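/- Let $k$ be a field. All dg categories are small, $k$-linear, with differential of degree $+1$. **Twisted tensor product.** For dg categories $C,D$ the dg category $C\tilde\otimes D$ has objects $\mathrm{Ob}(C)\times\mathrm{Ob}(D)$. It is the dg category generated by morphisms $f\otimes\mathrm{id}_d:(c_0,d)\to(c_1,d)$ of degree $|f|$, $\mathrm{id}_c\otimes g:(c,d_0)\to(c,d_1)$ of degree $|g|$, and $\varepsilon(f;g_1,\dots,g_n):(c_0,d_0)\to(c_1,d_n)$ of degree $|f|+\sum_i(|g_i|-1)$, for $n\ge 1$ and homogeneous $c_0\xrightarrow{f}c_1$ in $C$, $d_0\xrightarrow{g_1}\cdots\xrightarrow{g_n}d_n$ in $D$, subject to the following relations. (Write $\varepsilon(f;\,)=f\otimes\mathrm{id}$ for $n=0$.) * $f\mapsto f\otimes\mathrm{id}_d$ and $g\mapsto\mathrm{id}_c\otimes g$ are dg functors $C\to C\tilde\otimes D$, $D\to C\tilde\otimes D$; $\varepsilon(f;g_1,\dots,g_n)$ is linear in each argument; for $n\ge1$ it vanishes if $f$ or some $g_i$ is an identity morphism. * $\varepsilon(f_2f_1;g_1,\dots,g_n)=\sum_{0\le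 m\le n}(-1)^{|f_1|\sum_{j>m}(|g_j|-1)}\,\varepsilon(f_2;g_{m+1},\dots,g_n)\,\varepsilon(f_1;g_1,\dots,g_m)$. * For $n\ge1$, $$\begin{aligned}d\varepsilon(f;g_1,\dots,g_n)={}&\varepsilon(df;g_1,\dots,g_n)-(-1)^{|f|}\Big[\sum_{j=1}^n(-1)^{\sum_{i>j}(|g_i|-1)}\varepsilon(f;\dots,dg_j,\dots)+\sum_{j=1}^{n-1}(-1)^{\sum_{i>j}(|g_i|-1)}\varepsilon(f;\dots,g_{j+1}g_j,\dots)\\&+(-1)^{|f||g_n|}(\mathrm{id}_{c_1}\otimes g_n)\,\varepsilon(f;g_1,\dots,g_{n-1})-(-1)^{\sum_{i\ge2}(|g_i|-1)}\varepsilon(f;g_2,\dots,g_n)\,(\mathrm{id}_{c_0}\otimes g_1)\Big].\end{aligned}$$ The construction $\tilde\otimes$ is functorial in both arguments. **Associator.** Consider dg functors $\alpha_{C,D,E}:(C\tilde\otimes D)\tilde\otimes E\to C\tilde\otimes(D\tilde\otimes E)$ that are the identity on objects and satisfy $$\begin{aligned} \alpha\big((\mathrm{id}\otimes\mathrm{id})\otimes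 h\big)&=\mathrm{id}\otimes(\mathrm{id}\otimes h),\qquad \alpha\big(\varepsilon(\mathrm{id}_X\otimes g;h_1,\dots,h_N)\big)=\mathrm{id}_X\otimes\varepsilon(g;h_1,\dots,h_N)\quad(N\ge0),\\ \alpha\big(\varepsilon(\varepsilon(f;g_1,\dots,g_m);h_1,\dots,h_N)\big)&=\sum_{0\le i_1\le j_1\le\dots\le i_m\le j_m\le N}(-1)^{\sum_{l=1}^m(|g_l|-1)\sum_{s>j_l}(|h_s|-1)}\\ &\qquad\varepsilon\big(f;h_1,\dots,h_{i_1},\varepsilon(g_1;h_{i_1+1},\dots,h_{j_1}),h_{j_1+1},\dots,h_{i_m},\varepsilon(g_m;h_{i_m+1},\dots,h_{j_m}),h_{j_m+1},\dots,h_N\big)\quad(m,N\ge0), \end{aligned}$$ where on the right $h_s$ stands for $\mathrm{id}\otimes h_s$, and $\varepsilon(g;\,)=g\otimes\mathrm{id}$. **Disks.** For $n\ge 0$ let $I_n$ be the $k$-linear span of the poset $\{0<1<\dots<n\}$, a dg category concentrated in degree $0$. A *2-disk* is a sequence $D=(n_1,\dots,n_l)$ with $l\ge1$ and all $n_i\ge1$;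 put $I_D=I_{n_l}\tilde\otimes(I_{n_{l-1}}\tilde\otimes(\cdots(I_{n_2}\tilde\otimes I_{n_1})\cdots))$. For a sequence $\mathbf D=(D_1,\dots,D_t)$ of 2-disks, $t\ge1$, let $[\mathbf D]=[D_1,\dots,D_t]$ be their concatenation in this order and $I_{\mathbf D}=I_{D_1,\dots,D_t}=I_{D_t}\tilde\otimes(I_{D_{t-1}}\tilde\otimes(\cdots(I_{D_2}\tilde\otimes I_{D_1})\cdots))$. For a sequence $\mathbf D^1,\dots,\mathbf D^r$, $r\ge1$, with $\mathbf D^i=(D^i_1,\dots,D^i_{t_i})$, $t_i\ge1$, let $I_{\mathbf D^1,\dots,\mathbf D^r}=I_{\mathbf D^r}\tilde\otimes(\cdots(I_{\mathbf D^2}\tilde\otimes I_{\mathbf D^1})\cdots)$. **The functors $\Upsilon$.** For 2-disks $D_1$ and $D_2=(n_1,\dots,n_l)$ let $\Upsilon(D_1,D_2):I_{D_2}\tilde\otimes I_{D_1}\to I_{[D_1,D_2]}$ be the composite of associators $$(I_{n_l}\tilde\otimes(\cdots\tilde\otimes I_{n_1}))\tilde\otimes I_{D_1}\to I_{n_l}\tilde\otimes\big((I_{n_{l-1}}\tilde\otimes(\cdots\tilde\otimes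 I_{n_1}))\tilde\otimes I_{D_1}\big)\to\cdots\to I_{n_l}\tilde\otimes(I_{n_{l-1}}\tilde\otimes(\cdots\tilde\otimes(I_{n_1}\tilde\otimes I_{D_1})))$$ (the identity if $l=1$), and let $\Upsilon(D_1,\dots,D_t)$ be the composite $$I_{D_1,\dots,D_t}\to I_{[D_1,D_2],D_3,\dots,D_t}\to I_{[D_1,D_2,D_3],D_4,\dots,D_t}\to\cdots\to I_{[D_1,\dots,D_t]}$$ induced by the functors $\Upsilon(D',D'')$ (the identity if $t=1$). Let $$\tilde\Upsilon:I_{\mathbf D^1,\dots,\mathbf D^r}\to I_{D^1_1,\dots,D^1_{t_1},\dots,D^r_1,\dots,D^r_{t_r}}$$ be defined by the same construction, with the dg categories $I_{D^i_j}$ in place of the $I_{n}$. Define $$\Upsilon_1:I_{\mathbf D^1,\dots,\mathbf D^r}\xrightarrow{\ \Upsilon(\mathbf D^r)\tilde\otimes(\cdots(\Upsilon(\mathbf D^2)\tilde\otimes\Upsilon(\mathbf D^1))\cdots)\ }I_{[\mathbf D^1],\dots,[\mathbf D^r]}\xrightarrow{\ \Upsilon([\mathbf D^1],\dots,[\mathbf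 D^r])\ }I_{[[\mathbf D^1],\dots,[\mathbf D^r]]},$$ $$\Upsilon_2:I_{\mathbf D^1,\dots,\mathbf D^r}\xrightarrow{\ \tilde\Upsilon\ }I_{D^1_1,\dots,D^r_{t_r}}\xrightarrow{\ \Upsilon(D^1_1,\dots,D^r_{t_r})\ }I_{[D^1_1,\dots,D^r_{t_r}]}=I_{[[\mathbf D^1],\dots,[\mathbf D^r]]}.$$ **Proposition.** For all dg categories $C,D,E$ there is exactly one dg functor $\alpha_{C,D,E}$ as above. With $\Upsilon_1,\Upsilon_2$ built from these associators, $\Upsilon_1=\Upsilon_2$ for every $r\ge1$ and all sequences $\mathbf D^1,\dots,\mathbf D^r$ of 2-disks. -/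

import Mathlib

open CategoryTheory

universe u

namespace TwistedTensor

/-! ### Small dg categories and dg functors -/

/-- A small dg category over a field `k` (cohomological grading, `d` of degree `+1`).
`Hom x y n` is the degree `n` part of the complex of morphisms `x ⟶ y`. Composition and
differential take a proof that the degrees add up, so that no casts between degrees are needed. -/
structure DGCat (k : Type u) [Field k] where
  Obj : Type u
  Hom : Obj → Obj → ℤ → Type u
  [addCommGroup : ∀ x y n, AddCommGroup (Hom x y n)]
  [module : ∀ x y n, Module k (Hom x y n)]
  id : ∀ x, Hom x x 0
  comp : ∀ {x y z : Obj} {m n p : ℤ}, m + n = p → (Hom y z m →ₗ[k] Hom x y n →ₗ[k] Hom x z p)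
  d : ∀ {x y : Obj} {n p : ℤ}, n + 1 = p → (Hom x y n →ₗ[k] Hom x y p)
  id_comp : ∀ {x y : Obj} {n : ℤ} (f : Hom x y n), comp (zero_add n) (id y) f = f
  comp_id : ∀ {x y : Obj} {n : ℤ} (f : Hom x y n), comp (add_zero n) f (id x) = f
  assoc : ∀ {w x y z : Obj} {l m n lm mn p : ℤ} (h : Hom y z l) (g : Hom x y m) (f : Hom w x n)
    (hlm : l + m = lm) (hmn : m + n = mn) (h₁ : lm + n = p) (h₂ : l + mn = p),
    comp h₁ (comp hlm h g) f = comp h₂ h (comp hmn g f)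
  d_d : ∀ {x y : Obj} {n p q : ℤ} (hp : n + 1 = p) (hq : p + 1 = q) (f : Hom x y n),
    d hq (d hp f) = 0
  leibniz : ∀ {x y z : Obj} {m n p m' n' q : ℤ} (g : Hom y z m) (f : Hom x y n)
    (hp : m + n = p) (hq : p + 1 = q) (hm : m + 1 = m') (hn : n + 1 = n')
    (h₁ : m' + n = q) (h₂ : m + n' = q),
    d hq (comp hp g f) = comp h₁ (d hm g) f + m.negOnePow • comp h₂ g (d hn f)

attribute [instance] DGCat.addCommGroup DGCat.module

variable {k : Type u} [Field k]

/-- A dg functor: linear maps of degree `0` on morphisms, compatible with identities,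
compositions and differentials. -/
@[ext]
structure DGFunctor (C D : DGCat.{u} k) where
  obj : C.Obj → D.Obj
  map : ∀ {x y : C.Obj} {n : ℤ}, C.Hom x y n →ₗ[k] D.Hom (obj x) (obj y) n
  map_id : ∀ x, map (C.id x) = D.id (obj x)
  map_comp : ∀ {x y z : C.Obj} {m n p : ℤ} (h : m + n = p) (g : C.Hom y z m) (f : C.Hom x y n),
    map (C.comp h g f) = D.comp h (map g) (map f)
  map_d : ∀ {x y : C.Obj} {n p : ℤ} (h : n + 1 = p) (f : C.Hom x y n),
    map (C.d h f) = D.d h (map f)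

/-- The category of small dg categories over `k`. -/
instance : Category (DGCat.{u} k) where
  Hom := DGFunctor
  id C :=
    { obj := fun x => x
      map := LinearMap.id
      map_id := fun _ => rfl
      map_comp := fun _ _ _ => rfl
      map_d := fun _ _ => rfl }
  comp F G :=
    { obj := fun x => G.obj (F.obj x)
      map := G.map ∘ₗ F.map
      map_id := fun x => by simp [F.map_id, G.map_id]
      map_comp := fun h g f => by simp [F.map_comp, G.map_comp]
      map_d := fun h f => by simp [F.map_d, G.map_d] }

/-! ### Chains of composable morphisms -/

/-- The sign `(-1) ^ n` as an element of `k`. -/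
def sgn (k : Type u) [Field k] (n : ℤ) : k := ((n.negOnePow : ℤ) : k)

/-- Chains `x = d₀ → d₁ → ⋯ → dₙ = y` of `n ≥ 0` composable homogeneous morphisms
`g₁, …, gₙ` of a dg category. `cons g s` appends `g` as the last morphism `gₙ` of the chain. -/
inductive Chain (D : DGCat.{u} k) (x : D.Obj) : D.Obj → Type u
  | nil : Chain D x x
  | cons {y z : D.Obj} {m : ℤ} (g : D.Hom y z m) (s : Chain D x y) : Chain D x z

namespace Chain

variable {D D' : DGCat.{u} k}

/-- The shifted degree `∑ (|gᵢ| - 1)` of a chain. -/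
def sdeg {x : D.Obj} : ∀ {y : D.Obj}, Chain D x y → ℤ
  | _, nil => 0
  | _, cons (m := m) _ s => (m - 1) + s.sdeg

/-- Concatenation; the morphisms of the second argument come first. -/
def append {x y : D.Obj} : ∀ {z : D.Obj}, Chain D y z → Chain D x y → Chain D x z
  | _, nil, t => t
  | _, cons g s, t => cons g (s.append t)

theorem nil_append {x y : D.Obj} (t : Chain D x y) : nil.append t = t := rfl

theorem sdeg_append {x y : D.Obj} : ∀ {z : D.Obj} (s : Chain D y z) (t : Chain D x y),
    (s.append t).sdeg = s.sdeg + t.sdeg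
  | _, nil, t => by simp [append, sdeg]
  | _, cons g s, t => by simp [append, sdeg, sdeg_append s t]; ring

/-- The image of a chain under a dg functor. -/
def map (F : DGFunctor D D') {x : D.Obj} :
    ∀ {y : D.Obj}, Chain D x y → Chain D' (F.obj x) (F.obj y)
  | _, nil => nil
  | _, cons g s => cons (F.map g) (s.map F)

theorem sdeg_map (F : DGFunctor D D') {x : D.Obj} : ∀ {y : D.Obj} (s : Chain D x y),
    (s.map F).sdeg = s.sdeg
  | _, nil => rfl
  | _, cons g s => by simp [map, sdeg, sdeg_map F s]

theorem map_append (F : DGFunctor D D') {x y : D.Obj} :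
    ∀ {z : D.Obj} (s : Chain D y z) (t : Chain D x y),
      (s.append t).map F = (s.map F).append (t.map F)
  | _, nil, _ => rfl
  | _, cons g s, t => by simp [map, append, map_append F s t]

end Chain

/-- A way to cut the chain `g₁, …, gₙ` into `right = (g₁, …, gₘ)` and
`left = (gₘ₊₁, …, gₙ)`, `0 ≤ m ≤ n`. -/
structure Split {D : DGCat.{u} k} {x z : D.Obj} (s : Chain D x z) where
  mid : D.Obj
  left : Chain D mid z
  right : Chain D x mid
  append_eq : left.append right = s

theorem Split.deg {D : DGCat.{u} k} {x z : D.Obj} {s : Chain D x z} (t : Split s) :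
    t.left.sdeg + t.right.sdeg = s.sdeg := by
  rw [← Chain.sdeg_append, t.append_eq]

/-- The list of all `n + 1` ways to cut a chain of length `n`. -/
def Chain.splits {D : DGCat.{u} k} {x : D.Obj} :
    ∀ {z : D.Obj} (s : Chain D x z), List (Split s)
  | _, .nil => [⟨x, .nil, .nil, Chain.nil_append _⟩]
  | z, .cons g s =>
      ⟨z, .nil, .cons g s, Chain.nil_append _⟩ ::
        s.splits.map fun t => ⟨t.mid, .cons g t.left, t.right, by
          rw [Chain.append, t.append_eq]⟩

/-- A chain of shifted degree `q` with a coefficient. Lists of such terms are formal linear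
combinations of chains. -/
structure Term (D : DGCat.{u} k) (x y : D.Obj) (q : ℤ) where
  coeff : k
  chain : Chain D x y
  deg : chain.sdeg = q

/-- The term `(-1) ^ (|gₙ| - 1) (g₁, …, gₙ gₙ₋₁)` (no term if `n = 1`). -/
def mergeTerms {D : DGCat.{u} k} {x : D.Obj} :
    ∀ {y z : D.Obj} {m : ℤ} (g : D.Hom y z m) (s : Chain D x y),
      List (Term D x z ((Chain.cons g s).sdeg + 1))
  | _, _, _, _, .nil => []
  | _, _, m, g, .cons g' s' => [⟨sgn k (m - 1), .cons (D.comp rfl g g') s', by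
      simp only [Chain.sdeg]; ring⟩]

/-- The differential of the bar construction: the formal sum
`∑ⱼ (-1) ^ (∑_{i > j} (|gᵢ| - 1)) (g₁, …, d gⱼ, …, gₙ)
  + ∑_{j < n} (-1) ^ (∑_{i > j} (|gᵢ| - 1)) (g₁, …, gⱼ₊₁ gⱼ, …, gₙ)`. -/
def Chain.bar {D : DGCat.{u} k} {x : D.Obj} :
    ∀ {z : D.Obj} (s : Chain D x z), List (Term D x z (s.sdeg + 1))
  | _, .nil => []
  | _, .cons (m := m) g s =>
      ⟨1, .cons (D.d rfl g) s, by simp only [Chain.sdeg]; ring⟩ :: mergeTerms g s ++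
        s.bar.map fun t => ⟨sgn k (m - 1) * t.coeff, .cons g t.chain, by
          have := t.deg
          simp only [Chain.sdeg, this]; ring⟩

/-! ### The twisted tensor product -/

/-- Homogeneous expressions for morphisms of the twisted tensor product of `C` and `D`, built from
the generators `right c g = id_c ⊗ g` and `eps f (g₁, …, gₙ) = ε(f; g₁, …, gₙ)`, `n ≥ 0`, of degree
`|f| + ∑ (|gᵢ| - 1)`. For the empty chain at `x`, `eps f nil` is `f ⊗ id_x`. -/
inductive Expr (C D : DGCat.{u} k) : C.Obj × D.Obj → C.Obj × D.Obj → ℤ → Type u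
  | zero {x y : C.Obj × D.Obj} {n : ℤ} : Expr C D x y n
  | add {x y : C.Obj × D.Obj} {n : ℤ} (a b : Expr C D x y n) : Expr C D x y n
  | smul {x y : C.Obj × D.Obj} {n : ℤ} (r : k) (a : Expr C D x y n) : Expr C D x y n
  | id (x : C.Obj × D.Obj) : Expr C D x x 0
  | comp {x y z : C.Obj × D.Obj} {m n p : ℤ} (h : m + n = p)
      (b : Expr C D y z m) (a : Expr C D x y n) : Expr C D x z p
  | d {x y : C.Obj × D.Obj} {n p : ℤ} (h : n + 1 = p) (a : Expr C D x y n) : Expr C D x y p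
  | right (c : C.Obj) {d₀ d₁ : D.Obj} {n : ℤ} (g : D.Hom d₀ d₁ n) : Expr C D (c, d₀) (c, d₁) n
  | eps {c₀ c₁ : C.Obj} {d₀ d₁ : D.Obj} {m p : ℤ} (f : C.Hom c₀ c₁ m) (s : Chain D d₀ d₁)
      (h : m + s.sdeg = p) : Expr C D (c₀, d₀) (c₁, d₁) p

/-- The sum of a list of expressions. -/
def Expr.sum {C D : DGCat.{u} k} {x y : C.Obj × D.Obj} {n : ℤ} :
    List (Expr C D x y n) → Expr C D x y n
  | [] => .zero
  | a :: l => .add a (Expr.sum l)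

/-- The smallest congruence on expressions that contains the axioms of a dg category and the
defining relations of the twisted tensor product. -/
inductive Rel (C D : DGCat.{u} k) :
    ∀ {x y : C.Obj × D.Obj} {n : ℤ}, Expr C D x y n → Expr C D x y n → Prop
  -- congruence
  | refl {x y : C.Obj × D.Obj} {n : ℤ} (a : Expr C D x y n) : Rel C D a a
  | symm {x y : C.Obj × D.Obj} {n : ℤ} {a b : Expr C D x y n} : Rel C D a b → Rel C D b a
  | trans {x y : C.Obj × D.Obj} {n : ℤ} {a b c : Expr C D x y n} :
      Rel C D a b → Rel C D b c → Rel C D a c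
  | add_congr {x y : C.Obj × D.Obj} {n : ℤ} {a a' b b' : Expr C D x y n} :
      Rel C D a a' → Rel C D b b' → Rel C D (.add a b) (.add a' b')
  | smul_congr {x y : C.Obj × D.Obj} {n : ℤ} (r : k) {a a' : Expr C D x y n} :
      Rel C D a a' → Rel C D (.smul r a) (.smul r a')
  | comp_congr {x y z : C.Obj × D.Obj} {m n p : ℤ} (h : m + n = p)
      {b b' : Expr C D y z m} {a a' : Expr C D x y n} :
      Rel C D b b' → Rel C D a a' → Rel C D (.comp h b a) (.comp h b' a')
  | d_congr {x y : C.Obj × D.Obj} {n p : ℤ} (h : n + 1 = p) {a a' : Expr C D x y n} :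
      Rel C D a a' → Rel C D (.d h a) (.d h a')
  -- the morphisms of a given degree form a `k`-vector space
  | add_assoc {x y : C.Obj × D.Obj} {n : ℤ} (a b c : Expr C D x y n) :
      Rel C D (.add (.add a b) c) (.add a (.add b c))
  | add_comm {x y : C.Obj × D.Obj} {n : ℤ} (a b : Expr C D x y n) :
      Rel C D (.add a b) (.add b a)
  | zero_add {x y : C.Obj × D.Obj} {n : ℤ} (a : Expr C D x y n) : Rel C D (.add .zero a) a
  | smul_add {x y : C.Obj × D.Obj} {n : ℤ} (r : k) (a b : Expr C D x y n) :
      Rel C D (.smul r (.add a b)) (.add (.smul r a) (.smul r b))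
  | add_smul {x y : C.Obj × D.Obj} {n : ℤ} (r s : k) (a : Expr C D x y n) :
      Rel C D (.smul (r + s) a) (.add (.smul r a) (.smul s a))
  | mul_smul {x y : C.Obj × D.Obj} {n : ℤ} (r s : k) (a : Expr C D x y n) :
      Rel C D (.smul (r * s) a) (.smul r (.smul s a))
  | one_smul {x y : C.Obj × D.Obj} {n : ℤ} (a : Expr C D x y n) : Rel C D (.smul 1 a) a
  | zero_smul {x y : C.Obj × D.Obj} {n : ℤ} (a : Expr C D x y n) : Rel C D (.smul 0 a) .zero
  -- composition is bilinear, the differential is linear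
  | comp_add {x y z : C.Obj × D.Obj} {m n p : ℤ} (h : m + n = p)
      (b : Expr C D y z m) (a a' : Expr C D x y n) :
      Rel C D (.comp h b (.add a a')) (.add (.comp h b a) (.comp h b a'))
  | add_comp {x y z : C.Obj × D.Obj} {m n p : ℤ} (h : m + n = p)
      (b b' : Expr C D y z m) (a : Expr C D x y n) :
      Rel C D (.comp h (.add b b') a) (.add (.comp h b a) (.comp h b' a))
  | comp_smul {x y z : C.Obj × D.Obj} {m n p : ℤ} (h : m + n = p) (r : k)
      (b : Expr C D y z m) (a : Expr C D x y n) :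
      Rel C D (.comp h b (.smul r a)) (.smul r (.comp h b a))
  | smul_comp {x y z : C.Obj × D.Obj} {m n p : ℤ} (h : m + n = p) (r : k)
      (b : Expr C D y z m) (a : Expr C D x y n) :
      Rel C D (.comp h (.smul r b) a) (.smul r (.comp h b a))
  | d_add {x y : C.Obj × D.Obj} {n p : ℤ} (h : n + 1 = p) (a b : Expr C D x y n) :
      Rel C D (.d h (.add a b)) (.add (.d h a) (.d h b))
  | d_smul {x y : C.Obj × D.Obj} {n p : ℤ} (h : n + 1 = p) (r : k) (a : Expr C D x y n) :
      Rel C D (.d h (.smul r a)) (.smul r (.d h a))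
  -- the axioms of a dg category
  | id_comp {x y : C.Obj × D.Obj} {n : ℤ} (h : 0 + n = n) (a : Expr C D x y n) :
      Rel C D (.comp h (.id y) a) a
  | comp_id {x y : C.Obj × D.Obj} {n : ℤ} (h : n + 0 = n) (a : Expr C D x y n) :
      Rel C D (.comp h a (.id x)) a
  | comp_assoc {w x y z : C.Obj × D.Obj} {l m n lm mn p : ℤ}
      (c : Expr C D y z l) (b : Expr C D x y m) (a : Expr C D w x n)
      (hlm : l + m = lm) (hmn : m + n = mn) (h₁ : lm + n = p) (h₂ : l + mn = p) :
      Rel C D (.comp h₁ (.comp hlm c b) a) (.comp h₂ c (.comp hmn b a))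
  | d_d {x y : C.Obj × D.Obj} {n p q : ℤ} (hp : n + 1 = p) (hq : p + 1 = q)
      (a : Expr C D x y n) : Rel C D (.d hq (.d hp a)) .zero
  | leibniz {x y z : C.Obj × D.Obj} {m n p m' n' q : ℤ}
      (b : Expr C D y z m) (a : Expr C D x y n)
      (hp : m + n = p) (hq : p + 1 = q) (hm : m + 1 = m') (hn : n + 1 = n')
      (h₁ : m' + n = q) (h₂ : m + n' = q) :
      Rel C D (.d hq (.comp hp b a))
        (.add (.comp h₁ (.d hm b) a) (.smul (sgn k m) (.comp h₂ b (.d hn a))))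
  -- `g ↦ id_c ⊗ g` is a dg functor
  | right_add (c : C.Obj) {d₀ d₁ : D.Obj} {n : ℤ} (g g' : D.Hom d₀ d₁ n) :
      Rel C D (.right c (g + g')) (.add (.right c g) (.right c g'))
  | right_smul (c : C.Obj) {d₀ d₁ : D.Obj} {n : ℤ} (r : k) (g : D.Hom d₀ d₁ n) :
      Rel C D (.right c (r • g)) (.smul r (.right c g))
  | right_id (c : C.Obj) (x : D.Obj) : Rel C D (.right c (D.id x)) (.id (c, x))
  | right_comp (c : C.Obj) {d₀ d₁ d₂ : D.Obj} {m n p : ℤ} (h : m + n = p)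
      (g : D.Hom d₁ d₂ m) (g' : D.Hom d₀ d₁ n) :
      Rel C D (.right c (D.comp h g g')) (.comp h (.right c g) (.right c g'))
  | d_right (c : C.Obj) {d₀ d₁ : D.Obj} {n p : ℤ} (h : n + 1 = p) (g : D.Hom d₀ d₁ n) :
      Rel C D (.d h (.right c g)) (.right c (D.d h g))
  -- `ε(f; g₁, …, gₙ)` is linear in each argument
  | eps_add {c₀ c₁ : C.Obj} {d₀ d₁ : D.Obj} {m p : ℤ} (f f' : C.Hom c₀ c₁ m)
      (s : Chain D d₀ d₁) (h : m + s.sdeg = p) :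
      Rel C D (.eps (f + f') s h) (.add (.eps f s h) (.eps f' s h))
  | eps_smul {c₀ c₁ : C.Obj} {d₀ d₁ : D.Obj} {m p : ℤ} (r : k) (f : C.Hom c₀ c₁ m)
      (s : Chain D d₀ d₁) (h : m + s.sdeg = p) :
      Rel C D (.eps (r • f) s h) (.smul r (.eps f s h))
  | eps_chain_add {c₀ c₁ : C.Obj} {d₀ d₁ d₂ d₃ : D.Obj} {m n p : ℤ} (f : C.Hom c₀ c₁ m)
      (l : Chain D d₂ d₃) (g g' : D.Hom d₁ d₂ n) (s : Chain D d₀ d₁)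
      (h : m + (l.append (.cons (g + g') s)).sdeg = p)
      (h₁ : m + (l.append (.cons g s)).sdeg = p) (h₂ : m + (l.append (.cons g' s)).sdeg = p) :
      Rel C D (.eps f (l.append (.cons (g + g') s)) h)
        (.add (.eps f (l.append (.cons g s)) h₁) (.eps f (l.append (.cons g' s)) h₂))
  | eps_chain_smul {c₀ c₁ : C.Obj} {d₀ d₁ d₂ d₃ : D.Obj} {m n p : ℤ} (f : C.Hom c₀ c₁ m)
      (l : Chain D d₂ d₃) (r : k) (g : D.Hom d₁ d₂ n) (s : Chain D d₀ d₁)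
      (h : m + (l.append (.cons (r • g) s)).sdeg = p)
      (h₁ : m + (l.append (.cons g s)).sdeg = p) :
      Rel C D (.eps f (l.append (.cons (r • g) s)) h) (.smul r (.eps f (l.append (.cons g s)) h₁))
  -- `id_c ⊗ id_x` is the identity; `ε` with `n ≥ 1` vanishes if an argument is an identity
  | eps_id_nil (c : C.Obj) (x : D.Obj) (h : 0 + (Chain.nil : Chain D x x).sdeg = 0) :
      Rel C D (.eps (C.id c) (.nil : Chain D x x) h) (.id (c, x))
  | eps_id_cons (c : C.Obj) {d₀ d₁ d₂ : D.Obj} {n p : ℤ} (g : D.Hom d₁ d₂ n) (s : Chain D d₀ d₁)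
      (h : 0 + (Chain.cons g s).sdeg = p) :
      Rel C D (.eps (C.id c) (.cons g s) h) .zero
  | eps_chain_id {c₀ c₁ : C.Obj} {d₀ d₁ d₂ : D.Obj} {m p : ℤ} (f : C.Hom c₀ c₁ m)
      (l : Chain D d₁ d₂) (s : Chain D d₀ d₁)
      (h : m + (l.append (.cons (D.id d₁) s)).sdeg = p) :
      Rel C D (.eps f (l.append (.cons (D.id d₁) s)) h) .zero
  -- `ε(f₂ f₁; g₁, …, gₙ) =`
  -- `∑_{0 ≤ i ≤ n} (-1) ^ (|f₁| ∑_{j > i} (|gⱼ| - 1)) ε(f₂; gᵢ₊₁, …, gₙ) ε(f₁; g₁, …, gᵢ)`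
  | eps_comp {c₀ c₁ c₂ : C.Obj} {d₀ d₁ : D.Obj} {m₁ m₂ m p : ℤ}
      (f₂ : C.Hom c₁ c₂ m₂) (f₁ : C.Hom c₀ c₁ m₁) (s : Chain D d₀ d₁)
      (hm : m₂ + m₁ = m) (h : m + s.sdeg = p) :
      Rel C D (.eps (C.comp hm f₂ f₁) s h)
        (Expr.sum (s.splits.map fun t => .smul (sgn k (m₁ * t.left.sdeg))
          (.comp (by have := t.deg; omega) (.eps f₂ t.left rfl) (.eps f₁ t.right rfl))))
  -- `d (f ⊗ id_x) = d f ⊗ id_x`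
  | d_eps_nil {c₀ c₁ : C.Obj} {m p q m' : ℤ} (f : C.Hom c₀ c₁ m) (x : D.Obj)
      (h : m + (Chain.nil : Chain D x x).sdeg = p) (hq : p + 1 = q) (hm : m + 1 = m')
      (h' : m' + (Chain.nil : Chain D x x).sdeg = q) :
      Rel C D (.d hq (.eps f (.nil : Chain D x x) h)) (.eps (C.d hm f) (.nil : Chain D x x) h')
  -- for `n ≥ 1`, with `(g₁, …, gₙ) = cons g s` (so `g = gₙ`) and also `g' = g₁`:
  -- `d ε(f; g₁, …, gₙ) = ε(d f; g₁, …, gₙ) - (-1) ^ |f| [ε(f; bar (g₁, …, gₙ))`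
  -- `  + (-1) ^ (|f| |gₙ|) (id ⊗ gₙ) ε(f; g₁, …, gₙ₋₁)`
  -- `  - (-1) ^ (∑_{i ≥ 2} (|gᵢ| - 1)) ε(f; g₂, …, gₙ) (id ⊗ g₁)]`
  | d_eps_cons {c₀ c₁ : C.Obj} {d₀ d₁ e₀ e₁ : D.Obj} {m m' n n' p q : ℤ} (f : C.Hom c₀ c₁ m)
      (g : D.Hom e₁ d₁ n) (s : Chain D d₀ e₁) (s' : Chain D e₀ d₁) (g' : D.Hom d₀ e₀ n')
      (hs : Chain.cons g s = s'.append (.cons g' .nil))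
      (h : m + (Chain.cons g s).sdeg = p) (hq : p + 1 = q) (hm : m + 1 = m') :
      Rel C D (.d hq (.eps f (.cons g s) h))
        (.add (.eps (C.d hm f) (.cons g s) (by omega))
          (.smul (-sgn k m)
            (.add (Expr.sum ((Chain.cons g s).bar.map fun t =>
                .smul t.coeff (.eps f t.chain (by have := t.deg; omega))))
              (.add
                (.smul (sgn k (m * n)) (.comp (by simp only [Chain.sdeg] at h; omega)
                  (.right c₁ g) (.eps f s rfl)))
                (.smul (-sgn k s'.sdeg) (.comp (by
                    have h' := congrArg Chain.sdeg hs
                    rw [Chain.sdeg_append] at h'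
                    simp only [Chain.sdeg] at h' h
                    omega)
                  (.eps f s' rfl) (.right c₀ g')))))))

namespace Expr

variable (C D : DGCat.{u} k)

/-- Expressions up to the relations. -/
instance setoid (x y : C.Obj × D.Obj) (n : ℤ) : Setoid (Expr C D x y n) where
  r := Rel C D
  iseqv := ⟨.refl, .symm, .trans⟩

variable {C D}

theorem rel_of_eq {x y : C.Obj × D.Obj} {n : ℤ} {a b : Expr C D x y n} (h : a = b) :
    Rel C D a b := h ▸ .refl a

theorem comp_eps_eps {c₀ c₁ c₂ : C.Obj} {d₀ d₁ d₂ : D.Obj} {m n m₁ n₁ m₂ n₂ p : ℤ}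
    (f : C.Hom c₁ c₂ m) (s : Chain D d₁ d₂) (f' : C.Hom c₀ c₁ n) (s' : Chain D d₀ d₁)
    (h₁ : m + s.sdeg = m₁) (h₁' : n + s'.sdeg = n₁) (h₂ : m + s.sdeg = m₂)
    (h₂' : n + s'.sdeg = n₂) (h : m₁ + n₁ = p) (h' : m₂ + n₂ = p) :
    Expr.comp h (.eps f s h₁) (.eps f' s' h₁') = Expr.comp h' (.eps f s h₂) (.eps f' s' h₂') := by
  subst h₁ h₁' h₂ h₂'
  rfl

theorem comp_right_eps {c₀ c₁ : C.Obj} {d₀ d₁ d₂ : D.Obj} {m n n₁ n₂ p : ℤ}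
    (g : D.Hom d₁ d₂ m) (f' : C.Hom c₀ c₁ n) (s' : Chain D d₀ d₁)
    (h₁' : n + s'.sdeg = n₁) (h₂' : n + s'.sdeg = n₂) (h : m + n₁ = p) (h' : m + n₂ = p) :
    Expr.comp h (.right c₁ g) (.eps f' s' h₁') = Expr.comp h' (.right c₁ g) (.eps f' s' h₂') := by
  subst h₁' h₂'
  rfl

theorem comp_eps_right {c₁ c₂ : C.Obj} {d₀ d₁ d₂ : D.Obj} {m n m₁ m₂ p : ℤ}
    (f : C.Hom c₁ c₂ m) (s : Chain D d₁ d₂) (g : D.Hom d₀ d₁ n)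
    (h₁ : m + s.sdeg = m₁) (h₂ : m + s.sdeg = m₂) (h : m₁ + n = p) (h' : m₂ + n = p) :
    Expr.comp h (.eps f s h₁) (.right c₁ g) = Expr.comp h' (.eps f s h₂) (.right c₁ g) := by
  subst h₁ h₂
  rfl

end Expr

/-- The space of morphisms of degree `n` in the twisted tensor product. -/
def THom (C D : DGCat.{u} k) (x y : C.Obj × D.Obj) (n : ℤ) : Type u :=
  Quotient (Expr.setoid C D x y n)

namespace THom

variable {C D : DGCat.{u} k} {x y : C.Obj × D.Obj} {n : ℤ}

instance : Zero (THom C D x y n) := ⟨Quotient.mk _ .zero⟩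

instance : Add (THom C D x y n) :=
  ⟨Quotient.map₂ .add fun _ _ h _ _ h' => Rel.add_congr h h'⟩

instance : SMul k (THom C D x y n) :=
  ⟨fun r => Quotient.map (.smul r) fun _ _ h => Rel.smul_congr r h⟩

instance : Neg (THom C D x y n) := ⟨fun a => (-1 : k) • a⟩

instance : AddCommGroup (THom C D x y n) where
  add_assoc a b c := by
    refine Quotient.inductionOn₃ a b c fun a b c => Quotient.sound (Rel.add_assoc a b c)
  zero_add a := Quotient.inductionOn a fun a => Quotient.sound (Rel.zero_add a)
  add_zero a := Quotient.inductionOn a fun a =>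
    Quotient.sound ((Rel.add_comm _ _).trans (Rel.zero_add a))
  add_comm a b := Quotient.inductionOn₂ a b fun a b => Quotient.sound (Rel.add_comm a b)
  neg_add_cancel a := by
    refine Quotient.inductionOn a fun a => Quotient.sound ?_
    refine (Rel.add_congr (.refl _) (Rel.one_smul a).symm).trans ?_
    refine (Rel.add_smul (-1) 1 a).symm.trans ?_
    rw [neg_add_cancel]
    exact Rel.zero_smul a
  nsmul := nsmulRec
  zsmul := zsmulRec

instance : Module k (THom C D x y n) where
  one_smul a := Quotient.inductionOn a fun a => Quotient.sound (Rel.one_smul a)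
  mul_smul r s a := Quotient.inductionOn a fun a => Quotient.sound (Rel.mul_smul r s a)
  smul_zero r := by
    refine Quotient.sound ?_
    refine (Rel.smul_congr r (Rel.zero_smul .zero).symm).trans ?_
    refine (Rel.mul_smul r 0 .zero).symm.trans ?_
    rw [mul_zero]
    exact Rel.zero_smul _
  smul_add r a b := Quotient.inductionOn₂ a b fun a b => Quotient.sound (Rel.smul_add r a b)
  add_smul r s a := Quotient.inductionOn a fun a => Quotient.sound (Rel.add_smul r s a)
  zero_smul a := Quotient.inductionOn a fun a => Quotient.sound (Rel.zero_smul a)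

end THom

theorem negOnePow_smul {M : Type u} [AddCommGroup M] [Module k M] (m : ℤ) (a : M) :
    m.negOnePow • a = sgn k m • a := by
  rw [sgn, Int.cast_smul_eq_zsmul, Units.smul_def]

/-- The twisted tensor product of two small dg categories: the dg category presented by the
generators `id_c ⊗ g` and `ε(f; g₁, …, gₙ)` and the relations above. -/
def tensor (C D : DGCat.{u} k) : DGCat.{u} k where
  Obj := C.Obj × D.Obj
  Hom := THom C D
  id x := Quotient.mk _ (.id x)
  comp {x y z m n p} h := LinearMap.mk₂ k
    (Quotient.map₂ (Expr.comp h) fun _ _ hb _ _ ha => Rel.comp_congr h hb ha)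
    (fun b b' a => Quotient.inductionOn₃ b b' a fun b b' a =>
      Quotient.sound (Rel.add_comp h b b' a))
    (fun r b a => Quotient.inductionOn₂ b a fun b a => Quotient.sound (Rel.smul_comp h r b a))
    (fun b a a' => Quotient.inductionOn₃ b a a' fun b a a' =>
      Quotient.sound (Rel.comp_add h b a a'))
    (fun r b a => Quotient.inductionOn₂ b a fun b a => Quotient.sound (Rel.comp_smul h r b a))
  d {x y n p} h :=
    { toFun := Quotient.map (Expr.d h) fun _ _ ha => Rel.d_congr h ha
      map_add' := fun a b => Quotient.inductionOn₂ a b fun a b =>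
        Quotient.sound (Rel.d_add h a b)
      map_smul' := fun r a => Quotient.inductionOn a fun a => Quotient.sound (Rel.d_smul h r a) }
  id_comp a := Quotient.inductionOn a fun a => Quotient.sound (Rel.id_comp _ a)
  comp_id a := Quotient.inductionOn a fun a => Quotient.sound (Rel.comp_id _ a)
  assoc c b a hlm hmn h₁ h₂ := Quotient.inductionOn₃ c b a fun c b a =>
    Quotient.sound (Rel.comp_assoc c b a hlm hmn h₁ h₂)
  d_d hp hq a := Quotient.inductionOn a fun a => Quotient.sound (Rel.d_d hp hq a)
  leibniz b a hp hq hm hn h₁ h₂ := by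
    rw [negOnePow_smul (k := k)]
    exact Quotient.inductionOn₂ b a fun b a =>
      Quotient.sound (Rel.leibniz b a hp hq hm hn h₁ h₂)

/-- The object `(c, d)` of the twisted tensor product. -/
def pair {C D : DGCat.{u} k} (c : C.Obj) (d : D.Obj) : (tensor C D).Obj := (c, d)

/-- The morphism `id_c ⊗ g` of the twisted tensor product. -/
def rightHom {C D : DGCat.{u} k} (c : C.Obj) {d₀ d₁ : D.Obj} {n : ℤ} (g : D.Hom d₀ d₁ n) :
    (tensor C D).Hom (pair c d₀) (pair c d₁) n :=
  Quotient.mk (Expr.setoid C D (c, d₀) (c, d₁) n) (.right c g)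

/-- The morphism `ε(f; g₁, …, gₙ)` of the twisted tensor product (`f ⊗ id` if `n = 0`). -/
def epsHom {C D : DGCat.{u} k} {c₀ c₁ : C.Obj} {d₀ d₁ : D.Obj} {m p : ℤ} (f : C.Hom c₀ c₁ m)
    (s : Chain D d₀ d₁) (h : m + s.sdeg = p) : (tensor C D).Hom (pair c₀ d₀) (pair c₁ d₁) p :=
  Quotient.mk (Expr.setoid C D (c₀, d₀) (c₁, d₁) p) (.eps f s h)

/-! ### Functoriality of the twisted tensor product -/

section Map

variable {C D C' D' : DGCat.{u} k} (F : DGFunctor C C') (G : DGFunctor D D')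

/-- The action of a pair of dg functors on expressions:
`id_c ⊗ g ↦ id_{F c} ⊗ G g` and `ε(f; g₁, …, gₙ) ↦ ε(F f; G g₁, …, G gₙ)`. -/
def Expr.map : ∀ {x y : C.Obj × D.Obj} {n : ℤ}, Expr C D x y n →
    Expr C' D' (F.obj x.1, G.obj x.2) (F.obj y.1, G.obj y.2) n
  | _, _, _, .zero => .zero
  | _, _, _, .add a b => .add a.map b.map
  | _, _, _, .smul r a => .smul r a.map
  | _, _, _, .id x => .id (F.obj x.1, G.obj x.2)
  | _, _, _, .comp h b a => .comp h b.map a.map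
  | _, _, _, .d h a => .d h a.map
  | _, _, _, .right c g => .right (F.obj c) (G.map g)
  | _, _, _, .eps f s h => .eps (F.map f) (s.map G) (by rw [Chain.sdeg_map]; exact h)

theorem Expr.map_sum {x y : C.Obj × D.Obj} {n : ℤ} : ∀ l : List (Expr C D x y n),
    (Expr.sum l).map F G = Expr.sum (l.map (Expr.map F G))
  | [] => rfl
  | a :: l => by simp [Expr.sum, Expr.map, Expr.map_sum l]

/-- The image of a cut of a chain. -/
def Split.map {x z : D.Obj} {s : Chain D x z} (t : Split s) : Split (s.map G) where
  mid := G.obj t.mid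
  left := t.left.map G
  right := t.right.map G
  append_eq := by rw [← Chain.map_append, t.append_eq]

theorem splits_map {x : D.Obj} : ∀ {z : D.Obj} (s : Chain D x z),
    (s.map G).splits = s.splits.map (Split.map G)
  | _, .nil => rfl
  | _, .cons g s => by
      refine congrArg₂ List.cons rfl ?_
      refine (congrArg (List.map _) (splits_map s)).trans ?_
      refine List.map_map.trans (Eq.trans ?_ List.map_map.symm)
      rfl

/-- The image of a term. -/
def Term.map {x y : D.Obj} {q q' : ℤ} (hq : q = q') (t : Term D x y q) :
    Term D' (G.obj x) (G.obj y) q' :=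
  ⟨t.coeff, t.chain.map G, by rw [Chain.sdeg_map, t.deg, hq]⟩

theorem mergeTerms_map {x : D.Obj} : ∀ {y z : D.Obj} {m : ℤ} (g : D.Hom y z m) (s : Chain D x y)
    (h : (Chain.cons g s).sdeg + 1 = ((Chain.cons g s).map G).sdeg + 1),
    mergeTerms (G.map g) (s.map G) = (mergeTerms g s).map (Term.map G h)
  | _, _, _, _, .nil, _ => rfl
  | _, _, _, g, .cons g' s', h => by
      simp [Chain.map, mergeTerms, Term.map, G.map_comp]

theorem bar_map {x : D.Obj} : ∀ {z : D.Obj} (s : Chain D x z)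
    (h : s.sdeg + 1 = (s.map G).sdeg + 1), (s.map G).bar = s.bar.map (Term.map G h)
  | _, .nil, _ => rfl
  | _, .cons g s, h => by
      have h' : s.sdeg + 1 = (s.map G).sdeg + 1 := by rw [Chain.sdeg_map]
      simp only [Chain.map, Chain.bar, bar_map s h', mergeTerms_map G g s h, List.map_map,
        List.map_append, List.map_cons]
      simp only [Term.map, Chain.map, G.map_d, Function.comp_def]

theorem Rel.map {x y : C.Obj × D.Obj} {n : ℤ} {a b : Expr C D x y n} (h : Rel C D a b) :
    Rel C' D' (a.map F G) (b.map F G) := by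
  induction h with
  | refl a => exact .refl _
  | symm _ ih => exact ih.symm
  | trans _ _ ih₁ ih₂ => exact ih₁.trans ih₂
  | add_congr _ _ ih₁ ih₂ => exact .add_congr ih₁ ih₂
  | smul_congr r _ ih => exact .smul_congr r ih
  | comp_congr h _ _ ih₁ ih₂ => exact .comp_congr h ih₁ ih₂
  | d_congr h _ ih => exact .d_congr h ih
  | add_assoc a b c => exact .add_assoc _ _ _
  | add_comm a b => exact .add_comm _ _
  | zero_add a => exact .zero_add _
  | smul_add r a b => exact .smul_add _ _ _
  | add_smul r s a => exact .add_smul _ _ _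
  | mul_smul r s a => exact .mul_smul _ _ _
  | one_smul a => exact .one_smul _
  | zero_smul a => exact .zero_smul _
  | comp_add h b a a' => exact .comp_add _ _ _ _
  | add_comp h b b' a => exact .add_comp _ _ _ _
  | comp_smul h r b a => exact .comp_smul _ _ _ _
  | smul_comp h r b a => exact .smul_comp _ _ _ _
  | d_add h a b => exact .d_add _ _ _
  | d_smul h r a => exact .d_smul _ _ _
  | id_comp h a => exact .id_comp _ _
  | comp_id h a => exact .comp_id _ _
  | comp_assoc c b a hlm hmn h₁ h₂ => exact .comp_assoc _ _ _ _ _ _ _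
  | d_d hp hq a => exact .d_d _ _ _
  | leibniz b a hp hq hm hn h₁ h₂ => exact .leibniz _ _ _ _ _ _ _ _
  | right_add c g g' => simpa only [Expr.map, map_add] using .right_add _ _ _
  | right_smul c r g => simpa only [Expr.map, map_smul] using .right_smul _ _ _
  | right_id c x => simpa only [Expr.map, G.map_id] using .right_id _ _
  | right_comp c h g g' => simpa only [Expr.map, G.map_comp] using .right_comp _ h _ _
  | d_right c h g => simpa only [Expr.map, G.map_d] using .d_right _ h _
  | eps_add f f' s h => simpa only [Expr.map, map_add] using .eps_add _ _ _ _
  | eps_smul r f s h => simpa only [Expr.map, map_smul] using .eps_smul _ _ _ _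
  | eps_chain_add f l g g' s h h₁ h₂ =>
      simp only [Expr.map, Chain.map_append, Chain.map, map_add]
      exact .eps_chain_add _ _ _ _ _ _ _ _
  | eps_chain_smul f l r g s h h₁ =>
      simp only [Expr.map, Chain.map_append, Chain.map, map_smul]
      exact .eps_chain_smul _ _ _ _ _ _ _
  | eps_id_nil c x h => simpa only [Expr.map, F.map_id] using .eps_id_nil _ _ _
  | eps_id_cons c g s h =>
      simp only [Expr.map, F.map_id, Chain.map]
      exact .eps_id_cons _ _ _ _
  | eps_chain_id f l s h =>
      simp only [Expr.map, Chain.map_append, Chain.map, G.map_id]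
      exact .eps_chain_id _ _ _ _
  | eps_comp f₂ f₁ s hm h =>
      have h₀ := h
      rw [← Chain.sdeg_map G] at h₀
      have h' := Rel.eps_comp (F.map f₂) (F.map f₁) (s.map G) hm h₀
      rw [splits_map] at h'
      simp only [Expr.map, F.map_comp, Expr.map_sum, List.map_map, Function.comp_def]
      rw [List.map_map] at h'
      refine h'.trans (Expr.rel_of_eq (congrArg Expr.sum (List.map_congr_left fun t _ => ?_)))
      simp only [Function.comp_def, Split.map]
      congr 1
      · rw [Chain.sdeg_map]
      · exact Expr.comp_eps_eps ..
  | d_eps_nil f x h hq hm h' =>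
      simp only [Expr.map, F.map_d, Chain.map]
      exact .d_eps_nil _ _ _ _ _ _
  | d_eps_cons f g s s' g' hs h hq hm =>
      have hs' := congrArg (Chain.map G) hs
      rw [Chain.map_append] at hs'
      have h' := Rel.d_eps_cons (F.map f) (G.map g) (s.map G) (s'.map G) (G.map g') hs'
        (by have := Chain.sdeg_map G (Chain.cons g s); simp only [Chain.map] at this; omega) hq hm
      have hb := bar_map G (.cons g s) (by rw [Chain.sdeg_map])
      simp only [Chain.map] at hb
      rw [hb] at h'
      rw [List.map_map] at h'
      simp only [Expr.map, F.map_d, Expr.map_sum, List.map_map, Function.comp_def]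
      refine h'.trans (Expr.rel_of_eq ?_)
      simp only [Function.comp_def, Term.map, Chain.map]
      refine congrArg₂ Expr.add rfl (congrArg (Expr.smul _) (congrArg₂ Expr.add rfl
        (congrArg₂ Expr.add (congrArg (Expr.smul _) (Expr.comp_right_eps ..)) ?_)))
      exact congrArg₂ Expr.smul (congrArg (fun i => -sgn k i) (Chain.sdeg_map G s'))
        (Expr.comp_eps_right ..)

/-- Functoriality of the twisted tensor product in both arguments. -/
def tensorMap {C D C' D' : DGCat.{u} k} (F : C ⟶ C') (G : D ⟶ D') :
    tensor C D ⟶ tensor C' D' where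
  obj x := pair (F.obj x.1) (G.obj x.2)
  map :=
    { toFun := Quotient.map (Expr.map F G) fun _ _ h => Rel.map F G h
      map_add' := fun a b => Quotient.inductionOn₂ a b fun _ _ => rfl
      map_smul' := fun _ a => Quotient.inductionOn a fun _ => rfl }
  map_id _ := rfl
  map_comp _ b a := Quotient.inductionOn₂ b a fun _ _ => rfl
  map_d _ a := Quotient.inductionOn a fun _ => rfl

end Map

/-! ### The associator -/

section Brace

variable {D E : DGCat.{u} k}

/-- The chain `id_d ⊗ h₁, …, id_d ⊗ h_N` in the twisted tensor product. -/
def rightChain (d : D.Obj) {e₀ : E.Obj} :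
    ∀ {e₁ : E.Obj}, Chain E e₀ e₁ → Chain (tensor D E) (pair d e₀) (pair d e₁)
  | _, .nil => .nil
  | _, .cons h hs => .cons (rightHom d h) (rightChain d hs)

theorem sdeg_rightChain (d : D.Obj) {e₀ : E.Obj} :
    ∀ {e₁ : E.Obj} (hs : Chain E e₀ e₁), (rightChain d hs).sdeg = hs.sdeg
  | _, .nil => rfl
  | _, .cons h hs => by simp [rightChain, Chain.sdeg, sdeg_rightChain d hs]

variable {d₀ d₁ d₂ : D.Obj} {n : ℤ}

/-- All terms of `brace (g₁, …, g_k) hs` (with `g = g_k`) whose last morphism is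
`ε(g; h_{j+1}, …, h_N)`, `0 ≤ j ≤ N`; `br` is `brace (g₁, …, g_{k-1})`. -/
def braceLast (g : D.Hom d₁ d₂ n) (gs : Chain D d₀ d₁)
    (br : ∀ {e₀ e₁ : E.Obj} (hs : Chain E e₀ e₁),
      List (Term (tensor D E) (pair d₀ e₀) (pair d₁ e₁) (gs.sdeg + hs.sdeg)))
    {e₀ e₁ : E.Obj} (hs : Chain E e₀ e₁) :
    List (Term (tensor D E) (pair d₀ e₀) (pair d₂ e₁) ((Chain.cons g gs).sdeg + hs.sdeg)) :=
  hs.splits.flatMap fun t => (br t.right).map fun w =>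
    ⟨sgn k (gs.sdeg * t.left.sdeg) * w.coeff, .cons (epsHom g t.left rfl) w.chain, by
      have := t.deg
      have := w.deg
      simp only [Chain.sdeg]
      omega⟩

/-- All terms of `brace (g₁, …, g_k) hs`, `k ≥ 1`, `g = g_k`: either the last morphism is
`id ⊗ h_N`, or it is `ε(g; h_{j+1}, …, h_N)` for some `0 ≤ j ≤ N`. -/
def braceCons (g : D.Hom d₁ d₂ n) (gs : Chain D d₀ d₁)
    (br : ∀ {e₀ e₁ : E.Obj} (hs : Chain E e₀ e₁),
      List (Term (tensor D E) (pair d₀ e₀) (pair d₁ e₁) (gs.sdeg + hs.sdeg))) {e₀ : E.Obj} :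
    ∀ {e₁ : E.Obj} (hs : Chain E e₀ e₁),
      List (Term (tensor D E) (pair d₀ e₀) (pair d₂ e₁) ((Chain.cons g gs).sdeg + hs.sdeg))
  | _, .nil => braceLast g gs br .nil
  | _, .cons (m := m) h hs =>
      ((braceCons g gs br hs).map fun w =>
        ⟨sgn k ((Chain.cons g gs).sdeg * (m - 1)) * w.coeff, .cons (rightHom d₂ h) w.chain, by
          have := w.deg
          simp only [Chain.sdeg] at this ⊢
          omega⟩) ++
      braceLast g gs br (.cons h hs)

/-- The formal sum, over all `0 ≤ i₁ ≤ j₁ ≤ i₂ ≤ j₂ ≤ ⋯ ≤ i_k ≤ j_k ≤ N`, of the chains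
`h₁, …, h_{i₁}, ε(g₁; h_{i₁+1}, …, h_{j₁}), h_{j₁+1}, …, h_{i₂}, ε(g₂; h_{i₂+1}, …, h_{j₂}), …, h_N`
in the twisted tensor product (where `h` stands for `id ⊗ h`, and `ε(g; ) = g ⊗ id`), with the sign
`(-1) ^ (∑_l (|g_l| - 1) ∑_{s > j_l} (|h_s| - 1))`. -/
def brace {d₀ : D.Obj} : ∀ {d₁ : D.Obj} (gs : Chain D d₀ d₁) {e₀ e₁ : E.Obj} (hs : Chain E e₀ e₁),
    List (Term (tensor D E) (pair d₀ e₀) (pair d₁ e₁) (gs.sdeg + hs.sdeg))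
  | _, .nil, _, _, hs => [⟨1, rightChain d₀ hs, by simp [sdeg_rightChain, Chain.sdeg]⟩]
  | _, .cons g gs, _, _, hs => braceCons g gs (fun hs' => brace gs hs') hs

end Brace

/-- The characterization of the associator as a dg functor
`(C ⊗ D) ⊗ E ⟶ C ⊗ (D ⊗ E)`: it is the identity on objects and is given on the generating morphisms
by the formulas below. (`HEq` only identifies `Hom (F x) (F y)` with `Hom x y` along `obj_eq`.) -/
structure IsAssociator {C D E : DGCat.{u} k}
    (F : tensor (tensor C D) E ⟶ tensor C (tensor D E)) : Prop where
  obj_eq : ∀ (c : C.Obj) (d : D.Obj) (e : E.Obj), F.obj (pair (pair c d) e) = pair c (pair d e)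
  /-- `(id ⊗ id) ⊗ h ↦ id ⊗ (id ⊗ h)` -/
  map_right : ∀ (c : C.Obj) (d : D.Obj) {e₀ e₁ : E.Obj} {n : ℤ} (h : E.Hom e₀ e₁ n),
    HEq (F.map (rightHom (C := tensor C D) (pair c d) h))
      (rightHom (D := tensor D E) c (rightHom (C := D) d h))
  /-- `ε(id ⊗ g; h₁, …, h_N) ↦ id ⊗ ε(g; h₁, …, h_N)`, `N ≥ 0`; for `N = 0` this is
  `(id ⊗ g) ⊗ id ↦ id ⊗ (g ⊗ id)` -/
  map_eps_right : ∀ (c : C.Obj) {d₀ d₁ : D.Obj} {e₀ e₁ : E.Obj} {n p : ℤ} (g : D.Hom d₀ d₁ n)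
    (hs : Chain E e₀ e₁) (hp : n + hs.sdeg = p),
    HEq (F.map (epsHom (C := tensor C D) (rightHom (C := C) c g) hs hp))
      (rightHom (D := tensor D E) c (epsHom g hs hp))
  /-- `ε(ε(f; g₁, …, g_k); h₁, …, h_N) ↦ ∑ ± ε(f; h₁, …, ε(g₁; …), …, ε(g_k; …), …, h_N)`,
  `k, N ≥ 0`. For `N = 0` this is `ε(f; g₁, …, g_k) ⊗ id ↦ ε(f; g₁ ⊗ id, …, g_k ⊗ id)`, and
  for `k = 0` it is `ε(f ⊗ id; h₁, …, h_N) ↦ ε(f; id ⊗ h₁, …, id ⊗ h_N)`. -/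
  map_eps_eps : ∀ {c₀ c₁ : C.Obj} {d₀ d₁ : D.Obj} {e₀ e₁ : E.Obj} {m q p : ℤ}
    (f : C.Hom c₀ c₁ m) (gs : Chain D d₀ d₁) (hs : Chain E e₀ e₁)
    (hq : m + gs.sdeg = q) (hp : q + hs.sdeg = p),
    HEq (F.map (epsHom (C := tensor C D) (epsHom f gs hq) hs hp))
      (((brace gs hs).map fun w =>
        w.coeff • epsHom f w.chain (p := p) (by have := w.deg; omega)).sum)

/-! ### Intervals and 2-disks -/

/-- The `k`-linear span of the poset `{0 < 1 < ⋯ < n}`: the space of morphisms `i ⟶ j` is `k`, in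
degree `0`, if `i ≤ j`, and zero otherwise. -/
def interval (k : Type u) [Field k] (n : ℕ) : DGCat.{u} k where
  Obj := ULift.{u} (Fin (n + 1))
  Hom i j m := ({ carrier := {a | a ≠ 0 → i.down ≤ j.down ∧ m = 0}
                  add_mem' := by
                    intro a b ha hb hab
                    by_cases h : a = 0
                    · exact hb fun h' => hab (by simp [h, h'])
                    · exact ha h
                  zero_mem' := fun h => absurd rfl h
                  smul_mem' := fun r a ha hr => ha fun h => hr (by simp [h]) } : Submodule k k)
  id i := ⟨1, fun _ => ⟨le_rfl, rfl⟩⟩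
  comp h := LinearMap.mk₂ k (fun b a => ⟨b.1 * a.1, fun hba => by
      have hb := b.2 (left_ne_zero_of_mul hba)
      have ha := a.2 (right_ne_zero_of_mul hba)
      exact ⟨ha.1.trans hb.1, by omega⟩⟩)
    (fun _ _ _ => Subtype.ext (add_mul _ _ _)) (fun _ _ _ => Subtype.ext (mul_assoc _ _ _))
    (fun _ _ _ => Subtype.ext (mul_add _ _ _))
    (fun _ _ _ => Subtype.ext (mul_left_comm _ _ _))
  d _ := 0
  id_comp _ := Subtype.ext (one_mul _)
  comp_id _ := Subtype.ext (mul_one _)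
  assoc _ _ _ _ _ _ _ := Subtype.ext (mul_assoc _ _ _)
  d_d _ _ _ := rfl
  leibniz _ _ _ _ _ _ _ _ := by
    simp only [LinearMap.zero_apply, map_zero, smul_zero, add_zero]

/-- Nonempty finite sequences; `snoc s a` is the sequence `s` followed by `a`. -/
inductive NSeq (ι : Type*) : Type _
  | single (a : ι) : NSeq ι
  | snoc (s : NSeq ι) (a : ι) : NSeq ι

namespace NSeq

variable {ι κ : Type*}

/-- Concatenation: `s` followed by `t`. -/
def append (s : NSeq ι) : NSeq ι → NSeq ι
  | single a => snoc s a
  | snoc t a => snoc (s.append t) a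

/-- Concatenation of a sequence of sequences. -/
def join : NSeq (NSeq ι) → NSeq ι
  | single s => s
  | snoc S s => S.join.append s

/-- Termwise application of a map. -/
def map (φ : ι → κ) : NSeq ι → NSeq κ
  | single a => single (φ a)
  | snoc s a => snoc (s.map φ) (φ a)

theorem append_assoc (s t : NSeq ι) :
    ∀ u : NSeq ι, (s.append t).append u = s.append (t.append u)
  | single _ => rfl
  | snoc u _ => by simp only [append, append_assoc s t u]

theorem join_append (S : NSeq (NSeq ι)) :
    ∀ T : NSeq (NSeq ι), (S.append T).join = S.join.append T.join
  | single _ => rfl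
  | snoc T t => by simp only [append, join, join_append S T, append_assoc]

theorem join_map_join : ∀ S : NSeq (NSeq (NSeq ι)), (S.map join).join = S.join.join
  | single _ => rfl
  | snoc S s => by simp only [map, join, join_append, join_map_join S]

end NSeq

/-- A 2-disk `(n₁, …, n_l)`: a nonempty sequence of integers `≥ 1`. -/
abbrev Disk : Type := NSeq ℕ+

/-! ### Iterated tensor products and the functors `Υ` -/

section Upsilon

/-- `X (a_t) ⊗ (X (a_{t-1}) ⊗ (⋯ (X (a₂) ⊗ X (a₁)) ⋯ ))` for the sequence `(a₁, …, a_t)`. -/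
def iterTensor {ι : Type*} (X : ι → DGCat.{u} k) : NSeq ι → DGCat.{u} k
  | .single a => X a
  | .snoc s a => tensor (X a) (iterTensor X s)

/-- The termwise action of dg functors on iterated tensor products. -/
def iterTensorMap {ι κ : Type*} {X : ι → DGCat.{u} k} {Y : κ → DGCat.{u} k} {r : ι → κ}
    (φ : ∀ i, X i ⟶ Y (r i)) : ∀ s : NSeq ι, iterTensor X s ⟶ iterTensor Y (s.map r)
  | .single a => φ a
  | .snoc s a => tensorMap (φ a) (iterTensorMap φ s)

/-- A family of dg functors of the type of the associators. -/
abbrev AssocFamily (k : Type u) [Field k] : Type (u + 1) :=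
  ∀ C D E : DGCat.{u} k, tensor (tensor C D) E ⟶ tensor C (tensor D E)

variable (α : AssocFamily k) {ι : Type*} (X : ι → DGCat.{u} k)

/-- For sequences `s` and `t = (b₁, …, b_l)`, the composite
`(X b_l ⊗ (⋯ ⊗ X b₁)) ⊗ X_s ⟶ X b_l ⊗ ((X b_{l-1} ⊗ (⋯ ⊗ X b₁)) ⊗ X_s) ⟶ ⋯ ⟶ X_{(s, t)}`
of associators. -/
def upsilonTwo (s : NSeq ι) : ∀ t : NSeq ι,
    tensor (iterTensor X t) (iterTensor X s) ⟶ iterTensor X (s.append t)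
  | .single b => 𝟙 (tensor (X b) (iterTensor X s))
  | .snoc t b => α (X b) (iterTensor X t) (iterTensor X s) ≫
      tensorMap (𝟙 (X b)) (upsilonTwo s t)

/-- For a sequence `(s₁, …, s_t)` of sequences, the composite
`X_{s₁, …, s_t} ⟶ X_{(s₁, s₂), s₃, …, s_t} ⟶ X_{(s₁, s₂, s₃), s₄, …, s_t} ⟶ ⋯ ⟶ X_{(s₁, …, s_t)}`
of dg functors given by `upsilonTwo`. -/
def upsilon : ∀ S : NSeq (NSeq ι), iterTensor (iterTensor X) S ⟶ iterTensor X S.join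
  | .single s => 𝟙 (iterTensor X s)
  | .snoc S s => tensorMap (𝟙 (iterTensor X s)) (upsilon S) ≫ upsilonTwo α X S.join s

/-- `I_D = I_{n_l} ⊗ (I_{n_{l-1}} ⊗ (⋯ (I_{n₂} ⊗ I_{n₁}) ⋯ ))` for a 2-disk `D = (n₁, …, n_l)`. -/
def diskCat (k : Type u) [Field k] (D : Disk) : DGCat.{u} k :=
  iterTensor (fun n : ℕ+ => interval k n) D

/-- `I_{D₁, …, D_t} = I_{D_t} ⊗ (⋯ (I_{D₂} ⊗ I_{D₁}) ⋯ )` for a sequence of 2-disks. -/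
def diskSeqCat (k : Type u) [Field k] (𝓓 : NSeq Disk) : DGCat.{u} k :=
  iterTensor (diskCat k) 𝓓

/-- `I_{𝓓¹, …, 𝓓ˡ} = I_{𝓓ˡ} ⊗ (⋯ (I_{𝓓²} ⊗ I_{𝓓¹}) ⋯ )` for a sequence of sequences of 2-disks. -/
def diskSeqSeqCat (k : Type u) [Field k] (𝔻 : NSeq (NSeq Disk)) : DGCat.{u} k :=
  iterTensor (diskSeqCat k) 𝔻

/-- `Υ(D₁, …, D_t) : I_{D₁, …, D_t} ⟶ I_{[D₁, …, D_t]}`. -/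
def diskUpsilon (𝓓 : NSeq Disk) : diskSeqCat k 𝓓 ⟶ diskCat k 𝓓.join :=
  upsilon α (fun n : ℕ+ => interval k n) 𝓓

/-- `Υ₁ : I_{𝓓¹, …, 𝓓ˡ} ⟶ I_{[𝓓¹], …, [𝓓ˡ]} ⟶ I_{[[𝓓¹], …, [𝓓ˡ]]}`; the first arrow is the tensor
product of the dg functors `Υ(𝓓ⁱ) : I_{𝓓ⁱ} ⟶ I_{[𝓓ⁱ]}`. -/
def upsilonOne (𝔻 : NSeq (NSeq Disk)) :
    diskSeqSeqCat k 𝔻 ⟶ diskCat k (𝔻.map NSeq.join).join :=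
  iterTensorMap (X := diskSeqCat k) (Y := diskCat k) (diskUpsilon α) 𝔻 ≫
    diskUpsilon α (𝔻.map NSeq.join)

/-- `Υ₂ : I_{𝓓¹, …, 𝓓ˡ} ⟶ I_{D¹₁, …, D¹_{t₁}, …, Dˡ₁, …, Dˡ_{t_l}} ⟶ I_{[D¹₁, …, Dˡ_{t_l}]}`; the first
arrow is built like `Υ`, with the dg categories `I_{Dⁱⱼ}` in place of the intervals. -/
def upsilonTwoStep (𝔻 : NSeq (NSeq Disk)) :
    diskSeqSeqCat k 𝔻 ⟶ diskCat k 𝔻.join.join :=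
  upsilon α (diskCat k) 𝔻 ≫ diskUpsilon α 𝔻.join

end Upsilon

end TwistedTensor

set_option linter.unusedSectionVars false
set_option linter.unusedVariables false

namespace TwistedTensor

variable {k : Type u} [Field k]

/-! ### Signs -/

/-! The twisted tensor product has a right adjoint. Dg functors out of `tensor C D` into `Y`
correspond to dg functors from `C` to `Coh D Y`, whose objects are dg functors `D → Y` and whose
morphisms are reduced Hochschild cochains, multiplied by the cup product. A dg functor `F` gives a
Maurer–Cartan element `edge F` of the convolution algebra on the bar coalgebra of `D`, and twisting
by these elements yields the differential `twDiff`. The relations imposed on `ε(f; g₁, …, gₙ)` say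
precisely that `f ↦ (s ↦ ε(f; s))` is a dg functor to `Coh`. This gives both the lift `tensorLift`
(through `Rel.eval`) and the unit `cohUnit`.

The associator is obtained without checking its formula against the relations one by one. The signed
sums `brace` define a map from the tensor product of the bar coalgebras of `D` and `E` to the bar
coalgebra of `tensor D E`. It is determined by its component `pairTau` in chains of length one; it
respects cutting (`braceSum_splitSum`), and it respects differentials (`braceSum_barSum`) because
`pairTau` satisfies the Maurer–Cartan equation `diffT_pairTau`. Pulling cochains back along it gives
a dg functor `curry` from `Coh (tensor D E) X` to `Coh D (Coh E X)`, and the associator is the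
adjoint transpose of `cohUnit` followed by `curry`. It is unique because the morphisms on which it
is prescribed generate the source.

The pentagon is also checked on generators. The essential case, triply nested `ε`, is the
associativity of braces `braceSum_braceSum_assoc`: both iterated braces obey the same recursion that
strips off the last morphism, and the morphisms stripped off correspond under the associator by its
defining formulas.

The equality of the two functors is then formal. Naturality and the pentagon give coherence for
three blocks (`upsilonTwo_append`), then for concatenated sequences of blocks
(`upsilonTwo_upsilon`), then for sequences of sequences (`iterTensorMap_upsilon`), each by induction
on the last block or entry. Nothing about intervals is needed, nor that associators are invertible.
-/

theorem sgn_zero : sgn k 0 = 1 := by simp [sgn]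

theorem sgn_one : sgn k 1 = -1 := by simp [sgn]

theorem sgn_add (a b : ℤ) : sgn k (a + b) = sgn k a * sgn k b := by
  simp [sgn, Int.negOnePow_add]

theorem sgn_congr {a b : ℤ} (h : Even a ↔ Even b) : sgn k a = sgn k b := by
  by_cases ha : Even a
  · simp [sgn, Int.negOnePow_even _ ha, Int.negOnePow_even _ (h.1 ha)]
  · rw [sgn, sgn, Int.negOnePow_odd _ (Int.not_even_iff_odd.1 ha),
      Int.negOnePow_odd _ (Int.not_even_iff_odd.1 (fun hb => ha (h.2 hb)))]

theorem neg_sgn (a : ℤ) : -sgn k a = sgn k (a + 1) := by simp [sgn_add, sgn_one]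

theorem sgn_sub (a b : ℤ) : sgn k (a - b) = sgn k a * sgn k b := by
  rw [← sgn_add]
  exact sgn_congr (by simp [Int.even_sub, Int.even_add])

theorem sgn_mul_self (a : ℤ) : sgn k a * sgn k a = 1 := by
  rw [← sgn_add, ← sgn_zero]
  exact sgn_congr (by simp)

/-! ### Total spaces of morphisms -/

/-- The direct sum of the spaces of morphisms of all degrees. -/
abbrev Tot (X : DGCat.{u} k) (x y : X.Obj) : Type u := DirectSum ℤ (X.Hom x y)

section Tot

variable {X Y Z : DGCat.{u} k}

/-- The inclusion of the morphisms of degree `n`. -/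
def of {x y : X.Obj} (n : ℤ) : X.Hom x y n →ₗ[k] Tot X x y := DirectSum.lof k ℤ (X.Hom x y) n

theorem of_apply_self {x y : X.Obj} (n : ℤ) (a : X.Hom x y n) : of n a n = a :=
  DirectSum.of_eq_same _ _

theorem of_injective {x y : X.Obj} (n : ℤ) : Function.Injective (of (X := X) (x := x) (y := y) n) :=
  fun a b h => by rw [← of_apply_self n a, h, of_apply_self]

theorem Tot.induction {x y : X.Obj} {p : Tot X x y → Prop} (a : Tot X x y)
    (h₀ : p 0) (h₁ : ∀ n a, p (of n a)) (h₂ : ∀ a b, p a → p b → p (a + b)) : p a :=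
  DirectSum.induction_on a h₀ h₁ h₂

/-- The linear extension of a family of linear maps on homogeneous morphisms. -/
def Tot.lift {x y : X.Obj} {M : Type*} [AddCommMonoid M] [Module k M]
    (f : ∀ n, X.Hom x y n →ₗ[k] M) : Tot X x y →ₗ[k] M := DirectSum.toModule k ℤ M f

@[simp] theorem Tot.lift_of {x y : X.Obj} {M : Type*} [AddCommMonoid M] [Module k M]
    (f : ∀ n, X.Hom x y n →ₗ[k] M) (n : ℤ) (a : X.Hom x y n) : Tot.lift f (of n a) = f n a :=
  DirectSum.toModule_lof _ _ _

/-- Composition on total spaces of morphisms. -/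
def mulT {x y z : X.Obj} : Tot X y z →ₗ[k] Tot X x y →ₗ[k] Tot X x z :=
  Tot.lift fun m => LinearMap.flip (Tot.lift fun n => LinearMap.flip
    ((X.comp (rfl : m + n = m + n)).compr₂ (of (m + n))))

/-- The differential on total spaces of morphisms. -/
def diffT {x y : X.Obj} : Tot X x y →ₗ[k] Tot X x y :=
  Tot.lift fun n => of (n + 1) ∘ₗ X.d rfl

/-- The identity in the total space of endomorphisms. -/
def oneT (x : X.Obj) : Tot X x x := of 0 (X.id x)

/-- This is what total spaces are for: on the right no proof about degrees remains, so morphisms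
whose degrees agree only propositionally can be compared and rewritten. -/
theorem of_comp {x y z : X.Obj} {m n p : ℤ} (h : m + n = p) (b : X.Hom y z m) (a : X.Hom x y n) :
    of p (X.comp h b a) = mulT (of m b) (of n a) := by
  subst h
  simp [mulT]

theorem of_d {x y : X.Obj} {n p : ℤ} (h : n + 1 = p) (a : X.Hom x y n) :
    of p (X.d h a) = diffT (of n a) := by
  subst h
  simp [diffT]

theorem mulT_assoc {w x y z : X.Obj} (c : Tot X y z) (b : Tot X x y) (a : Tot X w x) :
    mulT (mulT c b) a = mulT c (mulT b a) := by
  induction c using Tot.induction with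
  | h₀ => simp
  | h₂ c c' h h' => simp [h, h']
  | h₁ l c =>
  induction b using Tot.induction with
  | h₀ => simp
  | h₂ b b' h h' => simp [h, h']
  | h₁ m b =>
  induction a using Tot.induction with
  | h₀ => simp
  | h₂ a a' h h' => simp [h, h']
  | h₁ n a =>
  rw [← of_comp rfl, ← of_comp rfl, ← of_comp rfl, ← of_comp (add_assoc l m n).symm]
  rw [X.assoc]

@[simp] theorem oneT_mulT {x y : X.Obj} (a : Tot X x y) : mulT (oneT y) a = a := by
  induction a using Tot.induction with
  | h₀ => simp
  | h₂ a a' h h' => simp [h, h']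
  | h₁ n a => rw [oneT, ← of_comp (zero_add n), X.id_comp]

@[simp] theorem mulT_oneT {x y : X.Obj} (a : Tot X x y) : mulT a (oneT x) = a := by
  induction a using Tot.induction with
  | h₀ => simp
  | h₂ a a' h h' => simp [h, h']
  | h₁ n a => rw [oneT, ← of_comp (add_zero n), X.comp_id]

@[simp] theorem diffT_diffT {x y : X.Obj} (a : Tot X x y) : diffT (diffT a) = 0 := by
  induction a using Tot.induction with
  | h₀ => simp
  | h₂ a a' h h' => simp [h, h']
  | h₁ n a => rw [← of_d rfl, ← of_d rfl, X.d_d, map_zero]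

/-- The morphisms of degree `n` as a subspace of the total space. -/
def homog (X : DGCat.{u} k) (x y : X.Obj) (n : ℤ) : Submodule k (Tot X x y) :=
  LinearMap.range (of n)

theorem of_mem_homog {x y : X.Obj} (n : ℤ) (a : X.Hom x y n) : of n a ∈ homog X x y n :=
  ⟨a, rfl⟩

/-- The way back: a homogeneous element of the total space is recovered from its component, which is
a morphism of the prescribed degree without any cast. -/
theorem of_component {x y : X.Obj} {n : ℤ} {a : Tot X x y} (h : a ∈ homog X x y n) :
    of n (a n) = a := by
  obtain ⟨a, rfl⟩ := h
  rw [of_apply_self]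

theorem mulT_mem_homog {x y z : X.Obj} {m n p : ℤ} {b : Tot X y z} {a : Tot X x y}
    (hb : b ∈ homog X y z m) (ha : a ∈ homog X x y n) (h : m + n = p) :
    mulT b a ∈ homog X x z p := by
  obtain ⟨b, rfl⟩ := hb
  obtain ⟨a, rfl⟩ := ha
  rw [← of_comp h]
  exact of_mem_homog _ _

theorem diffT_mem_homog {x y : X.Obj} {n p : ℤ} {a : Tot X x y}
    (ha : a ∈ homog X x y n) (h : n + 1 = p) : diffT a ∈ homog X x y p := by
  obtain ⟨a, rfl⟩ := ha
  rw [← of_d h]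
  exact of_mem_homog _ _

/-- The Leibniz sign depends on the left factor alone, so only that factor has to be homogeneous. -/
theorem diffT_mulT {x y z : X.Obj} {m : ℤ} {b : Tot X y z} (hb : b ∈ homog X y z m)
    (a : Tot X x y) :
    diffT (mulT b a) = mulT (diffT b) a + sgn k m • mulT b (diffT a) := by
  obtain ⟨b, rfl⟩ := hb
  induction a using Tot.induction with
  | h₀ => simp
  | h₂ a a' h h' => simp [h, h']; abel
  | h₁ n a =>
  rw [← of_comp rfl, ← of_d rfl, ← of_d rfl, ← of_d rfl,
    X.leibniz b a rfl rfl rfl rfl (by omega) (by omega), map_add, negOnePow_smul (k := k), map_smul,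
    of_comp, of_comp]

/-- Not an axiom of `DGCat`: the Leibniz rule for `id = id ∘ id` gives `d id = d id + d id`. -/
theorem d_id (x : X.Obj) {p : ℤ} (h : 0 + 1 = p) : X.d h (X.id x) = 0 := by
  refine of_injective _ ?_
  rw [of_d, map_zero]
  have h := diffT_mulT (of_mem_homog 0 (X.id x)) (of 0 (X.id x))
  rw [← oneT] at h ⊢
  simpa [sgn_zero] using h

/-- The action of a dg functor on total spaces of morphisms. -/
def DGFunctor.tot (F : DGFunctor X Y) {x y : X.Obj} :
    Tot X x y →ₗ[k] Tot Y (F.obj x) (F.obj y) :=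
  Tot.lift fun n => of n ∘ₗ F.map

@[simp] theorem DGFunctor.tot_of (F : DGFunctor X Y) {x y : X.Obj} (n : ℤ) (a : X.Hom x y n) :
    F.tot (of n a) = of n (F.map a) := by
  simp [DGFunctor.tot]

theorem DGFunctor.tot_mulT (F : DGFunctor X Y) {x y z : X.Obj} (b : Tot X y z) (a : Tot X x y) :
    F.tot (mulT b a) = mulT (F.tot b) (F.tot a) := by
  induction b using Tot.induction with
  | h₀ => simp
  | h₂ b b' h h' => simp [h, h']
  | h₁ m b =>
  induction a using Tot.induction with
  | h₀ => simp
  | h₂ a a' h h' => simp [h, h']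
  | h₁ n a => simp [← of_comp rfl, F.map_comp]

@[simp] theorem DGFunctor.tot_oneT (F : DGFunctor X Y) (x : X.Obj) :
    F.tot (oneT x) = oneT (F.obj x) := by
  simp [oneT, F.map_id]

theorem DGFunctor.tot_diffT (F : DGFunctor X Y) {x y : X.Obj} (a : Tot X x y) :
    F.tot (diffT a) = diffT (F.tot a) := by
  induction a using Tot.induction with
  | h₀ => simp
  | h₂ a a' h h' => simp [h, h']
  | h₁ n a => simp [← of_d rfl, F.map_d]

theorem DGFunctor.tot_mem_homog (F : DGFunctor X Y) {x y : X.Obj} {n : ℤ} {a : Tot X x y}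
    (h : a ∈ homog X x y n) : F.tot a ∈ homog Y (F.obj x) (F.obj y) n := by
  obtain ⟨a, rfl⟩ := h
  rw [F.tot_of]
  exact of_mem_homog _ _

end Tot

/-! ### Sums over cuts and the bar differential as operators on functionals -/

section ChainSums

variable {D : DGCat.{u} k} {M N : Type*} [AddCommGroup M] [Module k M] [AddCommGroup N] [Module k N]

theorem isLinearMap_zero : IsLinearMap k (fun _ : M => (0 : N)) := ⟨by simp, by simp⟩

theorem IsLinearMap.add' {f g : M → N} (hf : IsLinearMap k f) (hg : IsLinearMap k g) :
    IsLinearMap k (fun a => f a + g a) :=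
  (hf.mk' + hg.mk').isLinear

theorem IsLinearMap.smul' (r : k) {f : M → N} (hf : IsLinearMap k f) :
    IsLinearMap k (fun a => r • f a) :=
  (r • hf.mk').isLinear

theorem IsLinearMap.comp' {P : Type*} [AddCommGroup P] [Module k P] {f : N → P} {g : M → N}
    (hf : IsLinearMap k f) (hg : IsLinearMap k g) : IsLinearMap k (fun a => f (g a)) :=
  (hf.mk' ∘ₗ hg.mk').isLinear

/-- The sum of `Φ` over all ways to cut a chain into a left and a right part. -/
def splitSum {x z : D.Obj} (s : Chain D x z)
    (Φ : ∀ w : D.Obj, Chain D w z → Chain D x w → M) : M :=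
  (s.splits.map fun t => Φ t.mid t.left t.right).sum

/-- The value of a functional on the bar differential of a chain. -/
def barSum {x z : D.Obj} (s : Chain D x z) (φ : Chain D x z → M) : M :=
  (s.bar.map fun t => t.coeff • φ t.chain).sum

/-- The value of a functional on the chain `g s` with `g` composed with the last morphism
of `s`. -/
def mergeVal {x : D.Obj} : ∀ {y z : D.Obj} {m : ℤ} (_ : D.Hom y z m) (_ : Chain D x y)
    (_ : Chain D x z → M), M
  | _, _, _, _, .nil, _ => 0
  | _, _, _, g, .cons g' s', φ => φ (.cons (D.comp rfl g g') s')

variable {x y z : D.Obj} {m : ℤ}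

@[simp] theorem splitSum_nil (Φ : ∀ w : D.Obj, Chain D w x → Chain D x w → M) :
    splitSum .nil Φ = Φ x .nil .nil := by
  simp [splitSum, Chain.splits]

@[simp] theorem splitSum_cons (g : D.Hom y z m) (s : Chain D x y)
    (Φ : ∀ w : D.Obj, Chain D w z → Chain D x w → M) :
    splitSum (.cons g s) Φ =
      Φ z .nil (.cons g s) + splitSum s (fun w l r => Φ w (.cons g l) r) := by
  simp [splitSum, Chain.splits, List.map_map, Function.comp_def]

theorem splitSum_congr {s : Chain D x z} {Φ Ψ : ∀ w : D.Obj, Chain D w z → Chain D x w → M}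
    (h : ∀ w l r, Chain.append l r = s → Φ w l r = Ψ w l r) : splitSum s Φ = splitSum s Ψ := by
  unfold splitSum
  congr 1
  exact List.map_congr_left fun t _ => h _ _ _ t.append_eq

theorem splitSum_eq_zero {s : Chain D x z} {Φ : ∀ w : D.Obj, Chain D w z → Chain D x w → M}
    (h : ∀ w l r, Chain.append l r = s → Φ w l r = 0) : splitSum s Φ = 0 := by
  rw [splitSum_congr h, splitSum]
  simp

@[simp] theorem splitSum_zero (s : Chain D x z) : splitSum s (fun _ _ _ => (0 : M)) = 0 :=
  splitSum_eq_zero fun _ _ _ _ => rfl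

theorem splitSum_add (s : Chain D x z) (Φ Ψ : ∀ w : D.Obj, Chain D w z → Chain D x w → M) :
    splitSum s (fun w l r => Φ w l r + Ψ w l r) = splitSum s Φ + splitSum s Ψ :=
  List.sum_map_add

theorem map_splitSum (f : M →ₗ[k] N) (s : Chain D x z)
    (Φ : ∀ w : D.Obj, Chain D w z → Chain D x w → M) :
    f (splitSum s Φ) = splitSum s (fun w l r => f (Φ w l r)) := by
  simp [splitSum, map_list_sum, List.map_map, Function.comp_def]

theorem splitSum_smul (a : k) (s : Chain D x z)
    (Φ : ∀ w : D.Obj, Chain D w z → Chain D x w → M) :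
    splitSum s (fun w l r => a • Φ w l r) = a • splitSum s Φ :=
  (map_splitSum (LinearMap.lsmul k M a) s Φ).symm

theorem isLinearMap_splitSum (s : Chain D x z)
    {Φ : N → ∀ w : D.Obj, Chain D w z → Chain D x w → M}
    (h : ∀ w l r, IsLinearMap k (fun a => Φ a w l r)) :
    IsLinearMap k (fun a => splitSum s (Φ a)) :=
  ⟨fun a b => (splitSum_congr fun w l r _ => (h w l r).map_add a b).trans (splitSum_add _ _ _),
    fun c a => (splitSum_congr fun w l r _ => (h w l r).map_smul c a).trans (splitSum_smul _ _ _)⟩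

/-- Coassociativity of cutting. -/
theorem splitSum_assoc : ∀ {z : D.Obj} (s : Chain D x z)
    (Ω : ∀ v w : D.Obj, Chain D w z → Chain D v w → Chain D x v → M),
    splitSum s (fun v l c => splitSum l (fun w a b => Ω v w a b c)) =
      splitSum s (fun w a r => splitSum r (fun v b c => Ω v w a b c))
  | _, .nil, Ω => by simp
  | _, .cons g s, Ω => by
      simp only [splitSum_cons, splitSum_nil, splitSum_add,
        splitSum_assoc s (fun v w a b c => Ω v w (.cons g a) b c), add_assoc]

/-- Fubini for finite sums over cuts of two unrelated chains. -/
theorem splitSum_swap {D' : DGCat.{u} k} {x' z' : D'.Obj} (s : Chain D x z) (s' : Chain D' x' z')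
    (Φ : ∀ w : D.Obj, Chain D w z → Chain D x w →
      ∀ w' : D'.Obj, Chain D' w' z' → Chain D' x' w' → M) :
    splitSum s (fun w l r => splitSum s' (Φ w l r)) =
      splitSum s' (fun w' l' r' => splitSum s (fun w l r => Φ w l r w' l' r')) := by
  have : ∀ {z : D.Obj} (s : Chain D x z) (Φ : ∀ w : D.Obj, Chain D w z → Chain D x w →
      ∀ w' : D'.Obj, Chain D' w' z' → Chain D' x' w' → M),
      splitSum s (fun w l r => splitSum s' (Φ w l r)) =
        splitSum s' (fun w' l' r' => splitSum s (fun w l r => Φ w l r w' l' r')) := by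
    intro z s
    induction s with
    | nil => simp
    | cons g s ih =>
      intro Φ
      simp only [splitSum_cons, splitSum_add, ih]
  exact this s Φ

@[simp] theorem barSum_nil (φ : Chain D x x → M) : barSum .nil φ = 0 := rfl

@[simp] theorem mergeVal_nil (g : D.Hom y z m) (φ : Chain D y z → M) : mergeVal g .nil φ = 0 := rfl

@[simp] theorem mergeVal_cons {w : D.Obj} {n : ℤ} (g : D.Hom y z m) (g' : D.Hom w y n)
    (s : Chain D x w) (φ : Chain D x z → M) :
    mergeVal g (.cons g' s) φ = φ (.cons (D.comp rfl g g') s) := rfl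

-- The recursion behind all bar identities below: either the last morphism is differentiated, or, at
-- the cost of the sign of `g` in the bar construction, it is merged with its neighbour or the
-- operator moves on to the tail.
@[simp] theorem barSum_cons (g : D.Hom y z m) (s : Chain D x y) (φ : Chain D x z → M) :
    barSum (.cons g s) φ = φ (.cons (D.d rfl g) s) +
      sgn k (m - 1) • (mergeVal g s φ + barSum s (fun t => φ (.cons g t))) := by
  simp only [barSum, Chain.bar, List.map_cons, List.cons_append, List.map_append, List.map_map,
    List.sum_cons, List.sum_append, one_smul, Function.comp_def, mul_smul, smul_add]
  congr 2
  · cases s <;> simp [mergeTerms, mergeVal]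
  · simp [List.smul_sum, List.map_map, Function.comp_def]

theorem barSum_congr {s : Chain D x z} {φ ψ : Chain D x z → M}
    (h : ∀ t : Chain D x z, t.sdeg = s.sdeg + 1 → φ t = ψ t) : barSum s φ = barSum s ψ := by
  unfold barSum
  congr 1
  exact List.map_congr_left fun t _ => by rw [h _ t.deg]

@[simp] theorem barSum_zero (s : Chain D x z) : barSum s (fun _ => (0 : M)) = 0 := by
  simp [barSum]

theorem barSum_add (s : Chain D x z) (φ ψ : Chain D x z → M) :
    barSum s (fun t => φ t + ψ t) = barSum s φ + barSum s ψ := by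
  simp only [barSum, smul_add]
  exact List.sum_map_add

theorem map_barSum (f : M →ₗ[k] N) (s : Chain D x z) (φ : Chain D x z → M) :
    f (barSum s φ) = barSum s (fun t => f (φ t)) := by
  simp [barSum, map_list_sum, List.map_map, Function.comp_def]

theorem barSum_smul (a : k) (s : Chain D x z) (φ : Chain D x z → M) :
    barSum s (fun t => a • φ t) = a • barSum s φ :=
  (map_barSum (LinearMap.lsmul k M a) s φ).symm

theorem isLinearMap_barSum (s : Chain D x z) {φ : N → Chain D x z → M}
    (h : ∀ t, IsLinearMap k (fun a => φ a t)) : IsLinearMap k (fun a => barSum s (φ a)) :=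
  ⟨fun a b => (barSum_congr fun t _ => (h t).map_add a b).trans (barSum_add _ _ _),
    fun c a => (barSum_congr fun t _ => (h t).map_smul c a).trans (barSum_smul _ _ _)⟩

theorem barSum_splitSum_swap {D' : DGCat.{u} k} {x' z' : D'.Obj} (s : Chain D x z)
    (s' : Chain D' x' z')
    (Φ : Chain D x z → ∀ w' : D'.Obj, Chain D' w' z' → Chain D' x' w' → M) :
    barSum s (fun t => splitSum s' (Φ t)) =
      splitSum s' (fun w' l' r' => barSum s (fun t => Φ t w' l' r')) := by
  have : ∀ {z' : D'.Obj} (s' : Chain D' x' z')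
      (Φ : Chain D x z → ∀ w' : D'.Obj, Chain D' w' z' → Chain D' x' w' → M),
      barSum s (fun t => splitSum s' (Φ t)) =
        splitSum s' (fun w' l' r' => barSum s (fun t => Φ t w' l' r')) := by
    intro z' s'
    induction s' with
    | nil => simp
    | cons g s ih =>
      intro Φ
      simp only [splitSum_cons, barSum_add, ih]
  exact this s' Φ

/-- A cut of the merged chain cannot separate `g` from the morphism it has absorbed. The spurious
cut in which `l` is empty contributes nothing, because `mergeVal` is `0` on the empty chain. -/
theorem mergeVal_splitSum (g : D.Hom y z m) (s : Chain D x y)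
    (Φ : ∀ w : D.Obj, Chain D w z → Chain D x w → M) :
    mergeVal g s (fun t => splitSum t Φ) = mergeVal g s (Φ z .nil) +
      splitSum s (fun w l r => mergeVal g l (fun t => Φ w t r)) := by
  cases s <;> simp

/-- The bar differential is a coderivation with respect to cutting. -/
theorem barSum_splitSum : ∀ {z : D.Obj} (s : Chain D x z)
    (Φ : ∀ w : D.Obj, Chain D w z → Chain D x w → M),
    barSum s (fun t => splitSum t Φ) = splitSum s (fun w l r =>
      barSum l (fun t => Φ w t r) + sgn k l.sdeg • barSum r (Φ w l))
  | _, .nil, Φ => by simp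
  | _, .cons (m := m) g s, Φ => by
      simp only [barSum_cons, splitSum_cons, mergeVal_splitSum, barSum_add,
        barSum_splitSum s (fun w l r => Φ w (.cons g l) r), splitSum_add, smul_add, barSum_nil,
        zero_add, Chain.sdeg, sgn_zero, one_smul, sgn_add, mul_smul, splitSum_smul]
      abel

/-- A functional on chains is multilinear if it is linear in each morphism. -/
def IsMulti (φ : Chain D x y → M) : Prop :=
  ∀ ⦃u v : D.Obj⦄ ⦃n : ℤ⦄ (l : Chain D v y) (s : Chain D x u),
    IsLinearMap k (fun g : D.Hom u v n => φ (l.append (.cons g s)))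

/-- A functional on chains is normalized if it vanishes on chains that contain an identity. -/
def IsNormal (φ : Chain D x y → M) : Prop :=
  ∀ ⦃u : D.Obj⦄ (l : Chain D u y) (s : Chain D x u), φ (l.append (.cons (D.id u) s)) = 0

theorem IsMulti.tail {φ : Chain D x z → M} (h : IsMulti φ) (g : D.Hom y z m) :
    IsMulti (fun t => φ (.cons g t)) :=
  fun _ _ _ l s => h (.cons g l) s

theorem IsMulti.head {φ : Chain D x z → M} (h : IsMulti φ) (s : Chain D x y) :
    IsLinearMap k (fun g : D.Hom y z m => φ (.cons g s)) :=
  h .nil s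

theorem IsNormal.tail {φ : Chain D x z → M} (h : IsNormal φ) (g : D.Hom y z m) :
    IsNormal (fun t => φ (.cons g t)) :=
  fun _ l s => h (.cons g l) s

theorem IsNormal.head {φ : Chain D x z → M} (h : IsNormal φ) (s : Chain D x z) :
    φ (.cons (D.id z) s) = 0 :=
  h .nil s

theorem IsMulti.comp {φ : Chain D x z → M} (h : IsMulti φ) {f : M → N} (hf : IsLinearMap k f) :
    IsMulti (fun t => f (φ t)) :=
  fun _ _ _ l s => IsLinearMap.comp' hf (h l s)

theorem IsNormal.comp {φ : Chain D x z → M} (h : IsNormal φ) {f : M → N} (hf : IsLinearMap k f) :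
    IsNormal (fun t => f (φ t)) := fun _ l s => by
  have := h l s
  dsimp only at this ⊢
  rw [this, hf.map_zero]

/-- The value of a multilinear functional on `a t`, where `a` need not be homogeneous. -/
def consL {φ : Chain D x z → M} (h : IsMulti φ) (t : Chain D x y) : Tot D y z →ₗ[k] M :=
  Tot.lift fun _ => (h.head t).mk'

@[simp] theorem consL_of {φ : Chain D x z → M} (h : IsMulti φ) (t : Chain D x y)
    (g : D.Hom y z m) : consL h t (of m g) = φ (.cons g t) := by
  simp [consL]

theorem IsMulti.consL {φ : Chain D x z → M} (h : IsMulti φ) (a : Tot D y z) :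
    IsMulti (fun t => consL h t a) := fun u v n l s => by
  induction a using Tot.induction with
  | h₀ => simpa using isLinearMap_zero
  | h₁ m g => simpa using h.tail g l s
  | h₂ a b ha hb => simpa using IsLinearMap.add' ha hb

/-- For every cut the varied morphism lies on one side only, where the functional is linear in it.
The induction runs over the morphisms that come after it. -/
theorem splitSum_isMulti_aux : ∀ {v z : D.Obj} (l : Chain D v z) {u : D.Obj} {n : ℤ}
    (s : Chain D x u) (Φ : ∀ w : D.Obj, Chain D w z → Chain D x w → M)
    (_ : ∀ w r, IsMulti (fun l => Φ w l r)) (_ : ∀ w l, IsMulti (Φ w l)),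
    IsLinearMap k (fun g : D.Hom u v n => splitSum (l.append (.cons g s)) Φ)
  | _, _, .nil, _, _, s, Φ, h, h' => by
      simp only [Chain.append, splitSum_cons]
      exact IsLinearMap.add' ((h' _ _).head s)
        (isLinearMap_splitSum s fun w l r => (h w r).head l)
  | _, _, .cons g l, _, _, s, Φ, h, h' => by
      simp only [Chain.append, splitSum_cons]
      exact IsLinearMap.add' ((h' _ _).tail g l s)
        (splitSum_isMulti_aux l s (fun w l r => Φ w (.cons g l) r)
          (fun w r => (h w r).tail g) fun w l => h' w _)

theorem splitSum_isMulti {Φ : ∀ w : D.Obj, Chain D w z → Chain D x w → M}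
    (h : ∀ w r, IsMulti (fun l => Φ w l r)) (h' : ∀ w l, IsMulti (Φ w l)) :
    IsMulti (fun s => splitSum s Φ) :=
  fun _ _ _ l s => splitSum_isMulti_aux l s Φ h h'

theorem splitSum_isNormal_aux : ∀ {v z : D.Obj} (l : Chain D v z)
    (s : Chain D x v) (Φ : ∀ w : D.Obj, Chain D w z → Chain D x w → M)
    (_ : ∀ w r, IsNormal (fun l => Φ w l r)) (_ : ∀ w l, IsNormal (Φ w l)),
    splitSum (l.append (.cons (D.id v) s)) Φ = 0
  | _, _, .nil, s, Φ, h, h' => by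
      simp only [Chain.append, splitSum_cons]
      rw [(h' _ _).head s, zero_add]
      exact splitSum_eq_zero fun w l r _ => (h w r).head l
  | _, _, .cons g l, s, Φ, h, h' => by
      simp only [Chain.append, splitSum_cons]
      rw [splitSum_isNormal_aux l s (fun w l r => Φ w (.cons g l) r)
          (fun w r => (h w r).tail g) fun w l => h' w _, add_zero]
      exact (h' _ _).tail g l s

theorem splitSum_isNormal {Φ : ∀ w : D.Obj, Chain D w z → Chain D x w → M}
    (h : ∀ w r, IsNormal (fun l => Φ w l r)) (h' : ∀ w l, IsNormal (Φ w l)) :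
    IsNormal (fun s => splitSum s Φ) :=
  fun _ l s => splitSum_isNormal_aux l s Φ h h'

/-- In each term the varied morphism is unchanged, differentiated, or composed with one of its
neighbours, and all of these operations are linear. -/
theorem barSum_isMulti_aux : ∀ {v z : D.Obj} (l : Chain D v z) {u : D.Obj} {n : ℤ}
    (s : Chain D x u) (φ : Chain D x z → M) (_ : IsMulti φ),
    IsLinearMap k (fun g : D.Hom u v n => barSum (l.append (.cons g s)) φ)
  | _, _, .nil, _, _, s, φ, h => by
      simp only [Chain.append, barSum_cons]
      refine IsLinearMap.add' (IsLinearMap.comp' (f := fun g => φ (.cons g s)) (h.head s) (D.d rfl).isLinear)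
        (IsLinearMap.smul' _ (IsLinearMap.add' ?_ (isLinearMap_barSum s fun t => h.head t)))
      cases s with
      | nil => simpa using isLinearMap_zero
      | cons g' s =>
        simp only [mergeVal_cons]
        exact IsLinearMap.comp' (f := fun g => φ (.cons g s)) (h.head s) ((D.comp rfl).flip g').isLinear
  | _, _, .cons g l, _, _, s, φ, h => by
      simp only [Chain.append, barSum_cons]
      refine IsLinearMap.add' (h.tail _ l s)
        (IsLinearMap.smul' _ (IsLinearMap.add' ?_ (barSum_isMulti_aux l s _ (h.tail g))))
      cases l with
      | nil =>
        simp only [Chain.append, mergeVal_cons]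
        exact IsLinearMap.comp' (f := fun g => φ (.cons g s)) (h.head s) (D.comp rfl g).isLinear
      | cons g' l =>
        simp only [Chain.append, mergeVal_cons]
        exact h.tail _ l s

theorem barSum_isMulti {φ : Chain D x z → M} (h : IsMulti φ) : IsMulti (fun s => barSum s φ) :=
  fun _ _ _ l s => barSum_isMulti_aux l s φ h

/-- A chain hides the degrees of its morphisms, so the choice of the index `p` for a composite is
invisible in the chain. -/
theorem cons_comp_eq {w : D.Obj} {m n p : ℤ} (h : m + n = p) (g : D.Hom y z m) (f : D.Hom w y n)
    (s : Chain D x w) : Chain.cons (D.comp h g f) s = Chain.cons (D.comp rfl g f) s := by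
  subst h
  rfl

theorem cons_comp_comp_eq {w v : D.Obj} {l m n : ℤ} (h : D.Hom y z l) (g : D.Hom w y m)
    (f : D.Hom v w n) (s : Chain D x v) :
    Chain.cons (D.comp rfl (D.comp rfl h g) f) s = Chain.cons (D.comp rfl h (D.comp rfl g f)) s := by
  rw [← cons_comp_eq (add_assoc l m n).symm h (D.comp rfl g f), ← D.assoc h g f rfl rfl rfl]

theorem cons_d_d {φ : Chain D x z → M} (h : IsMulti φ) (g : D.Hom y z m) (s : Chain D x y) :
    φ (.cons (D.d rfl (D.d rfl g)) s) = 0 := by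
  rw [D.d_d]
  exact (h.head s).map_zero

theorem cons_d_comp {w : D.Obj} {n : ℤ} {φ : Chain D x z → M} (h : IsMulti φ) (g : D.Hom y z m)
    (f : D.Hom w y n) (s : Chain D x w) :
    φ (.cons (D.d rfl (D.comp rfl g f)) s) = φ (.cons (D.comp rfl (D.d rfl g) f) s) +
      sgn k m • φ (.cons (D.comp rfl g (D.d rfl f)) s) := by
  rw [← consL_of h, of_d, of_comp, diffT_mulT (of_mem_homog m g), ← of_d rfl, ← of_d rfl,
    ← of_comp rfl, ← of_comp rfl, map_add, map_smul, consL_of, consL_of]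

/-- The bar differential squares to zero. -/
theorem barSum_barSum : ∀ {z : D.Obj} (s : Chain D x z) {φ : Chain D x z → M} (_ : IsMulti φ),
    barSum s (fun t => barSum t φ) = 0
  | _, .nil, φ, _ => rfl
  | _, .cons g .nil, φ, h => by
      simp [cons_d_d h]
  | _, .cons (m := m) g (.cons (m := n) g' s), φ, h => by
      -- The terms in which both operators act beyond `g` form the square of the bar differential of
      -- the tail.
      have ih := barSum_barSum (.cons g' s) (h.tail g)
      have e₁ : sgn k (m + 1 - 1) = -sgn k (m - 1) := by
        rw [neg_sgn]; congr 1; ring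
      have e₂ : sgn k (m + n - 1) = -(sgn k (m - 1) * sgn k (n - 1)) := by
        rw [← sgn_add, neg_sgn]; exact sgn_congr (by congr! 1; ring)
      have e₃ : sgn k m = -sgn k (m - 1) := by
        rw [neg_sgn]; congr 1; ring
      have e₄ : sgn k (n + 1 - 1) = -sgn k (n - 1) := by
        rw [neg_sgn]; congr 1; ring
      have e := sgn_mul_self (k := k) (m - 1)
      have e' := sgn_mul_self (k := k) (n - 1)
      rw [barSum_cons]
      have ha : barSum (.cons (D.d rfl g) (.cons g' s)) φ = -sgn k (m - 1) •
          (φ (.cons (D.comp rfl (D.d rfl g) g') s) +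
            barSum (.cons g' s) (fun t => φ (.cons (D.d rfl g) t))) := by
        rw [barSum_cons, cons_d_d h, zero_add, e₁, mergeVal_cons]
      have hc : barSum (.cons g' s) (fun t => mergeVal g t φ) =
          φ (.cons (D.comp rfl g (D.d rfl g')) s) + sgn k (n - 1) •
            (mergeVal (D.comp rfl g g') s φ +
              barSum s (fun t => φ (.cons (D.comp rfl g g') t))) := by
        rw [barSum_cons]
        simp only [mergeVal_cons]
        congr 3
        -- Merging `g` with an already merged neighbour uses associativity in `D`.
        cases s with
        | nil => rfl
        | cons g'' s => simp [cons_comp_comp_eq]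
      have hb : barSum (.cons g' s) (fun t => barSum (.cons g t) φ) =
          barSum (.cons g' s) (fun t => φ (.cons (D.d rfl g) t)) +
            sgn k (m - 1) • barSum (.cons g' s) (fun t => mergeVal g t φ) := by
        simp only [barSum_cons g, barSum_add, barSum_smul, smul_add, ih, smul_zero, add_zero]
      rw [hb, hc, ha, mergeVal_cons, barSum_cons (D.comp rfl g g'), cons_d_comp h, e₂, e₃]
      -- Four kinds of terms are left: `d g` with the operator on the tail, `(d g) g'`, `g (d g')`,
      -- and `g g'` merged with the operator further on. Each occurs twice with opposite signs.
      generalize barSum (.cons g' s) (fun t => φ (.cons (D.d rfl g) t)) = A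
      generalize φ (.cons (D.comp rfl (D.d rfl g) g') s) = B
      generalize φ (.cons (D.comp rfl g (D.d rfl g')) s) = C
      generalize mergeVal (D.comp rfl g g') s φ + barSum s _ = E
      rcases mul_self_eq_one_iff.1 e with e | e <;> rw [e] <;> module

end ChainSums

/-! ### The dg category of dg functors and reduced cochains -/

section Coh

variable {D X : DGCat.{u} k}

/-- Families of morphisms indexed by chains. -/
abbrev Fam (D X : DGCat.{u} k) (F G : D.Obj → X.Obj) : Type u :=
  ∀ x y : D.Obj, Chain D x y → Tot X (F x) (G y)

variable {F G H K : D.Obj → X.Obj}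

/-- The cup product of families, where `n` is the degree of the second one. -/
def cup (n : ℤ) : Fam D X G H →ₗ[k] Fam D X F G →ₗ[k] Fam D X F H :=
  LinearMap.mk₂ k (fun ψ φ x y s => splitSum s fun w l r =>
      sgn k (n * l.sdeg) • mulT (ψ w y l) (φ x w r))
    (fun ψ ψ' φ => by
      funext x y s
      simp only [Pi.add_apply, map_add, LinearMap.add_apply, smul_add, splitSum_add])
    (fun c ψ φ => by
      funext x y s
      simp only [Pi.smul_apply, map_smul, LinearMap.smul_apply, smul_comm _ c, splitSum_smul])
    (fun ψ φ φ' => by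
      funext x y s
      simp only [Pi.add_apply, map_add, smul_add, splitSum_add])
    (fun c ψ φ => by
      funext x y s
      simp only [Pi.smul_apply, map_smul, smul_comm _ c, splitSum_smul])

theorem cup_apply (n : ℤ) (ψ : Fam D X G H) (φ : Fam D X F G) {x y : D.Obj} (s : Chain D x y) :
    cup n ψ φ x y s = splitSum s fun w l r => sgn k (n * l.sdeg) • mulT (ψ w y l) (φ x w r) := rfl

/-- Associativity in `X` and coassociativity of cutting. Both bracketings of three factors on parts
`a`, `b`, `c` carry the exponent `n (|a| + |b|) + m |a|`. -/
theorem cup_assoc {m n p : ℤ} (h : m + n = p) (χ : Fam D X H K) (ψ : Fam D X G H)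
    (φ : Fam D X F G) : cup n (cup m χ ψ) φ = cup p χ (cup n ψ φ) := by
  subst h
  funext x y s
  simp only [cup_apply]
  have h₁ : ∀ (v : D.Obj) (l : Chain D v y) (c : Chain D x v),
      sgn k (n * l.sdeg) • mulT (splitSum l fun w a b => sgn k (m * a.sdeg) •
        mulT (χ w y a) (ψ v w b)) (φ x v c) = splitSum l fun w a b =>
        sgn k (n * (a.sdeg + b.sdeg) + m * a.sdeg) • mulT (χ w y a) (mulT (ψ v w b) (φ x v c)) := by
    intro v l c
    rw [← LinearMap.flip_apply, map_splitSum, ← splitSum_smul]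
    refine splitSum_congr fun w a b hab => ?_
    rw [← hab, Chain.sdeg_append, LinearMap.flip_apply, map_smul, LinearMap.smul_apply, smul_smul,
      ← sgn_add, mulT_assoc]
  have h₂ : ∀ (w : D.Obj) (a : Chain D w y) (r : Chain D x w),
      sgn k ((m + n) * a.sdeg) • mulT (χ w y a) (splitSum r fun v b c => sgn k (n * b.sdeg) •
        mulT (ψ v w b) (φ x v c)) = splitSum r fun v b c =>
        sgn k (n * (a.sdeg + b.sdeg) + m * a.sdeg) • mulT (χ w y a) (mulT (ψ v w b) (φ x v c)) := by
    intro w a r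
    rw [map_splitSum, ← splitSum_smul]
    refine splitSum_congr fun v b c _ => ?_
    rw [map_smul, smul_smul, ← sgn_add]
    congr 2
    ring
  simp only [h₁, h₂]
  exact splitSum_assoc s fun v w a b c =>
    sgn k (n * (a.sdeg + b.sdeg) + m * a.sdeg) • mulT (χ w y a) (mulT (ψ v w b) (φ x v c))

/-- The differential of the target, applied to the values of a family. -/
def famDiff : Fam D X F G →ₗ[k] Fam D X F G where
  toFun φ x y s := diffT (φ x y s)
  map_add' φ ψ := by funext x y s; simp
  map_smul' c φ := by funext x y s; simp

/-- Composition of a family with the bar differential. -/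
def famBar : Fam D X F G →ₗ[k] Fam D X F G where
  toFun φ x y s := barSum s (φ x y)
  map_add' φ ψ := by funext x y s; exact barSum_add s _ _
  map_smul' c φ := by funext x y s; exact barSum_smul c s _

theorem famDiff_apply (φ : Fam D X F G) {x y : D.Obj} (s : Chain D x y) :
    famDiff φ x y s = diffT (φ x y s) := rfl

theorem famBar_apply (φ : Fam D X F G) {x y : D.Obj} (s : Chain D x y) :
    famBar φ x y s = barSum s (φ x y) := rfl

/-- A family of degree `n`: its value on `s` has degree `n + ∑ (|gᵢ| - 1)`. -/
def IsHomog (n : ℤ) (φ : Fam D X F G) : Prop :=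
  ∀ x y (s : Chain D x y), φ x y s ∈ homog X (F x) (G y) (n + s.sdeg)

theorem famDiff_famDiff (φ : Fam D X F G) : famDiff (famDiff φ) = 0 := by
  funext x y s
  simp [famDiff_apply]

theorem famDiff_famBar (φ : Fam D X F G) : famDiff (famBar φ) = famBar (famDiff φ) := by
  funext x y s
  simp only [famDiff_apply, famBar_apply, map_barSum]
  rfl

theorem famBar_famBar {φ : Fam D X F G} (h : ∀ x y, IsMulti (φ x y)) : famBar (famBar φ) = 0 := by
  funext x y s
  exact barSum_barSum s (h x y)

theorem famDiff_cup {m n p : ℤ} (hp : n + 1 = p) {ψ : Fam D X G H} (hψ : IsHomog m ψ)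
    (φ : Fam D X F G) :
    famDiff (cup n ψ φ) = cup n (famDiff ψ) φ + sgn k m • cup p ψ (famDiff φ) := by
  subst hp
  funext x y s
  simp only [famDiff_apply, Pi.add_apply, Pi.smul_apply, cup_apply, map_splitSum]
  rw [← splitSum_smul, ← splitSum_add]
  refine splitSum_congr fun w l r _ => ?_
  rw [map_smul, diffT_mulT (hψ _ _ _), smul_add, smul_smul, smul_smul, ← sgn_add, ← sgn_add]
  congr 3
  ring

/-- Dual to `barSum_splitSum`. Acting on the left part raises its degree by one, which produces the
sign of `n`; acting on the right part raises the degree of the second factor, which changes the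
index `n` to `p`. -/
theorem famBar_cup {n p : ℤ} (hp : n + 1 = p) (ψ : Fam D X G H) (φ : Fam D X F G) :
    famBar (cup n ψ φ) = sgn k n • cup n (famBar ψ) φ + cup p ψ (famBar φ) := by
  subst hp
  funext x y s
  simp only [famBar_apply, Pi.add_apply, Pi.smul_apply, cup_apply]
  rw [← splitSum_smul, ← splitSum_add]
  refine (barSum_splitSum s _).trans (splitSum_congr fun w l r _ => ?_)
  congr 1
  · rw [← LinearMap.flip_apply, map_barSum, ← barSum_smul, ← barSum_smul]
    refine barSum_congr fun t ht => ?_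
    rw [LinearMap.flip_apply, smul_smul, ht, ← sgn_add]
    congr 2
    ring
  · rw [barSum_smul, map_barSum, smul_smul, ← sgn_add]
    congr 2
    ring

/-- The family that maps a chain of length `1` to its image under a dg functor and all other
chains to `0`. -/
def edge (F : DGFunctor D X) : Fam D X F.obj F.obj
  | _, _, .nil => 0
  | _, _, .cons (m := m) g .nil => of m (F.map g)
  | _, _, .cons _ (.cons _ _) => 0

@[simp] theorem edge_nil (F : DGFunctor D X) (x : D.Obj) : edge F x x .nil = 0 := rfl

@[simp] theorem edge_single (F : DGFunctor D X) {x y : D.Obj} {m : ℤ} (g : D.Hom x y m) :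
    edge F x y (.cons g .nil) = of m (F.map g) := rfl

@[simp] theorem edge_cons_cons (F : DGFunctor D X) {x y z w : D.Obj} {m n : ℤ} (g : D.Hom y z m)
    (g' : D.Hom w y n) (s : Chain D x w) : edge F x z (.cons g (.cons g' s)) = 0 := rfl

theorem edge_isHomog (F : DGFunctor D X) : IsHomog 1 (edge F) := by
  rintro x y (_ | ⟨g, _ | ⟨g', s⟩⟩)
  · exact Submodule.zero_mem _
  · simp only [edge_single, Chain.sdeg, add_zero]
    have := of_mem_homog (X := X) _ (F.map g)
    simpa using this
  · exact Submodule.zero_mem _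

theorem splitSum_left_nil {M : Type*} [AddCommGroup M] [Module k M] {x : D.Obj} {z : D.Obj} (s : Chain D x z)
    {Φ : ∀ w : D.Obj, Chain D w z → Chain D x w → M}
    (h : ∀ (v w : D.Obj) (m : ℤ) (g : D.Hom w z m) (l : Chain D v w) r,
      Φ v (.cons g l) r = 0) : splitSum s Φ = Φ z .nil s := by
  cases s with
  | nil => simp
  | cons g s =>
    rw [splitSum_cons, splitSum_eq_zero (fun w l r _ => h _ _ _ g l r), add_zero]

theorem splitSum_right_nil {M : Type*} [AddCommGroup M] [Module k M] {x : D.Obj} : ∀ {z : D.Obj}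
    (s : Chain D x z) {Φ : ∀ w : D.Obj, Chain D w z → Chain D x w → M}
    (_ : ∀ (v w : D.Obj) (m : ℤ) l (g : D.Hom v w m) (r : Chain D x v),
      Φ w l (.cons g r) = 0), splitSum s Φ = Φ x s .nil
  | _, .nil, _, _ => by simp
  | _, .cons g s, Φ, h => by
    rw [splitSum_cons, h, zero_add,
      splitSum_right_nil s (Φ := fun w l r => Φ w (.cons g l) r) (fun _ _ _ _ _ _ => h _ _ _ _ _ _)]

/-- `edge G` lives on chains of length one, so only the cut splitting off the last morphism
contributes. -/
theorem cup_edge_left (n : ℤ) (G : DGFunctor D X) (φ : Fam D X F G.obj) {x y z : D.Obj} {m : ℤ}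
    (g : D.Hom y z m) (s : Chain D x y) :
    cup n (edge G) φ x z (.cons g s) =
      sgn k (n * (m - 1)) • mulT (of m (G.map g)) (φ x y s) := by
  rw [cup_apply, splitSum_cons, edge_nil, splitSum_left_nil]
  · simp [Chain.sdeg]
  · intros
    simp

/-- Only the cut that leaves the first morphism alone on the right contributes. The left factor is
an arbitrary `Φ` so that the induction can absorb the morphisms of `s` into it. -/
theorem cup_edge_right_aux (G' : DGFunctor D X) : ∀ {v z : D.Obj} (s : Chain D v z)
    {x : D.Obj} {m : ℤ} (g : D.Hom x v m) {a : X.Obj}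
    (Φ : ∀ w, Chain D w z → Tot X (G'.obj w) a),
    splitSum (s.append (.cons g .nil)) (fun w l r => sgn k (1 * l.sdeg) •
      mulT (Φ w l) (edge G' x w r)) = sgn k s.sdeg • mulT (Φ v s) (of m (G'.map g))
  | _, _, .nil, x, m, g, a, Φ => by
      simp [Chain.append, Chain.sdeg]
  | _, _, .cons (m := n) g' s, x, m, g, a, Φ => by
      have h := cup_edge_right_aux G' s g (fun w l => Φ w (.cons g' l))
      have h₀ : edge G' x _ (.cons g' (s.append (.cons g .nil))) = 0 := by
        cases s <;> rfl
      simp only [Chain.append, splitSum_cons, h₀, map_zero, smul_zero, zero_add, Chain.sdeg,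
        mul_add, sgn_add _ (1 * _), mul_smul, splitSum_smul, h]
      simp [sgn_add, mul_smul]

theorem cup_edge_right (F' : DGFunctor D X) (φ : Fam D X F'.obj G) {x v z : D.Obj} {m : ℤ}
    (s : Chain D v z) (g : D.Hom x v m) :
    cup 1 φ (edge F') x z (s.append (.cons g .nil)) =
      sgn k s.sdeg • mulT (φ v z s) (of m (F'.map g)) := by
  rw [cup_apply]
  exact cup_edge_right_aux F' s g fun w l => φ w z l

/-- The Maurer-Cartan equation for the family `edge F`. -/
theorem edge_mc (F : DGFunctor D X) :
    famDiff (edge F) - famBar (edge F) + cup 1 (edge F) (edge F) = 0 := by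
  funext x y s
  simp only [Pi.add_apply, Pi.sub_apply, Pi.zero_apply, famDiff_apply, famBar_apply]
  -- In length one the equation is compatibility of `F` with differentials, in length two
  -- compatibility with composition. In all other lengths every term vanishes.
  rcases s with _ | ⟨g, _ | ⟨g', _ | ⟨g'', s⟩⟩⟩
  · simp [cup_apply]
  · rw [cup_edge_left]
    simp [F.map_d, of_d]
  · rw [cup_edge_left]
    simp [F.map_comp, of_comp]
  · rw [cup_edge_left]
    simp

/-- The differential of cochains between two dg functors: the convolution differential twisted by
the families `edge`. -/
def twDiff (n : ℤ) (F G : DGFunctor D X) : Fam D X F.obj G.obj →ₗ[k] Fam D X F.obj G.obj :=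
  famDiff + sgn k n • famBar + cup n (edge G) - sgn k n • (cup 1).flip (edge F)

theorem twDiff_eq (n : ℤ) (F G : DGFunctor D X) (φ : Fam D X F.obj G.obj) :
    twDiff n F G φ = famDiff φ + sgn k n • famBar φ + cup n (edge G) φ -
      sgn k n • cup 1 φ (edge F) := rfl

/-- The untwisted operators anticommute up to the built-in signs and square to zero. What the twists
add is acted on by the curvatures of `edge F` and `edge G`, which vanish by `edge_mc`. -/
theorem twDiff_twDiff {n p : ℤ} (h : n + 1 = p) (F G : DGFunctor D X) {φ : Fam D X F.obj G.obj}
    (hφ : IsHomog n φ) (hm : ∀ x y, IsMulti (φ x y)) :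
    twDiff p F G (twDiff n F G φ) = 0 := by
  have h2 : p = 1 + n := by omega
  have e : sgn k p = -sgn k n := by rw [← h, neg_sgn]
  have hs := sgn_mul_self (k := k) n
  have mcF : famDiff (edge F) = famBar (edge F) - cup 1 (edge F) (edge F) := by
    have := edge_mc F
    rw [← sub_eq_zero, ← this]
    abel
  have mcG : famDiff (edge G) = famBar (edge G) - cup 1 (edge G) (edge G) := by
    have := edge_mc G
    rw [← sub_eq_zero, ← this]
    abel
  simp only [twDiff_eq, map_add, map_sub, map_smul, LinearMap.sub_apply, famDiff_famDiff, famDiff_famBar, famBar_famBar hm,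
    famDiff_cup h (edge_isHomog G), famDiff_cup (rfl : (1 : ℤ) + 1 = 2) hφ,
    famBar_cup h, famBar_cup (rfl : (1 : ℤ) + 1 = 2), mcF, mcG, sgn_one, e,
    cup_assoc (rfl : (1 : ℤ) + 1 = 2) φ, cup_assoc (show 1 + n = p by omega),
    cup_assoc (show n + 1 = p by omega)]
  -- The sign of `n` enters quadratically; with its value fixed to `1` or `-1` the identity is
  -- linear.
  rcases mul_self_eq_one_iff.1 hs with e | e <;> rw [e] <;> module

theorem twDiff_cup {m n p n' : ℤ} (hp : m + n = p) (hn : n + 1 = n') (F G H : DGFunctor D X)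
    {ψ : Fam D X G.obj H.obj} (hψ : IsHomog m ψ) (φ : Fam D X F.obj G.obj) :
    twDiff p F H (cup n ψ φ) =
      cup n (twDiff m G H ψ) φ + sgn k m • cup n' ψ (twDiff n F G φ) := by
  simp only [twDiff_eq, map_add, map_sub, map_smul, LinearMap.add_apply, LinearMap.sub_apply,
    LinearMap.smul_apply, famDiff_cup hn hψ, famBar_cup hn, cup_assoc hp,
    cup_assoc hn, cup_assoc (show 1 + n = n' by omega), ← hp, sgn_add]
  rcases mul_self_eq_one_iff.1 (sgn_mul_self (k := k) n) with e | e <;> rw [e] <;> module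

theorem cons_id_comp {x y z : D.Obj} {n : ℤ} (g : D.Hom y z n) (s : Chain D x y) :
    Chain.cons (D.comp rfl (D.id z) g) s = Chain.cons g s := by
  rw [← cons_comp_eq (zero_add n), D.id_comp]

theorem cons_comp_id {x y z : D.Obj} {n : ℤ} (g : D.Hom y z n) (s : Chain D x y) :
    Chain.cons (D.comp rfl g (D.id y)) s = Chain.cons g s := by
  rw [← cons_comp_eq (add_zero n), D.comp_id]

/-- For a normalized `ψ` only one term survives: the one merging the identity with its neighbour,
or, when `s` is empty, the product with `F id = id`. Both give `-ψ x s`. -/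
theorem barSum_id_cons (F : DGFunctor D X) {x z : D.Obj} {a : X.Obj} (s : Chain D x z)
    {ψ : ∀ w, Chain D w z → Tot X (F.obj w) a} (hm : ∀ w, IsMulti (ψ w))
    (hn : ∀ w, IsNormal (ψ w)) :
    barSum (.cons (D.id z) s) (ψ x) - splitSum (.cons (D.id z) s) (fun w l r =>
      sgn k (1 * l.sdeg) • mulT (ψ w l) (edge F x w r)) = -ψ x s := by
  have h₁ : barSum s (fun t => ψ x (.cons (D.id z) t)) = 0 := by
    simp only [(hn x).head, barSum_zero]
  have h₂ : ψ x (.cons (D.d rfl (D.id z)) s) = 0 := by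
    rw [d_id]
    exact ((hm x).head s).map_zero
  rw [barSum_cons, splitSum_cons, h₁, h₂]
  simp only [(hn _).head, map_zero, LinearMap.zero_apply, smul_zero, splitSum_zero]
  cases s with
  | nil =>
    simp only [edge_single, F.map_id, Chain.sdeg]
    rw [← oneT]
    simp [sgn_zero]
  | cons g s =>
    have : sgn k (-1) = -1 := by rw [← sgn_one]; exact sgn_congr (by decide)
    simp [cons_id_comp, this]

/-- An identity that is not the last morphism can be merged into the morphism after it; this cancels
the contribution computed in `barSum_id_cons`. If there are further morphisms in between, the tail
is handled by induction. -/
theorem barSum_append_id (F : DGFunctor D X) {x v : D.Obj} {a : X.Obj} (s : Chain D x v) :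
    ∀ {y z : D.Obj} {m : ℤ} (g : D.Hom y z m) (l : Chain D v y)
    {ψ : ∀ w, Chain D w z → Tot X (F.obj w) a} (_ : ∀ w, IsMulti (ψ w))
    (_ : ∀ w, IsNormal (ψ w)),
    barSum (.cons g (l.append (.cons (D.id v) s))) (ψ x) -
      splitSum (.cons g (l.append (.cons (D.id v) s))) (fun w l r =>
        sgn k (1 * l.sdeg) • mulT (ψ w l) (edge F x w r)) = 0
  | y, z, m, g, l, ψ, hm, hn => by
    have h₁ : edge F x z (.cons g (l.append (.cons (D.id v) s))) = 0 := by cases l <;> rfl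
    have h₂ : ψ x (.cons (D.d rfl g) (l.append (.cons (D.id v) s))) = 0 :=
      (hn x).tail (D.d rfl g) l s
    rw [barSum_cons, splitSum_cons, h₁, h₂]
    simp only [Chain.sdeg, mul_add, sgn_add _ (1 * _), mul_smul, splitSum_smul, map_zero, smul_zero,
      zero_add]
    rw [one_mul, ← smul_sub, add_sub_assoc]
    have key : mergeVal g (l.append (.cons (D.id v) s)) (ψ x) +
      (barSum (l.append (.cons (D.id v) s)) (fun t => ψ x (.cons g t)) -
        splitSum (l.append (.cons (D.id v) s)) (fun w l r => sgn k (1 * l.sdeg) •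
          mulT (ψ w (.cons g l)) (edge F x w r))) = 0 := by
      cases l with
      | nil =>
        have := barSum_id_cons F s (fun w => (hm w).tail g) fun w => (hn w).tail g
        simp only [Chain.append, this, mergeVal_cons, cons_comp_id, add_neg_cancel]
      | cons g' l =>
        have := barSum_append_id F s g' l (fun w => (hm w).tail g) fun w => (hn w).tail g
        simp only [Chain.append, this, mergeVal_cons, add_zero]
        exact (hn x).tail _ l s
    rw [key, smul_zero]

/-- The bar part alone does not preserve normalization, since an identity at an end of the chain has
only one neighbour to merge with. The products with `edge F` and `edge G` supply the missing terms.
-/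
theorem twDiff_isNormal (n : ℤ) (F G : DGFunctor D X) {φ : Fam D X F.obj G.obj}
    (hm : ∀ x y, IsMulti (φ x y)) (hn : ∀ x y, IsNormal (φ x y)) (x y : D.Obj) :
    IsNormal (twDiff n F G φ x y) := by
  intro v l s
  rw [twDiff_eq]
  simp only [Pi.add_apply, Pi.sub_apply, Pi.smul_apply, famDiff_apply, famBar_apply, hn x y l s,
    map_zero, zero_add]
  rw [add_sub_right_comm, ← smul_sub]
  cases l with
  | nil =>
    have := barSum_id_cons F s (fun w => hm w y) (fun w => hn w y)
    rw [← cup_apply] at this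
    simp only [Chain.append, cup_edge_left, this, G.map_id]
    rw [← oneT, oneT_mulT, smul_neg, neg_add_eq_zero]
    congr 1
    exact sgn_congr (by simp [parity_simps])
  | cons g l =>
    have := barSum_append_id F s g l (fun w => hm w y) (fun w => hn w y)
    rw [← cup_apply] at this
    have h := hn x _ l s
    simp only [Chain.append, cup_edge_left, this, h, map_zero, smul_zero, add_zero]

theorem isMulti_smul_sdeg {x y : D.Obj} {M : Type*} [AddCommGroup M] [Module k M] (n : ℤ)
    {φ : Chain D x y → M} (h : IsMulti φ) : IsMulti (fun s => sgn k (n * s.sdeg) • φ s) :=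
  fun u v m l s => by
    simp only [Chain.sdeg_append, Chain.sdeg]
    exact IsLinearMap.smul' _ (h l s)

theorem isNormal_smul_sdeg {x y : D.Obj} {M : Type*} [AddCommGroup M] [Module k M] (n : ℤ)
    {φ : Chain D x y → M} (h : IsNormal φ) : IsNormal (fun s => sgn k (n * s.sdeg) • φ s) :=
  fun u l s => by
    simp only [h l s, smul_zero]

theorem cup_isMulti (n : ℤ) {ψ : Fam D X G H} {φ : Fam D X F G} (hψ : ∀ x y, IsMulti (ψ x y))
    (hφ : ∀ x y, IsMulti (φ x y)) (x y : D.Obj) : IsMulti (cup n ψ φ x y) :=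
  splitSum_isMulti
    (fun w r => isMulti_smul_sdeg n ((hψ w y).comp (mulT.flip (φ x w r)).isLinear))
    (fun w l => (hφ x w).comp ((sgn k (n * l.sdeg) • mulT (ψ w y l)).isLinear))

theorem cup_isNormal (n : ℤ) {ψ : Fam D X G H} {φ : Fam D X F G} (hψ : ∀ x y, IsNormal (ψ x y))
    (hφ : ∀ x y, IsNormal (φ x y)) (x y : D.Obj) : IsNormal (cup n ψ φ x y) :=
  splitSum_isNormal
    (fun w r => isNormal_smul_sdeg n ((hψ w y).comp (mulT.flip (φ x w r)).isLinear))
    (fun w l => (hφ x w).comp ((sgn k (n * l.sdeg) • mulT (ψ w y l)).isLinear))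

theorem splitSum_mem {M : Type*} [AddCommGroup M] [Module k M] (S : Submodule k M) {x z : D.Obj}
    (s : Chain D x z) {Φ : ∀ w : D.Obj, Chain D w z → Chain D x w → M}
    (h : ∀ w l r, Chain.append l r = s → Φ w l r ∈ S) : splitSum s Φ ∈ S := by
  refine list_sum_mem fun a ha => ?_
  obtain ⟨t, _, rfl⟩ := List.mem_map.1 ha
  exact h _ _ _ t.append_eq

theorem barSum_mem {M : Type*} [AddCommGroup M] [Module k M] (S : Submodule k M) {x z : D.Obj}
    (s : Chain D x z) {φ : Chain D x z → M}
    (h : ∀ t : Chain D x z, t.sdeg = s.sdeg + 1 → φ t ∈ S) : barSum s φ ∈ S := by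
  refine list_sum_mem fun a ha => ?_
  obtain ⟨t, _, rfl⟩ := List.mem_map.1 ha
  exact S.smul_mem _ (h _ t.deg)

theorem cup_isHomog {m n p : ℤ} (h : m + n = p) {q : ℤ} {ψ : Fam D X G H} {φ : Fam D X F G}
    (hψ : IsHomog m ψ) (hφ : IsHomog n φ) : IsHomog p (cup q ψ φ) := fun x y s => by
  rw [cup_apply]
  refine splitSum_mem _ s fun w l r hlr => Submodule.smul_mem _ _
    (mulT_mem_homog (hψ w y l) (hφ x w r) ?_)
  rw [← hlr, Chain.sdeg_append]
  omega

theorem twDiff_isHomog {n p : ℤ} (h : n + 1 = p) (F G : DGFunctor D X) {φ : Fam D X F.obj G.obj}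
    (hφ : IsHomog n φ) : IsHomog p (twDiff n F G φ) := fun x y s => by
  rw [twDiff_eq]
  refine Submodule.sub_mem _ (Submodule.add_mem _ (Submodule.add_mem _ ?_ ?_) ?_) ?_
  · exact diffT_mem_homog (hφ _ _ _) (by omega)
  · refine Submodule.smul_mem _ _ (barSum_mem _ s fun t ht => ?_)
    have := hφ x y t
    rwa [ht, show n + (s.sdeg + 1) = p + s.sdeg by omega] at this
  · exact cup_isHomog (show 1 + n = p by omega) (edge_isHomog G) hφ x y s
  · exact Submodule.smul_mem _ _ (cup_isHomog h hφ (edge_isHomog F) x y s)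

theorem edge_isMulti (F : DGFunctor D X) (x y : D.Obj) : IsMulti (edge F x y) := by
  have aux : ∀ {u v : D.Obj} {n : ℤ} (l : Chain D v y) (s : Chain D x u),
      IsLinearMap k (fun g : D.Hom u v n => edge F x y (l.append (.cons g s))) := by
    intro u v n l s
    rcases l with _ | ⟨g', _ | ⟨g'', l⟩⟩
    · cases s with
      | nil => exact (of n ∘ₗ F.map).isLinear
      | cons g' s => exact isLinearMap_zero
    · exact isLinearMap_zero
    · exact isLinearMap_zero
  exact fun u v n l s => aux l s

theorem IsMulti.add {x y : D.Obj} {M : Type*} [AddCommGroup M] [Module k M] {φ ψ : Chain D x y → M}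
    (hφ : IsMulti φ) (hψ : IsMulti ψ) : IsMulti (fun s => φ s + ψ s) :=
  fun _ _ _ l s => IsLinearMap.add' (hφ l s) (hψ l s)

theorem IsMulti.smul {x y : D.Obj} {M : Type*} [AddCommGroup M] [Module k M] {φ : Chain D x y → M}
    (c : k) (hφ : IsMulti φ) : IsMulti (fun s => c • φ s) :=
  fun _ _ _ l s => IsLinearMap.smul' c (hφ l s)

theorem twDiff_isMulti (n : ℤ) (F G : DGFunctor D X) {φ : Fam D X F.obj G.obj}
    (h : ∀ x y, IsMulti (φ x y)) (x y : D.Obj) : IsMulti (twDiff n F G φ x y) := by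
  have e : twDiff n F G φ x y = fun s => famDiff φ x y s + sgn k n • famBar φ x y s +
      cup n (edge G) φ x y s + (-sgn k n) • cup 1 φ (edge F) x y s := by
    funext s
    simp [twDiff_eq, sub_eq_add_neg]
  rw [e]
  exact (((h x y).comp diffT.isLinear).add ((barSum_isMulti (h x y)).smul _)).add
    (cup_isMulti n (edge_isMulti G) h x y) |>.add
    ((cup_isMulti 1 h (edge_isMulti F) x y).smul _)

/-- The space of reduced cochains of degree `n` between two dg functors. -/
def cohHom (F G : DGFunctor D X) (n : ℤ) : Submodule k (Fam D X F.obj G.obj) where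
  carrier := {φ | IsHomog n φ ∧ (∀ x y, IsMulti (φ x y)) ∧ ∀ x y, IsNormal (φ x y)}
  add_mem' hφ hψ := ⟨fun x y s => Submodule.add_mem _ (hφ.1 x y s) (hψ.1 x y s),
    fun x y => (hφ.2.1 x y).add (hψ.2.1 x y), fun x y u l s => by
      simp [hφ.2.2 x y l s, hψ.2.2 x y l s]⟩
  zero_mem' := ⟨fun _ _ _ => Submodule.zero_mem _, fun _ _ _ _ _ _ _ => isLinearMap_zero,
    fun _ _ _ _ _ => rfl⟩
  smul_mem' c φ hφ := ⟨fun x y s => Submodule.smul_mem _ _ (hφ.1 x y s),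
    fun x y => (hφ.2.1 x y).smul c, fun x y u l s => by simp [hφ.2.2 x y l s]⟩

/-- The family that maps empty chains to identities and all other chains to `0`. -/
def oneFam (F : D.Obj → X.Obj) : Fam D X F F
  | x, _, .nil => oneT (F x)
  | _, _, .cons _ _ => 0

@[simp] theorem oneFam_nil (F : D.Obj → X.Obj) (x : D.Obj) :
    oneFam F x x .nil = oneT (F x) := rfl

@[simp] theorem oneFam_cons (F : D.Obj → X.Obj) {x y z : D.Obj} {m : ℤ} (g : D.Hom y z m)
    (s : Chain D x y) : oneFam F x z (.cons g s) = 0 := rfl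

theorem oneFam_mem (F : DGFunctor D X) : oneFam F.obj ∈ cohHom F F 0 := by
  refine ⟨?_, fun x y u v n l s => ?_, fun x y u l s => ?_⟩
  · rintro x y (_ | ⟨g, s⟩)
    · exact of_mem_homog 0 _
    · exact Submodule.zero_mem _
  · cases l <;> exact isLinearMap_zero
  · cases l <;> rfl

theorem oneFam_cup (n : ℤ) (φ : Fam D X F G) : cup n (oneFam G) φ = φ := by
  funext x y s
  rw [cup_apply, splitSum_left_nil]
  · simp [Chain.sdeg, sgn_zero]
  · intros
    simp

theorem cup_oneFam (φ : Fam D X F G) : cup 0 φ (oneFam F) = φ := by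
  funext x y s
  rw [cup_apply, splitSum_right_nil]
  · simp [sgn_zero]
  · intros
    simp

theorem cup_mem {F G H : DGFunctor D X} {m n p : ℤ} (h : m + n = p) {ψ : Fam D X G.obj H.obj}
    {φ : Fam D X F.obj G.obj} (hψ : ψ ∈ cohHom G H m) (hφ : φ ∈ cohHom F G n) :
    cup n ψ φ ∈ cohHom F H p :=
  ⟨cup_isHomog h hψ.1 hφ.1, cup_isMulti n hψ.2.1 hφ.2.1, cup_isNormal n hψ.2.2 hφ.2.2⟩

theorem twDiff_mem {F G : DGFunctor D X} {n p : ℤ} (h : n + 1 = p) {φ : Fam D X F.obj G.obj}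
    (hφ : φ ∈ cohHom F G n) : twDiff n F G φ ∈ cohHom F G p :=
  ⟨twDiff_isHomog h F G hφ.1, twDiff_isMulti n F G hφ.2.1, twDiff_isNormal n F G hφ.2.1 hφ.2.2⟩

/-- The dg category of dg functors `D → X` and reduced cochains, which is right adjoint to the
twisted tensor product. -/
def Coh (D X : DGCat.{u} k) : DGCat.{u} k where
  Obj := DGFunctor D X
  Hom F G n := cohHom F G n
  id F := ⟨oneFam F.obj, oneFam_mem F⟩
  comp {F G H m n p} h := LinearMap.mk₂ k (fun ψ φ => ⟨cup n ψ.1 φ.1, cup_mem h ψ.2 φ.2⟩)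
    (fun _ _ _ => Subtype.ext (by simp)) (fun _ _ _ => Subtype.ext (by simp))
    (fun _ _ _ => Subtype.ext (by simp)) (fun _ _ _ => Subtype.ext (by simp))
  d {F G n p} h := (twDiff n F G).restrict fun _ hφ => twDiff_mem h hφ
  id_comp φ := Subtype.ext (oneFam_cup _ _)
  comp_id φ := Subtype.ext (cup_oneFam _)
  assoc χ ψ φ _ hmn _ _ := Subtype.ext (cup_assoc hmn χ.1 ψ.1 φ.1)
  d_d hp _ φ := Subtype.ext (twDiff_twDiff hp _ _ φ.2.1 φ.2.2.1)
  leibniz ψ φ hp _ _ hn _ _ := by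
    rw [negOnePow_smul (k := k)]
    exact Subtype.ext (twDiff_cup hp hn _ _ _ ψ.2.1 φ.1)

end Coh

/-! ### Evaluation of cochains -/

section Ev

variable {D X : DGCat.{u} k}

/-- The dg functor that an object of `Coh D X` is. -/
def cohFun (F : (Coh D X).Obj) : DGFunctor D X := F

variable {F G H : (Coh D X).Obj}

/-- The family underlying a cochain. -/
def cohVal {n : ℤ} : (Coh D X).Hom F G n →ₗ[k] Fam D X (cohFun F).obj (cohFun G).obj where
  toFun φ := Subtype.val (p := fun φ => φ ∈ cohHom (cohFun F) (cohFun G) n) φ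
  map_add' _ _ := rfl
  map_smul' _ _ := rfl

theorem cohVal_mem {n : ℤ} (φ : (Coh D X).Hom F G n) :
    cohVal φ ∈ cohHom (cohFun F) (cohFun G) n :=
  Subtype.property (p := fun φ => φ ∈ cohHom (cohFun F) (cohFun G) n) φ

theorem cohVal_injective {n : ℤ} :
    Function.Injective (cohVal : (Coh D X).Hom F G n →ₗ[k] _) :=
  Subtype.val_injective (p := fun φ => φ ∈ cohHom (cohFun F) (cohFun G) n)

/-- The family underlying a cochain that need not be homogeneous. -/
def ev : Tot (Coh D X) F G →ₗ[k] Fam D X (cohFun F).obj (cohFun G).obj :=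
  Tot.lift fun _ => cohVal

@[simp] theorem ev_of (n : ℤ) (φ : (Coh D X).Hom F G n) : ev (of n φ) = cohVal φ := by
  rw [ev, Tot.lift_of]

theorem homog_component_ne {x y : X.Obj} {m n : ℤ} {a : Tot X x y} (h : a ∈ homog X x y m)
    (hmn : m ≠ n) : a n = 0 := by
  obtain ⟨a, rfl⟩ := h
  exact DirectSum.of_eq_of_ne _ _ _ hmn.symm

/-- A cochain of degree `m` takes values of degree `m + s.sdeg` on `s`, so the degree of the value
tells which component of `a` it came from. -/
theorem ev_component (a : Tot (Coh D X) F G) (n : ℤ) {x y : D.Obj} (s : Chain D x y) :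
    ev a x y s (n + s.sdeg) = cohVal (a n) x y s (n + s.sdeg) := by
  induction a using Tot.induction with
  | h₀ =>
    rw [map_zero, DirectSum.zero_apply, map_zero]
  | h₂ a b ha hb =>
    rw [map_add, DirectSum.add_apply, map_add]
    exact congrArg₂ (· + ·) ha hb
  | h₁ m φ =>
    rw [ev_of]
    by_cases hmn : m = n
    · subst hmn
      rw [of_apply_self]
    · rw [homog_component_ne ((cohVal_mem φ).1 x y s) (fun h => hmn (by omega)),
        homog_component_ne (of_mem_homog (X := Coh D X) m φ) hmn, map_zero]
      rfl

/-- Components of different degrees cannot interfere in any value, by `ev_component`. Hence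
identities in the total space of `Coh D X` may be tested on chains, with no degree bookkeeping. -/
theorem ev_injective : Function.Injective (ev : Tot (Coh D X) F G →ₗ[k] _) := by
  rw [injective_iff_map_eq_zero]
  intro a ha
  refine DFinsupp.ext fun n => cohVal_injective ?_
  funext x y s
  have h := ev_component a n s
  rw [ha] at h
  rw [← of_component ((cohVal_mem (a n)).1 x y s), ← h]
  exact map_zero _

theorem ev_mulT {m n : ℤ} (ψ : (Coh D X).Hom G H m) (φ : (Coh D X).Hom F G n) :
    ev (mulT (of m ψ) (of n φ)) = cup n (cohVal ψ) (cohVal φ) := by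
  rw [← of_comp rfl, ev_of]
  rfl

theorem ev_diffT {n : ℤ} (φ : (Coh D X).Hom F G n) :
    ev (diffT (of n φ)) = twDiff n (cohFun F) (cohFun G) (cohVal φ) := by
  rw [← of_d rfl, ev_of]
  rfl

theorem ev_oneT : ev (oneT F) = oneFam (cohFun F).obj := ev_of _ _

end Ev

/-! ### The adjunction between `tensor` and `Coh` -/

section Lift

variable {C D Y : DGCat.{u} k} (Θ : DGFunctor C (Coh D Y))

/-- The dg functor `D → Y` attached to an object by a dg functor `C → Coh D Y`. -/
def adjObj (c : C.Obj) : DGFunctor D Y := Θ.obj c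

/-- The cochain attached to a morphism by a dg functor `C → Coh D Y`. -/
def adjFam {c₀ c₁ : C.Obj} {m : ℤ} (f : C.Hom c₀ c₁ m) :
    Fam D Y (adjObj Θ c₀).obj (adjObj Θ c₁).obj :=
  cohVal (Θ.map f)

theorem adjFam_mem {c₀ c₁ : C.Obj} {m : ℤ} (f : C.Hom c₀ c₁ m) :
    adjFam Θ f ∈ cohHom (adjObj Θ c₀) (adjObj Θ c₁) m := cohVal_mem (Θ.map f)

theorem adjFam_id (c : C.Obj) : adjFam Θ (C.id c) = oneFam (adjObj Θ c).obj :=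
  congrArg cohVal (Θ.map_id c)

theorem adjFam_comp {c₀ c₁ c₂ : C.Obj} {m n p : ℤ} (h : m + n = p) (g : C.Hom c₁ c₂ m)
    (f : C.Hom c₀ c₁ n) : adjFam Θ (C.comp h g f) = cup n (adjFam Θ g) (adjFam Θ f) :=
  congrArg cohVal (Θ.map_comp h g f)

theorem adjFam_d {c₀ c₁ : C.Obj} {m p : ℤ} (h : m + 1 = p) (f : C.Hom c₀ c₁ m) :
    adjFam Θ (C.d h f) = twDiff m (adjObj Θ c₀) (adjObj Θ c₁) (adjFam Θ f) :=
  congrArg cohVal (Θ.map_d h f)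

theorem adjFam_add {c₀ c₁ : C.Obj} {m : ℤ} (f g : C.Hom c₀ c₁ m) :
    adjFam Θ (f + g) = adjFam Θ f + adjFam Θ g :=
  congrArg cohVal (map_add Θ.map f g)

theorem adjFam_smul {c₀ c₁ : C.Obj} {m : ℤ} (r : k) (f : C.Hom c₀ c₁ m) :
    adjFam Θ (r • f) = r • adjFam Θ f :=
  congrArg cohVal (map_smul Θ.map r f)

/-- The value of an expression under the dg functor `tensor C D → Y` adjoint to `Θ`. -/
def Expr.eval : ∀ {x y : C.Obj × D.Obj} {n : ℤ}, Expr C D x y n →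
    Y.Hom ((adjObj Θ x.1).obj x.2) ((adjObj Θ y.1).obj y.2) n
  | _, _, _, .zero => 0
  | _, _, _, .add a b => a.eval + b.eval
  | _, _, _, .smul r a => r • a.eval
  | _, _, _, .id x => Y.id _
  | _, _, _, .comp h b a => Y.comp h b.eval a.eval
  | _, _, _, .d h a => Y.d h a.eval
  | _, _, _, .right c g => (adjObj Θ c).map g
  -- The value of the family on `s` is concentrated in degree `|f| + s.sdeg = p`; taking the
  -- component in degree `p` replaces a cast.
  | _, _, _, .eps (p := p) f s _ => adjFam Θ f _ _ s p

theorem Expr.eval_sum {x y : C.Obj × D.Obj} {n : ℤ} : ∀ l : List (Expr C D x y n),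
    (Expr.sum l).eval Θ = (l.map (Expr.eval Θ)).sum
  | [] => rfl
  | a :: l => by simp [Expr.sum, Expr.eval, Expr.eval_sum l]

theorem of_adjFam {c₀ c₁ : C.Obj} {d₀ d₁ : D.Obj} {m p : ℤ} (f : C.Hom c₀ c₁ m)
    (s : Chain D d₀ d₁) (h : m + s.sdeg = p) :
    of p (adjFam Θ f d₀ d₁ s p) = adjFam Θ f d₀ d₁ s := by
  subst h
  exact of_component ((adjFam_mem Θ f).1 _ _ s)

theorem of_eval_eps {c₀ c₁ : C.Obj} {d₀ d₁ : D.Obj} {m p : ℤ} (f : C.Hom c₀ c₁ m)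
    (s : Chain D d₀ d₁) (h : m + s.sdeg = p) :
    of p ((Expr.eps f s h).eval Θ) = adjFam Θ f d₀ d₁ s :=
  of_adjFam Θ f s h

/-- The relations are the properties of `Θ` in disguise. Those for `right` say that each `adjObj Θ
c` is a dg functor, linearity and vanishing in the chain say that cochains are multilinear and
reduced, `eps_comp` is the cup product, and the relations for `d ε` are the formula for `twDiff`. -/
theorem Rel.eval {x y : C.Obj × D.Obj} {n : ℤ} {a b : Expr C D x y n} (h : Rel C D a b) :
    a.eval Θ = b.eval Θ := by
  induction h with
  | refl a => rfl
  | symm _ ih => exact ih.symm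
  | trans _ _ ih₁ ih₂ => exact ih₁.trans ih₂
  | add_congr _ _ ih₁ ih₂ => simp only [Expr.eval, ih₁, ih₂]
  | smul_congr r _ ih => simp only [Expr.eval, ih]
  | comp_congr h _ _ ih₁ ih₂ => simp only [Expr.eval, ih₁, ih₂]
  | d_congr h _ ih => simp only [Expr.eval, ih]
  | add_assoc a b c => exact _root_.add_assoc _ _ _
  | add_comm a b => exact _root_.add_comm _ _
  | zero_add a => exact _root_.zero_add _
  | smul_add r a b => exact _root_.smul_add _ _ _
  | add_smul r s a => exact _root_.add_smul _ _ _
  | mul_smul r s a => exact SemigroupAction.mul_smul _ _ _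
  | one_smul a => exact _root_.one_smul _ _
  | zero_smul a => exact _root_.zero_smul _ _
  | comp_add h b a a' => exact map_add _ _ _
  | add_comp h b b' a => exact LinearMap.map_add₂ _ _ _ _
  | comp_smul h r b a => exact map_smul _ _ _
  | smul_comp h r b a => exact LinearMap.map_smul₂ _ _ _ _
  | d_add h a b => exact map_add _ _ _
  | d_smul h r a => exact map_smul _ _ _
  | id_comp h a => exact Y.id_comp _
  | comp_id h a => exact Y.comp_id _
  | comp_assoc c b a hlm hmn h₁ h₂ => exact Y.assoc _ _ _ _ _ _ _
  | d_d hp hq a => exact Y.d_d _ _ _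
  | leibniz b a hp hq hm hn h₁ h₂ =>
      refine (Y.leibniz _ _ hp hq hm hn h₁ h₂).trans ?_
      rw [negOnePow_smul (k := k)]
      rfl
  | right_add c g g' => exact map_add _ _ _
  | right_smul c r g => exact map_smul _ _ _
  | right_id c x => exact (adjObj Θ c).map_id x
  | right_comp c h g g' => exact (adjObj Θ c).map_comp h g g'
  | d_right c h g => exact ((adjObj Θ c).map_d h g).symm
  | eps_add f f' s h =>
      refine of_injective _ ?_
      rw [of_eval_eps, Expr.eval, map_add, of_eval_eps, of_eval_eps, adjFam_add]
      rfl
  | eps_smul r f s h =>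
      refine of_injective _ ?_
      rw [of_eval_eps, Expr.eval, map_smul, of_eval_eps, adjFam_smul]
      rfl
  | eps_chain_add f l g g' s h h₁ h₂ =>
      refine of_injective _ ?_
      rw [of_eval_eps, Expr.eval, map_add, of_eval_eps, of_eval_eps]
      exact ((adjFam_mem Θ f).2.1 _ _ l s).map_add g g'
  | eps_chain_smul f l r g s h h₁ =>
      refine of_injective _ ?_
      rw [of_eval_eps, Expr.eval, map_smul, of_eval_eps]
      exact ((adjFam_mem Θ f).2.1 _ _ l s).map_smul r g
  | eps_id_nil c x h =>
      refine of_injective _ ?_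
      rw [of_eval_eps, adjFam_id]
      rfl
  | eps_id_cons c g s h =>
      refine of_injective _ ?_
      rw [of_eval_eps, adjFam_id]
      exact (map_zero _).symm
  | eps_chain_id f l s h =>
      refine of_injective _ ?_
      rw [of_eval_eps]
      exact ((adjFam_mem Θ f).2.2 _ _ l s).trans (map_zero _).symm
  | eps_comp f₂ f₁ s hm h =>
      refine of_injective _ ?_
      rw [of_eval_eps, adjFam_comp, cup_apply, Expr.eval_sum, map_list_sum, List.map_map,
        List.map_map, splitSum]
      refine congrArg List.sum (List.map_congr_left fun t _ => ?_)
      simp only [Function.comp_apply, Expr.eval, map_smul]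
      rw [of_comp]
      exact (congrArg₂ (fun a b => _ • mulT a b) (of_eval_eps Θ f₂ t.left rfl)
        (of_eval_eps Θ f₁ t.right rfl)).symm
  | d_eps_nil f x h hq hm h' =>
      refine of_injective _ ?_
      rw [Expr.eval, of_d, of_eval_eps, of_eval_eps, adjFam_d, twDiff_eq]
      simp [famDiff_apply, famBar_apply, cup_apply]
  | d_eps_cons f g s s' g' hs h hq hm =>
      rename_i m m' n n' p q
      refine of_injective _ ?_
      have key := congrFun (congrFun (congrFun (adjFam_d Θ hm f) _) _) (.cons g s)
      rw [twDiff_eq] at key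
      simp only [Pi.add_apply, Pi.sub_apply, Pi.smul_apply, famDiff_apply, famBar_apply,
        cup_edge_left] at key
      -- The product with `edge` on the right splits off the first morphism, so the chain must be
      -- displayed with its first morphism `g'` separated.
      rw [congrArg (cup 1 _ _ _ _) hs, cup_edge_right] at key
      simp only [Expr.eval, map_add, map_smul, of_d, of_comp, Expr.eval_sum, map_list_sum,
        List.map_map]
      rw [of_adjFam Θ f _ h, of_adjFam Θ f s rfl, of_adjFam Θ f s' rfl,
        of_adjFam Θ (C.d hm f) _ (by omega)]
      have hb : (List.map (⇑(of q) ∘ Expr.eval Θ ∘ fun t : Term D _ _ ((Chain.cons g s).sdeg + 1) =>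
          Expr.smul t.coeff (Expr.eps f t.chain (by have := t.deg; omega)))
            (Chain.cons g s).bar).sum = barSum (.cons g s) (adjFam Θ f _ _) := by
        refine congrArg List.sum (List.map_congr_left fun t _ => ?_)
        simp only [Function.comp_apply, Expr.eval, map_smul]
        rw [of_adjFam Θ f _ (by have := t.deg; omega)]
      -- `cup_edge_left` has the exponent `m (n - 1)` where the relation has `m n`; the difference
      -- is the sign of `m` that stands in front of the bracket.
      rw [hb, key, mul_sub, mul_one, sgn_sub]
      generalize barSum (.cons g s) (adjFam Θ f _ _) = A
      rcases mul_self_eq_one_iff.1 (sgn_mul_self (k := k) m) with e | e <;> rw [e] <;> module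

/-- The dg functor `tensor C D → Y` adjoint to `Θ`. -/
def tensorLift : DGFunctor (tensor C D) Y where
  obj x := (adjObj Θ x.1).obj x.2
  map :=
    { toFun := Quotient.lift (Expr.eval Θ) fun _ _ h => Rel.eval Θ h
      map_add' := fun a b => Quotient.inductionOn₂ a b fun _ _ => rfl
      map_smul' := fun _ a => Quotient.inductionOn a fun _ => rfl }
  map_id _ := rfl
  map_comp _ b a := Quotient.inductionOn₂ b a fun _ _ => rfl
  map_d _ a := Quotient.inductionOn a fun _ => rfl

theorem tensorLift_eps {c₀ c₁ : C.Obj} {d₀ d₁ : D.Obj} {m p : ℤ} (f : C.Hom c₀ c₁ m)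
    (s : Chain D d₀ d₁) (h : m + s.sdeg = p) :
    of p ((tensorLift Θ).map (epsHom f s h)) = adjFam Θ f d₀ d₁ s := of_adjFam Θ f s h

end Lift

/-! ### The unit of the adjunction -/

section Unit

variable {C D Y : DGCat.{u} k}

/-- A dg functor to `Coh D Y` from a compatible collection of families. -/
def toCoh (obj : C.Obj → (Coh D Y).Obj)
    (fam : ∀ {c₀ c₁ : C.Obj} {m : ℤ}, C.Hom c₀ c₁ m →
      Fam D Y (cohFun (obj c₀)).obj (cohFun (obj c₁)).obj)
    (mem : ∀ {c₀ c₁ : C.Obj} {m : ℤ} (f : C.Hom c₀ c₁ m),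
      fam f ∈ cohHom (cohFun (obj c₀)) (cohFun (obj c₁)) m)
    (add : ∀ {c₀ c₁ : C.Obj} {m : ℤ} (f f' : C.Hom c₀ c₁ m), fam (f + f') = fam f + fam f')
    (smul : ∀ {c₀ c₁ : C.Obj} {m : ℤ} (r : k) (f : C.Hom c₀ c₁ m), fam (r • f) = r • fam f)
    (id : ∀ c : C.Obj, fam (C.id c) = oneFam (cohFun (obj c)).obj)
    (comp : ∀ {c₀ c₁ c₂ : C.Obj} {m n p : ℤ} (h : m + n = p) (g : C.Hom c₁ c₂ m)
      (f : C.Hom c₀ c₁ n), fam (C.comp h g f) = cup n (fam g) (fam f))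
    (d : ∀ {c₀ c₁ : C.Obj} {m p : ℤ} (h : m + 1 = p) (f : C.Hom c₀ c₁ m),
      fam (C.d h f) = twDiff m (cohFun (obj c₀)) (cohFun (obj c₁)) (fam f)) :
    DGFunctor C (Coh D Y) where
  obj := obj
  map {c₀ c₁ n} :=
    { toFun := fun f =>
        (⟨fam f, mem f⟩ : {φ // φ ∈ cohHom (cohFun (obj c₀)) (cohFun (obj c₁)) n})
      map_add' := fun f f' => cohVal_injective (add f f')
      map_smul' := fun r f => cohVal_injective (smul r f) }
  map_id c := cohVal_injective (id c)
  map_comp h g f := cohVal_injective (comp h g f)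
  map_d h f := cohVal_injective (d h f)

/-- The morphism represented by an expression. -/
def Expr.toHom {x y : (tensor C D).Obj} {n : ℤ} (a : Expr C D x y n) : (tensor C D).Hom x y n :=
  Quotient.mk (Expr.setoid C D x y n) a

theorem Expr.toHom_sum {x y : (tensor C D).Obj} {n : ℤ} : ∀ l : List (Expr C D x y n),
    (Expr.sum l).toHom = (l.map Expr.toHom).sum
  | [] => rfl
  | a :: l => by
    rw [List.map_cons, List.sum_cons, ← toHom_sum l]
    rfl

/-! ### Defining relations as equations between morphisms -/

section Relations

variable {c₀ c₁ c₂ : C.Obj} {d₀ d₁ d₂ d₃ : D.Obj} {m n p : ℤ}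

theorem epsHom_add (f f' : C.Hom c₀ c₁ m) (s : Chain D d₀ d₁) (h : m + s.sdeg = p) :
    epsHom (f + f') s h = epsHom f s h + epsHom f' s h :=
  Quotient.sound (Rel.eps_add f f' s h)

theorem epsHom_smul (r : k) (f : C.Hom c₀ c₁ m) (s : Chain D d₀ d₁) (h : m + s.sdeg = p) :
    epsHom (r • f) s h = r • epsHom f s h :=
  Quotient.sound (Rel.eps_smul r f s h)

theorem epsHom_chain_add (f : C.Hom c₀ c₁ m) (l : Chain D d₂ d₃) (g g' : D.Hom d₁ d₂ n)
    (s : Chain D d₀ d₁) (h : m + (l.append (.cons (g + g') s)).sdeg = p)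
    (h₁ : m + (l.append (.cons g s)).sdeg = p) (h₂ : m + (l.append (.cons g' s)).sdeg = p) :
    epsHom f (l.append (.cons (g + g') s)) h =
      epsHom f (l.append (.cons g s)) h₁ + epsHom f (l.append (.cons g' s)) h₂ :=
  Quotient.sound (Rel.eps_chain_add f l g g' s h h₁ h₂)

theorem epsHom_chain_smul (f : C.Hom c₀ c₁ m) (l : Chain D d₂ d₃) (r : k) (g : D.Hom d₁ d₂ n)
    (s : Chain D d₀ d₁) (h : m + (l.append (.cons (r • g) s)).sdeg = p)
    (h₁ : m + (l.append (.cons g s)).sdeg = p) :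
    epsHom f (l.append (.cons (r • g) s)) h = r • epsHom f (l.append (.cons g s)) h₁ :=
  Quotient.sound (Rel.eps_chain_smul f l r g s h h₁)

theorem epsHom_chain_id (f : C.Hom c₀ c₁ m) (l : Chain D d₁ d₂) (s : Chain D d₀ d₁)
    (h : m + (l.append (.cons (D.id d₁) s)).sdeg = p) :
    epsHom f (l.append (.cons (D.id d₁) s)) h = 0 :=
  Quotient.sound (Rel.eps_chain_id f l s h)

theorem epsHom_id_nil (c : C.Obj) (x : D.Obj) (h : 0 + (Chain.nil : Chain D x x).sdeg = 0) :
    epsHom (C.id c) (.nil : Chain D x x) h = (tensor C D).id (pair c x) :=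
  Quotient.sound (Rel.eps_id_nil c x h)

theorem epsHom_id_cons (c : C.Obj) (g : D.Hom d₁ d₂ n) (s : Chain D d₀ d₁)
    (h : 0 + (Chain.cons g s).sdeg = p) : epsHom (C.id c) (.cons g s) h = 0 :=
  Quotient.sound (Rel.eps_id_cons c g s h)

theorem epsHom_comp {m₁ m₂ : ℤ} (f₂ : C.Hom c₁ c₂ m₂) (f₁ : C.Hom c₀ c₁ m₁) (s : Chain D d₀ d₁)
    (hm : m₂ + m₁ = m) (h : m + s.sdeg = p) :
    epsHom (C.comp hm f₂ f₁) s h = (s.splits.map fun t => sgn k (m₁ * t.left.sdeg) •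
      (tensor C D).comp (by have := t.deg; omega) (epsHom f₂ t.left rfl)
        (epsHom f₁ t.right rfl)).sum :=
  (Quotient.sound (Rel.eps_comp f₂ f₁ s hm h)).trans ((Expr.toHom_sum (x := pair c₀ d₀) (y := pair c₂ d₁) _).trans
    (congrArg (List.sum (α := (tensor C D).Hom (pair c₀ d₀) (pair c₂ d₁) p)) List.map_map))

theorem d_epsHom_nil {q m' : ℤ} (f : C.Hom c₀ c₁ m) (x : D.Obj)
    (h : m + (Chain.nil : Chain D x x).sdeg = p) (hq : p + 1 = q) (hm : m + 1 = m')
    (h' : m' + (Chain.nil : Chain D x x).sdeg = q) :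
    (tensor C D).d hq (epsHom f (.nil : Chain D x x) h) = epsHom (C.d hm f) .nil h' :=
  Quotient.sound (Rel.d_eps_nil f x h hq hm h')

theorem d_epsHom_cons {e₀ e₁ : D.Obj} {m' n' q : ℤ} (f : C.Hom c₀ c₁ m)
    (g : D.Hom e₁ d₁ n) (s : Chain D d₀ e₁) (s' : Chain D e₀ d₁) (g' : D.Hom d₀ e₀ n')
    (hs : Chain.cons g s = s'.append (.cons g' .nil))
    (h : m + (Chain.cons g s).sdeg = p) (hq : p + 1 = q) (hm : m + 1 = m') :
    (tensor C D).d hq (epsHom f (.cons g s) h) =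
      epsHom (C.d hm f) (.cons g s) (by omega) + (-sgn k m) •
        (((Chain.cons g s).bar.map fun t =>
            t.coeff • epsHom f t.chain (p := q) (by have := t.deg; omega)).sum +
          (sgn k (m * n) • (tensor C D).comp (by simp only [Chain.sdeg] at h; omega)
              (rightHom c₁ g) (epsHom f s rfl) +
            (-sgn k s'.sdeg) • (tensor C D).comp (by
                have h' := congrArg Chain.sdeg hs
                rw [Chain.sdeg_append] at h'
                simp only [Chain.sdeg] at h' h
                omega)
              (epsHom f s' rfl) (rightHom c₀ g'))) := by
  have hsum : ((Chain.cons g s).bar.map fun t =>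
      t.coeff • epsHom f t.chain (p := q) (by have := t.deg; omega)).sum =
      (Expr.sum ((Chain.cons g s).bar.map fun t =>
        Expr.smul t.coeff (.eps f t.chain (by have := t.deg; omega)))).toHom
        (x := pair c₀ d₀) (y := pair c₁ d₁) :=
    ((Expr.toHom_sum (x := pair c₀ d₀) (y := pair c₁ d₁) _).trans
      (congrArg (List.sum (α := (tensor C D).Hom (pair c₀ d₀) (pair c₁ d₁) q)) List.map_map)).symm
  rw [hsum]
  exact Quotient.sound (Rel.d_eps_cons f g s s' g' hs h hq hm)

end Relations

/-- The dg functor `g ↦ id_c ⊗ g`. -/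
abbrev rightFun (D : DGCat.{u} k) (c : C.Obj) : DGFunctor D (tensor C D) where
  obj d := pair c d
  map :=
    { toFun := rightHom c
      map_add' := fun g g' => Quotient.sound (Rel.right_add c g g')
      map_smul' := fun r g => Quotient.sound (Rel.right_smul c r g) }
  map_id x := Quotient.sound (Rel.right_id c x)
  map_comp h g f := Quotient.sound (Rel.right_comp c h g f)
  map_d h g := (Quotient.sound (Rel.d_right c h g)).symm

/-- The family `s ↦ ε(f; s)`. -/
def epsFam {c₀ c₁ : C.Obj} {m : ℤ} (f : C.Hom c₀ c₁ m) :
    Fam D (tensor C D) (fun d => pair c₀ d) (fun d => pair c₁ d) :=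
  fun _ _ s => of (m + s.sdeg) (epsHom f s rfl)

theorem of_epsHom {c₀ c₁ : C.Obj} {d₀ d₁ : D.Obj} {m p : ℤ} (f : C.Hom c₀ c₁ m)
    (s : Chain D d₀ d₁) (h : m + s.sdeg = p) : of p (epsHom f s h) = epsFam f d₀ d₁ s := by
  subst h
  rfl

theorem epsFam_add {c₀ c₁ : C.Obj} {m : ℤ} (f f' : C.Hom c₀ c₁ m) :
    (epsFam (f + f') : Fam D (tensor C D) _ _) = epsFam f + epsFam f' := by
  funext x y s
  rw [epsFam, epsHom_add, map_add]
  rfl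

theorem epsFam_smul {c₀ c₁ : C.Obj} {m : ℤ} (r : k) (f : C.Hom c₀ c₁ m) :
    (epsFam (r • f) : Fam D (tensor C D) _ _) = r • epsFam f := by
  funext x y s
  rw [epsFam, epsHom_smul, map_smul]
  rfl

theorem epsFam_isMulti {c₀ c₁ : C.Obj} {m : ℤ} (f : C.Hom c₀ c₁ m) (x y : D.Obj) :
    IsMulti (epsFam f x y) := fun u v n l s => by
  have h : ∀ g : D.Hom u v n, m + (l.append (.cons g s)).sdeg = m + (l.sdeg + (n - 1 + s.sdeg)) :=
    fun g => by rw [Chain.sdeg_append, Chain.sdeg]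
  refine ⟨fun g g' => ?_, fun r g => ?_⟩
  · rw [← of_epsHom f _ (h _), epsHom_chain_add f l g g' s (h _) (h _) (h _), map_add, of_epsHom,
      of_epsHom]
  · rw [← of_epsHom f _ (h _), epsHom_chain_smul f l r g s (h _) (h _), map_smul, of_epsHom]

theorem epsFam_isNormal {c₀ c₁ : C.Obj} {m : ℤ} (f : C.Hom c₀ c₁ m) (x y : D.Obj) :
    IsNormal (epsFam f x y) := fun u l s => by
  rw [epsFam, epsHom_chain_id, map_zero]

theorem epsFam_mem {c₀ c₁ : C.Obj} {m : ℤ} (f : C.Hom c₀ c₁ m) :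
    epsFam f ∈ cohHom (rightFun D c₀) (rightFun D c₁) m :=
  ⟨fun _ _ _ => of_mem_homog _ _, epsFam_isMulti f, epsFam_isNormal f⟩

theorem epsFam_id (c : C.Obj) :
    (epsFam (C.id c) : Fam D (tensor C D) _ _) = oneFam (fun d => pair c d) := by
  funext x y s
  cases s with
  | nil =>
    have h : 0 + (Chain.nil : Chain D x x).sdeg = 0 := add_zero 0
    rw [← of_epsHom _ _ h, epsHom_id_nil]
    rfl
  | cons g s =>
    rw [epsFam, epsHom_id_cons, map_zero]
    rfl

theorem epsFam_comp {c₀ c₁ c₂ : C.Obj} {m n p : ℤ} (h : m + n = p) (g : C.Hom c₁ c₂ m)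
    (f : C.Hom c₀ c₁ n) :
    (epsFam (C.comp h g f) : Fam D (tensor C D) _ _) = cup n (epsFam g) (epsFam f) := by
  funext x y s
  rw [epsFam, epsHom_comp, map_list_sum, List.map_map, cup_apply, splitSum]
  refine congrArg List.sum (List.map_congr_left fun t _ => ?_)
  simp only [Function.comp_apply, map_smul, of_comp, of_epsHom]

/-- Chains are built up from the last morphism, whereas the formula for `d ε` also involves the
first one. -/
theorem exists_eq_append_single {x : D.Obj} : ∀ {y z : D.Obj} {m : ℤ} (g : D.Hom y z m)
    (s : Chain D x y), ∃ (w : D.Obj) (n : ℤ) (s' : Chain D w z) (g' : D.Hom x w n),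
      Chain.cons g s = s'.append (.cons g' .nil)
  | _, _, _, g, .nil => ⟨_, _, .nil, g, rfl⟩
  | _, _, _, g, .cons h s => by
      obtain ⟨w, n, s', g', e⟩ := exists_eq_append_single h s
      exact ⟨w, n, .cons g s', g', by rw [Chain.append, ← e]⟩

/-- The relation for `d ε(f; s)`, solved for `ε(d f; s)`. Its last two terms are the cup products
with the edges of `g ↦ id ⊗ g` at the two ends of `f`. -/
theorem epsFam_d {c₀ c₁ : C.Obj} {m p : ℤ} (h : m + 1 = p) (f : C.Hom c₀ c₁ m) :
    epsFam (C.d h f) = twDiff m (rightFun D c₀) (rightFun D c₁) (epsFam f) := by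
  funext x y s
  rw [twDiff_eq]
  simp only [Pi.add_apply, Pi.sub_apply, Pi.smul_apply, famDiff_apply, famBar_apply]
  cases s with
  | nil =>
    have h₀ : ∀ n, n + (Chain.nil : Chain D x x).sdeg = n := add_zero
    rw [cup_apply, cup_apply]
    simp only [barSum_nil, smul_zero, splitSum_nil, edge_nil, map_zero, LinearMap.zero_apply,
      add_zero, sub_zero]
    rw [← of_epsHom _ _ (h₀ p), ← of_epsHom _ _ (h₀ m), ← of_d h, d_epsHom_nil]
  | cons g s =>
    rename_i z n
    obtain ⟨w, n', s', g', hs⟩ := exists_eq_append_single g s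
    have hd : (m + (Chain.cons g s).sdeg) + 1 = p + (Chain.cons g s).sdeg := by omega
    have key := congrArg (of _) (d_epsHom_cons f g s s' g' hs rfl hd h)
    simp only [map_add, map_smul, of_d, of_comp, of_epsHom, map_list_sum, List.map_map,
      Function.comp_def] at key
    change _ = _ + _ • (barSum (.cons g s) (epsFam f x y) + _) at key
    rw [cup_edge_left m (rightFun D c₁) (epsFam f) g s,
      congrArg (cup 1 (epsFam f) (edge (rightFun D c₀)) x y) hs,
      cup_edge_right (rightFun D c₀) (epsFam f) s' g', key, mul_sub, mul_one, sgn_sub]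
    generalize barSum (.cons g s) (epsFam f x y) = A
    rcases mul_self_eq_one_iff.1 (sgn_mul_self (k := k) m) with e | e <;> rw [e] <;> module

/-- The unit `C → Coh D (tensor C D)` of the adjunction. -/
def cohUnit (C D : DGCat.{u} k) : DGFunctor C (Coh D (tensor C D)) :=
  toCoh (fun c => rightFun D c) epsFam epsFam_mem epsFam_add epsFam_smul epsFam_id epsFam_comp
    epsFam_d

end Unit

/-! ### Braces -/

section Brace

variable {D E : DGCat.{u} k} {M N : Type*} [AddCommGroup M] [Module k M] [AddCommGroup N]
  [Module k N]

theorem sum_flatMap {A : Type*} (l : List A) (f : A → List M) :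
    (l.flatMap f).sum = (l.map fun a => (f a).sum).sum := by
  induction l with
  | nil => rfl
  | cons a l ih => simp [List.flatMap_cons, ih]

/-- The value of a functional on the formal sum `brace G hs`. -/
def braceSum {d₀ d₁ : D.Obj} {e₀ e₁ : E.Obj} (G : Chain D d₀ d₁) (hs : Chain E e₀ e₁)
    (φ : Chain (tensor D E) (pair d₀ e₀) (pair d₁ e₁) → M) : M :=
  ((brace G hs).map fun w => w.coeff • φ w.chain).sum

variable {d₀ d₁ d₂ : D.Obj} {e₀ e₁ e₂ : E.Obj} {m n : ℤ}

theorem braceSum_congr {G : Chain D d₀ d₁} {hs : Chain E e₀ e₁}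
    {φ ψ : Chain (tensor D E) (pair d₀ e₀) (pair d₁ e₁) → M}
    (h : ∀ t : Chain (tensor D E) (pair d₀ e₀) (pair d₁ e₁),
      t.sdeg = G.sdeg + hs.sdeg → φ t = ψ t) : braceSum G hs φ = braceSum G hs ψ := by
  unfold braceSum
  congr 1
  exact List.map_congr_left fun t _ => by rw [h _ t.deg]

theorem braceSum_mem (S : Submodule k M) {G : Chain D d₀ d₁} {hs : Chain E e₀ e₁}
    {φ : Chain (tensor D E) (pair d₀ e₀) (pair d₁ e₁) → M}
    (h : ∀ t : Chain (tensor D E) (pair d₀ e₀) (pair d₁ e₁),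
      t.sdeg = G.sdeg + hs.sdeg → φ t ∈ S) : braceSum G hs φ ∈ S := by
  refine list_sum_mem fun a ha => ?_
  obtain ⟨t, _, rfl⟩ := List.mem_map.1 ha
  exact S.smul_mem _ (h _ t.deg)

@[simp] theorem braceSum_zero (G : Chain D d₀ d₁) (hs : Chain E e₀ e₁) :
    braceSum G hs (fun _ => (0 : M)) = 0 := by
  simp [braceSum]

theorem braceSum_add (G : Chain D d₀ d₁) (hs : Chain E e₀ e₁)
    (φ ψ : Chain (tensor D E) (pair d₀ e₀) (pair d₁ e₁) → M) :
    braceSum G hs (fun t => φ t + ψ t) = braceSum G hs φ + braceSum G hs ψ := by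
  simp only [braceSum, smul_add]
  exact List.sum_map_add

theorem map_braceSum (f : M →ₗ[k] N) (G : Chain D d₀ d₁) (hs : Chain E e₀ e₁)
    (φ : Chain (tensor D E) (pair d₀ e₀) (pair d₁ e₁) → M) :
    f (braceSum G hs φ) = braceSum G hs (fun t => f (φ t)) := by
  simp [braceSum, map_list_sum, List.map_map, Function.comp_def]

theorem braceSum_smul (a : k) (G : Chain D d₀ d₁) (hs : Chain E e₀ e₁)
    (φ : Chain (tensor D E) (pair d₀ e₀) (pair d₁ e₁) → M) :
    braceSum G hs (fun t => a • φ t) = a • braceSum G hs φ :=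
  (map_braceSum (LinearMap.lsmul k M a) G hs φ).symm

theorem isLinearMap_braceSum (G : Chain D d₀ d₁) (hs : Chain E e₀ e₁)
    {φ : N → Chain (tensor D E) (pair d₀ e₀) (pair d₁ e₁) → M}
    (h : ∀ t, IsLinearMap k (fun a => φ a t)) : IsLinearMap k (fun a => braceSum G hs (φ a)) :=
  ⟨fun a b => (braceSum_congr fun t _ => (h t).map_add a b).trans (braceSum_add _ _ _ _),
    fun c a => (braceSum_congr fun t _ => (h t).map_smul c a).trans (braceSum_smul _ _ _ _)⟩

theorem braceSum_isMulti_param {B : DGCat.{u} k} {x y : B.Obj} (G : Chain D d₀ d₁)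
    (hs : Chain E e₀ e₁) {φ : Chain B x y → Chain (tensor D E) (pair d₀ e₀) (pair d₁ e₁) → M}
    (h : ∀ t, IsMulti (fun s => φ s t)) : IsMulti (fun s => braceSum G hs (φ s)) :=
  fun _ _ _ l s => isLinearMap_braceSum G hs fun t => h t l s

@[simp] theorem braceSum_nil (hs : Chain E e₀ e₁)
    (φ : Chain (tensor D E) (pair d₀ e₀) (pair d₀ e₁) → M) :
    braceSum .nil hs φ = φ (rightChain d₀ hs) := by
  simp [braceSum, brace]

/-- The part of `braceSum (g G) hs` in which the last morphism is some `ε(g; l)`. -/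
def lastSum (g : D.Hom d₁ d₂ n) (G : Chain D d₀ d₁) (hs : Chain E e₀ e₁)
    (φ : Chain (tensor D E) (pair d₀ e₀) (pair d₂ e₁) → M) : M :=
  splitSum hs fun _ l r => sgn k (G.sdeg * l.sdeg) •
    braceSum G r (fun t => φ (.cons (epsHom g l rfl) t))

theorem braceLast_sum (g : D.Hom d₁ d₂ n) (G : Chain D d₀ d₁) (hs : Chain E e₀ e₁)
    (φ : Chain (tensor D E) (pair d₀ e₀) (pair d₂ e₁) → M) :
    ((braceLast g G (fun hs' => brace G hs') hs).map fun w => w.coeff • φ w.chain).sum =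
      lastSum g G hs φ := by
  rw [braceLast, lastSum, List.map_flatMap, sum_flatMap, splitSum]
  refine congrArg List.sum (List.map_congr_left fun t _ => ?_)
  rw [List.map_map, braceSum, List.smul_sum, List.map_map]
  refine congrArg List.sum (List.map_congr_left fun w _ => ?_)
  simp only [Function.comp_apply, mul_smul]

theorem braceSum_cons_nil (g : D.Hom d₁ d₂ n) (G : Chain D d₀ d₁)
    (φ : Chain (tensor D E) (pair d₀ e₀) (pair d₂ e₀) → M) :
    braceSum (.cons g G) .nil φ = lastSum g G .nil φ := by
  rw [← braceLast_sum, braceSum, brace, braceCons]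

/-- Terms are sorted by their last morphism: either `id ⊗ h`, whose sign comes from moving all of `g
G` past `h`, or some `ε(g; l)`. -/
theorem braceSum_cons_cons (g : D.Hom d₁ d₂ n) (G : Chain D d₀ d₁) (h : E.Hom e₁ e₂ m)
    (hs : Chain E e₀ e₁) (φ : Chain (tensor D E) (pair d₀ e₀) (pair d₂ e₂) → M) :
    braceSum (.cons g G) (.cons h hs) φ =
      sgn k ((Chain.cons g G).sdeg * (m - 1)) •
        braceSum (.cons g G) hs (fun t => φ (.cons (rightHom d₂ h) t)) +
      lastSum g G (.cons h hs) φ := by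
  rw [← braceLast_sum, braceSum, brace, braceCons, List.map_append, List.sum_append, List.map_map,
    braceSum, brace, List.smul_sum, List.map_map]
  refine congrArg (fun l => List.sum l + _) (List.map_congr_left fun w _ => ?_)
  simp only [Function.comp_apply, mul_smul]

theorem rightChain_append (d : D.Obj) : ∀ {e₁ e₂ : E.Obj} (l : Chain E e₁ e₂) (s : Chain E e₀ e₁),
    rightChain d (l.append s) = (rightChain d l).append (rightChain d s)
  | _, _, .nil, _ => rfl
  | _, _, .cons h l, s => by rw [Chain.append, rightChain, rightChain_append d l s]; rfl

theorem rightHom_isLinearMap (d : D.Obj) :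
    IsLinearMap k (fun h : E.Hom e₀ e₁ m => rightHom (C := D) d h) :=
  (rightFun E d).map.isLinear

theorem rightHom_id (d : D.Obj) (e : E.Obj) :
    rightHom (C := D) d (E.id e) = (tensor D E).id (pair d e) :=
  (rightFun E d).map_id e

theorem lastSum_isMulti_right (g : D.Hom d₁ d₂ n) (G : Chain D d₀ d₁)
    {φ : Chain (tensor D E) (pair d₀ e₀) (pair d₂ e₁) → M} (hφ : IsMulti φ)
    (ih : ∀ {e₁ : E.Obj} {ψ : Chain (tensor D E) (pair d₀ e₀) (pair d₁ e₁) → M}, IsMulti ψ →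
      IsMulti (fun hs => braceSum G hs ψ)) :
    IsMulti (fun hs => lastSum g G hs φ) := by
  refine splitSum_isMulti (fun w r => isMulti_smul_sdeg _ ?_) fun w l => (ih (hφ.tail _)).smul _
  -- As `l` varies, `ε(g; l)` varies multilinearly, but in a degree depending on `l`. Inserting it
  -- through `consL` on the total space makes the composite a single linear map.
  have h := (epsFam_isMulti (D := E) g w e₁).comp
    (isLinearMap_braceSum G r fun t => (consL hφ t).isLinear)
  simpa only [epsFam, consL_of] using h

/-- Together with the three lemmas on normalization and on the first argument, this ensures that
pulling a reduced cochain back along the braces gives a reduced cochain in each of the two chains.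
-/
theorem braceSum_isMulti_right : ∀ {d₁ : D.Obj} (G : Chain D d₀ d₁) {e₁ : E.Obj}
    {φ : Chain (tensor D E) (pair d₀ e₀) (pair d₁ e₁) → M} (_ : IsMulti φ),
    IsMulti (fun hs => braceSum G hs φ)
  | _, .nil, e₁, φ, hφ => fun u v m l s => by
      simp only [braceSum_nil, rightChain_append]
      exact IsLinearMap.comp' (f := fun a => φ ((rightChain d₀ l).append (.cons a (rightChain d₀ s))))
        (hφ _ _) (rightHom_isLinearMap d₀)
  | d₂, .cons g G, e₁, φ, hφ => fun u v m l s => by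
      induction l with
      | nil =>
        simp only [Chain.append, braceSum_cons_cons]
        refine IsLinearMap.add' (IsLinearMap.smul' _ (isLinearMap_braceSum _ _ fun t => ?_))
          ((lastSum_isMulti_right g G hφ (braceSum_isMulti_right G)).head s)
        exact IsLinearMap.comp' (f := fun a => φ (.cons a t)) (hφ.head t) (rightHom_isLinearMap _)
      | cons h l ih =>
        simp only [Chain.append, braceSum_cons_cons]
        exact IsLinearMap.add' (IsLinearMap.smul' _ (ih _ (hφ.tail _)))
          ((lastSum_isMulti_right g G hφ (braceSum_isMulti_right G)).tail h l s)

theorem lastSum_isNormal_right (g : D.Hom d₁ d₂ n) (G : Chain D d₀ d₁)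
    {φ : Chain (tensor D E) (pair d₀ e₀) (pair d₂ e₁) → M} (hφ : IsMulti φ) (hn : IsNormal φ)
    (ih : ∀ {e₁ : E.Obj} {ψ : Chain (tensor D E) (pair d₀ e₀) (pair d₁ e₁) → M}, IsMulti ψ →
      IsNormal ψ → IsNormal (fun hs => braceSum G hs ψ)) :
    IsNormal (fun hs => lastSum g G hs φ) := by
  refine splitSum_isNormal (fun w r => isNormal_smul_sdeg _ ?_)
    fun w l => (ih (hφ.tail _) (hn.tail _)).comp (LinearMap.lsmul k M _).isLinear
  have h := (epsFam_isNormal (D := E) g w e₁).comp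
    (isLinearMap_braceSum G r fun t => (consL hφ t).isLinear)
  simpa only [epsFam, consL_of] using h

theorem braceSum_isNormal_right : ∀ {d₁ : D.Obj} (G : Chain D d₀ d₁) {e₁ : E.Obj}
    {φ : Chain (tensor D E) (pair d₀ e₀) (pair d₁ e₁) → M} (_ : IsMulti φ) (_ : IsNormal φ),
    IsNormal (fun hs => braceSum G hs φ)
  | _, .nil, e₁, φ, _, hn => fun u l s => by
      simp only [braceSum_nil, rightChain_append, rightChain, rightHom_id]
      exact hn _ _
  | d₂, .cons g G, e₁, φ, hφ, hn => fun u l s => by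
      induction l with
      | nil =>
        simp only [Chain.append, braceSum_cons_cons, rightHom_id, hn.head, braceSum_zero, smul_zero,
          zero_add]
        exact (lastSum_isNormal_right g G hφ hn (braceSum_isNormal_right G)).head s
      | cons h l ih =>
        simp only [Chain.append, braceSum_cons_cons]
        have h₀ := ih _ (hφ.tail (rightHom _ h)) (hn.tail (rightHom _ h))
        dsimp only at h₀
        rw [h₀, smul_zero, zero_add]
        exact (lastSum_isNormal_right g G hφ hn (braceSum_isNormal_right G)).tail h l s

theorem isLinearMap_epsHom {x y : E.Obj} (l : Chain E x y)
    {φ : (tensor D E).Hom (pair d₁ x) (pair d₂ y) (n + l.sdeg) → M} (hφ : IsLinearMap k φ) :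
    IsLinearMap k (fun g : D.Hom d₁ d₂ n => φ (epsHom g l rfl)) :=
  ⟨fun g g' => by rw [epsHom_add, hφ.map_add], fun r g => by rw [epsHom_smul, hφ.map_smul]⟩

theorem braceSum_isMulti_left {d₁ : D.Obj} (hs : Chain E e₀ e₁)
    {φ : Chain (tensor D E) (pair d₀ e₀) (pair d₁ e₁) → M} (hφ : IsMulti φ) :
    IsMulti (fun G => braceSum G hs φ) := by
  -- The brace recursion shortens either chain, so the induction on `L` keeps `hs` and `φ` arbitrary
  -- and contains an inner induction on `hs`.
  have key : ∀ {d₁ : D.Obj} {v : D.Obj} (L : Chain D v d₁) {e₁ : E.Obj} (hs : Chain E e₀ e₁)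
      {φ : Chain (tensor D E) (pair d₀ e₀) (pair d₁ e₁) → M}, IsMulti φ →
      ∀ {u : D.Obj} {n : ℤ} (s : Chain D d₀ u),
      IsLinearMap k (fun g : D.Hom u v n => braceSum (L.append (.cons g s)) hs φ) := by
    intro d₁ v L
    induction L with
    | nil =>
      intro e₁ hs φ hφ u n s
      have hl : ∀ {e₁ : E.Obj} (hs : Chain E e₀ e₁)
          {φ : Chain (tensor D E) (pair d₀ e₀) (pair v e₁) → M}, IsMulti φ →
          IsLinearMap k (fun g : D.Hom u v n => lastSum g s hs φ) := fun hs φ hφ =>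
        isLinearMap_splitSum hs fun w l r => IsLinearMap.smul' _ (isLinearMap_braceSum _ _ fun t =>
          isLinearMap_epsHom l (hφ.head t))
      induction hs with
      | nil =>
        simp only [Chain.append, braceSum_cons_nil]
        exact hl _ hφ
      | cons h hs ih =>
        simp only [Chain.append, braceSum_cons_cons, Chain.sdeg]
        exact IsLinearMap.add' (IsLinearMap.smul' _ (ih (hφ.tail _))) (hl _ hφ)
    | cons g' L ihL =>
      intro e₁ hs φ hφ u n s
      have hl : ∀ {e₁ : E.Obj} (hs : Chain E e₀ e₁)
          {φ : Chain (tensor D E) (pair d₀ e₀) (pair _ e₁) → M}, IsMulti φ →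
          IsLinearMap k (fun g : D.Hom u v n => lastSum g' (L.append (.cons g s)) hs φ) :=
        fun hs φ hφ => isLinearMap_splitSum hs fun w l r => by
          simp only [Chain.sdeg_append, Chain.sdeg]
          exact IsLinearMap.smul' _ (ihL r (hφ.tail _) s)
      induction hs with
      | nil =>
        simp only [Chain.append, braceSum_cons_nil]
        exact hl _ hφ
      | cons h hs ih =>
        simp only [Chain.append, braceSum_cons_cons, Chain.sdeg, Chain.sdeg_append]
        exact IsLinearMap.add' (IsLinearMap.smul' _ (ih (hφ.tail _))) (hl _ hφ)
  exact fun u v n L s => key L hs hφ s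

/-- An inserted identity produces terms containing `ε(id; l)`. For nonempty `l` this is zero; for
empty `l` it is an identity, on which `φ` vanishes. -/
theorem braceSum_isNormal_left {d₁ : D.Obj} (hs : Chain E e₀ e₁)
    {φ : Chain (tensor D E) (pair d₀ e₀) (pair d₁ e₁) → M} (hφ : IsMulti φ) (hn : IsNormal φ) :
    IsNormal (fun G => braceSum G hs φ) := by
  have key : ∀ {d₁ : D.Obj} {v : D.Obj} (L : Chain D v d₁) {e₁ : E.Obj} (hs : Chain E e₀ e₁)
      {φ : Chain (tensor D E) (pair d₀ e₀) (pair d₁ e₁) → M}, IsMulti φ → IsNormal φ →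
      ∀ (s : Chain D d₀ v), braceSum (L.append (.cons (D.id v) s)) hs φ = 0 := by
    intro d₁ v L
    induction L with
    | nil =>
      intro e₁ hs φ hφ hn s
      have hl : ∀ {e₁ : E.Obj} (hs : Chain E e₀ e₁)
          {φ : Chain (tensor D E) (pair d₀ e₀) (pair v e₁) → M}, IsMulti φ → IsNormal φ →
          lastSum (D.id v) s hs φ = 0 := fun hs φ hφ hn => by
        refine splitSum_eq_zero fun w l r _ => ?_
        have h₀ : ∀ t, φ (.cons (epsHom (D.id v) l rfl) t) = 0 := fun t => by
          rw [← consL_of hφ, of_epsHom, epsFam_id]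
          cases l with
          | nil => rw [oneFam_nil, oneT, consL_of, hn.head]
          | cons h l => rw [oneFam_cons, map_zero]
        simp [h₀]
      induction hs with
      | nil => rw [Chain.append, braceSum_cons_nil, hl _ hφ hn]
      | cons h hs ih =>
        have := ih (hφ.tail (rightHom v h)) (hn.tail (rightHom v h))
        rw [Chain.append] at this
        rw [Chain.append, braceSum_cons_cons, this, hl _ hφ hn, smul_zero, add_zero]
    | cons g' L ihL =>
      intro e₁ hs φ hφ hn s
      have hl : ∀ {e₁ : E.Obj} (hs : Chain E e₀ e₁)
          {φ : Chain (tensor D E) (pair d₀ e₀) (pair _ e₁) → M}, IsMulti φ → IsNormal φ →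
          lastSum g' (L.append (.cons (D.id v) s)) hs φ = 0 :=
        fun hs φ hφ hn => splitSum_eq_zero fun w l r _ => by
          rw [ihL r (hφ.tail _) (hn.tail _), smul_zero]
      induction hs with
      | nil => rw [Chain.append, braceSum_cons_nil, hl _ hφ hn]
      | cons h hs ih =>
        have := ih (hφ.tail (rightHom _ h)) (hn.tail (rightHom _ h))
        rw [Chain.append] at this
        rw [Chain.append, braceSum_cons_cons, this, hl _ hφ hn, smul_zero, add_zero]
  exact fun v L s => key L hs hφ hn s

end Brace

/-! ### Sums over cuts and the bar differential for pairs of chains -/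

theorem sgn_eq {a b : ℤ} (c : ℤ) (h : a = b + 2 * c) : sgn k a = sgn k b :=
  sgn_congr (by simp [h, parity_simps])

section PairSums

variable {D E : DGCat.{u} k} {M N : Type*} [AddCommGroup M] [Module k M] [AddCommGroup N]
  [Module k N] {d₀ d₁ : D.Obj} {e₀ e₁ : E.Obj}

/-- The number of morphisms of a chain. -/
def Chain.length {x : D.Obj} : ∀ {y : D.Obj}, Chain D x y → ℕ
  | _, nil => 0
  | _, cons _ s => s.length + 1

theorem Chain.length_append {x y : D.Obj} : ∀ {z : D.Obj} (s : Chain D y z) (t : Chain D x y),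
    (s.append t).length = s.length + t.length
  | _, nil, t => by simp [append, length]
  | _, cons g s, t => by simp only [append, length, length_append s t]; omega

/-- The signed sum over all ways to cut a pair of chains. -/
def splitSum₂ (G : Chain D d₀ d₁) (hs : Chain E e₀ e₁)
    (Φ : ∀ v w, Chain D v d₁ → Chain E w e₁ → Chain D d₀ v → Chain E e₀ w → M) : M :=
  splitSum G fun v Gl Gr => splitSum hs fun w l r => sgn k (Gr.sdeg * l.sdeg) • Φ v w Gl l Gr r

/-- The value of a functional on the bar differential of a pair of chains. -/
def barSum₂ (G : Chain D d₀ d₁) (hs : Chain E e₀ e₁) (Ψ : Chain D d₀ d₁ → Chain E e₀ e₁ → M) : M :=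
  barSum G (fun t => Ψ t hs) + sgn k G.sdeg • barSum hs (Ψ G)

theorem splitSum₂_congr {G : Chain D d₀ d₁} {hs : Chain E e₀ e₁}
    {Φ Ψ : ∀ v w, Chain D v d₁ → Chain E w e₁ → Chain D d₀ v → Chain E e₀ w → M}
    (h : ∀ v w Gl l Gr r, Chain.append Gl Gr = G → Chain.append l r = hs →
      Φ v w Gl l Gr r = Ψ v w Gl l Gr r) : splitSum₂ G hs Φ = splitSum₂ G hs Ψ :=
  splitSum_congr fun _ _ _ hG => splitSum_congr fun _ _ _ hl => by rw [h _ _ _ _ _ _ hG hl]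

theorem splitSum₂_add (G : Chain D d₀ d₁) (hs : Chain E e₀ e₁)
    (Φ Ψ : ∀ v w, Chain D v d₁ → Chain E w e₁ → Chain D d₀ v → Chain E e₀ w → M) :
    splitSum₂ G hs (fun v w Gl l Gr r => Φ v w Gl l Gr r + Ψ v w Gl l Gr r) =
      splitSum₂ G hs Φ + splitSum₂ G hs Ψ := by
  simp only [splitSum₂, smul_add, splitSum_add]

theorem map_splitSum₂ (f : M →ₗ[k] N) (G : Chain D d₀ d₁) (hs : Chain E e₀ e₁)
    (Φ : ∀ v w, Chain D v d₁ → Chain E w e₁ → Chain D d₀ v → Chain E e₀ w → M) :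
    f (splitSum₂ G hs Φ) = splitSum₂ G hs (fun v w Gl l Gr r => f (Φ v w Gl l Gr r)) := by
  simp only [splitSum₂, map_splitSum, map_smul]

theorem splitSum₂_smul (a : k) (G : Chain D d₀ d₁) (hs : Chain E e₀ e₁)
    (Φ : ∀ v w, Chain D v d₁ → Chain E w e₁ → Chain D d₀ v → Chain E e₀ w → M) :
    splitSum₂ G hs (fun v w Gl l Gr r => a • Φ v w Gl l Gr r) = a • splitSum₂ G hs Φ :=
  (map_splitSum₂ (LinearMap.lsmul k M a) G hs Φ).symm

theorem map_barSum₂ (f : M →ₗ[k] N) (G : Chain D d₀ d₁) (hs : Chain E e₀ e₁)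
    (Ψ : Chain D d₀ d₁ → Chain E e₀ e₁ → M) :
    f (barSum₂ G hs Ψ) = barSum₂ G hs (fun t s => f (Ψ t s)) := by
  simp only [barSum₂, map_add, map_smul, map_barSum]

theorem barSum₂_add (G : Chain D d₀ d₁) (hs : Chain E e₀ e₁)
    (Φ Ψ : Chain D d₀ d₁ → Chain E e₀ e₁ → M) :
    barSum₂ G hs (fun t s => Φ t s + Ψ t s) = barSum₂ G hs Φ + barSum₂ G hs Ψ := by
  simp only [barSum₂, barSum_add, smul_add]
  abel

/-- Coassociativity of cutting for pairs of chains. -/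
theorem splitSum₂_assoc (G : Chain D d₀ d₁) (hs : Chain E e₀ e₁)
    (Ω : ∀ v w v' w', Chain D v' d₁ → Chain E w' e₁ → Chain D v v' → Chain E w w' →
      Chain D d₀ v → Chain E e₀ w → M) :
    splitSum₂ G hs (fun v w c c' b b' => splitSum₂ c c' fun v' w' a a' e e' =>
      Ω v w v' w' a a' e e' b b') =
    splitSum₂ G hs (fun v' w' a a' r r' => splitSum₂ r r' fun v w e e' b b' =>
      Ω v w v' w' a a' e e' b b') := by
  -- Both sides are brought to the form where `G` is cut into `a`, `e`, `b`, then `hs` into `a'`,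
  -- `e'`, `b'`, with the same Koszul sign: `a'` and `e'` pass `b`, and `a'` passes `e`. Then each
  -- chain is treated by its own coassociativity.
  have h₁ : splitSum₂ G hs (fun v w c c' b b' => splitSum₂ c c' fun v' w' a a' e e' =>
      Ω v w v' w' a a' e e' b b') =
      splitSum G fun v c b => splitSum c fun v' a e => splitSum hs fun w c' b' =>
        splitSum c' fun w' a' e' =>
          sgn k (b.sdeg * (a'.sdeg + e'.sdeg) + e.sdeg * a'.sdeg) •
            Ω v w v' w' a a' e e' b b' := by
    refine splitSum_congr fun v c b _ => ?_
    rw [splitSum_swap]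
    refine splitSum_congr fun w c' b' _ => ?_
    dsimp only [splitSum₂]
    rw [← splitSum_smul]
    refine splitSum_congr fun v' a e _ => ?_
    rw [← splitSum_smul]
    refine splitSum_congr fun w' a' e' he => ?_
    rw [smul_smul, ← sgn_add, ← he, Chain.sdeg_append]
  have h₂ : splitSum₂ G hs (fun v' w' a a' r r' => splitSum₂ r r' fun v w e e' b b' =>
      Ω v w v' w' a a' e e' b b') =
      splitSum G fun v' a r => splitSum r fun v e b => splitSum hs fun w' a' r' =>
        splitSum r' fun w e' b' =>
          sgn k (b.sdeg * (a'.sdeg + e'.sdeg) + e.sdeg * a'.sdeg) •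
            Ω v w v' w' a a' e e' b b' := by
    refine splitSum_congr fun v' a r _ => ?_
    rw [splitSum_swap]
    refine splitSum_congr fun w' a' r' _ => ?_
    dsimp only [splitSum₂]
    rw [← splitSum_smul]
    refine splitSum_congr fun v e b hb => ?_
    rw [← splitSum_smul]
    refine splitSum_congr fun w e' b' _ => ?_
    rw [smul_smul, ← sgn_add, ← hb, Chain.sdeg_append]
    congr 2
    ring
  rw [h₁, h₂, splitSum_assoc G fun v v' a e b => splitSum hs fun w c' b' =>
        splitSum c' fun w' a' e' =>
          sgn k (b.sdeg * (a'.sdeg + e'.sdeg) + e.sdeg * a'.sdeg) •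
            Ω v w v' w' a a' e e' b b']
  refine splitSum_congr fun v' a r _ => splitSum_congr fun v e b _ => ?_
  exact splitSum_assoc hs fun w w' a' e' b' =>
          sgn k (b.sdeg * (a'.sdeg + e'.sdeg) + e.sdeg * a'.sdeg) •
            Ω v w v' w' a a' e e' b b'

/-- The bar differential of pairs is a coderivation with respect to cutting. -/
theorem barSum₂_splitSum₂ (G : Chain D d₀ d₁) (hs : Chain E e₀ e₁)
    (Ω : ∀ v w, Chain D v d₁ → Chain E w e₁ → Chain D d₀ v → Chain E e₀ w → M) :
    barSum₂ G hs (fun t s => splitSum₂ t s Ω) = splitSum₂ G hs fun v w Gl l Gr r =>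
      barSum₂ Gl l (fun t s => Ω v w t s Gr r) +
        sgn k (Gl.sdeg + l.sdeg) • barSum₂ Gr r (Ω v w Gl l) := by
  have h₁ : barSum G (fun t => splitSum₂ t hs Ω) = splitSum G fun v Gl Gr =>
      splitSum hs fun w l r => sgn k (Gr.sdeg * l.sdeg) • barSum Gl (fun t => Ω v w t l Gr r) +
        sgn k (Gl.sdeg + (Gr.sdeg + 1) * l.sdeg) • barSum Gr (fun t => Ω v w Gl l t r) := by
    refine (barSum_splitSum G _).trans (splitSum_congr fun v Gl Gr _ => ?_)
    rw [barSum_splitSum_swap, barSum_splitSum_swap, ← splitSum_smul, ← splitSum_add]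
    refine splitSum_congr fun w l r _ => ?_
    rw [barSum_smul, sgn_add, mul_smul, ← barSum_smul (sgn k ((Gr.sdeg + 1) * l.sdeg)) Gr]
    congr 2
    -- The bar differential raises the degree of the right part by one, hence the factor `Gr.sdeg +
    -- 1` in the exponent.
    exact barSum_congr fun t ht => by rw [ht]
  have h₂ : barSum hs (fun s => splitSum₂ G s Ω) = splitSum G fun v Gl Gr =>
      splitSum hs fun w l r => sgn k (Gr.sdeg * (l.sdeg + 1)) • barSum l (fun s => Ω v w Gl s Gr r) +
        sgn k (l.sdeg + Gr.sdeg * l.sdeg) • barSum r (fun s => Ω v w Gl l Gr s) := by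
    refine (barSum_splitSum_swap hs G _).trans (splitSum_congr fun v Gl Gr _ => ?_)
    refine (barSum_splitSum hs _).trans (splitSum_congr fun w l r _ => ?_)
    rw [barSum_smul, sgn_add, mul_smul, ← barSum_smul _ l]
    congr 1
    exact barSum_congr fun s hs => by rw [hs]
  unfold barSum₂
  rw [h₁, h₂, ← splitSum_smul, ← splitSum_add]
  refine splitSum_congr fun v Gl Gr hG => ?_
  rw [← splitSum_smul, ← splitSum_add]
  refine splitSum_congr fun w l r hl => ?_
  rw [← hG, Chain.sdeg_append]
  simp only [smul_add, smul_smul, ← sgn_add]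
  have e₁ : sgn k (Gl.sdeg + (Gr.sdeg + 1) * l.sdeg) =
      sgn k (Gr.sdeg * l.sdeg + (Gl.sdeg + l.sdeg)) := by congr 1; ring
  have e₂ : sgn k (Gl.sdeg + Gr.sdeg + Gr.sdeg * (l.sdeg + 1)) =
      sgn k (Gr.sdeg * l.sdeg + Gl.sdeg) := sgn_eq Gr.sdeg (by ring)
  have e₃ : sgn k (Gl.sdeg + Gr.sdeg + (l.sdeg + Gr.sdeg * l.sdeg)) =
      sgn k (Gr.sdeg * l.sdeg + (Gl.sdeg + l.sdeg + Gr.sdeg)) := by congr 1; ring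
  rw [e₁, e₂, e₃]
  abel

end PairSums

/-! ### Braces as a morphism of bar constructions -/

section BraceCoalgebra

variable {D E : DGCat.{u} k} {M N : Type*} [AddCommGroup M] [Module k M] [AddCommGroup N]
  [Module k N] {d₀ d₁ : D.Obj} {e₀ e₁ : E.Obj}

/-- The component of the brace map with values in chains of length `1`. -/
def pairTau {d₀ d₁ : D.Obj} (G : Chain D d₀ d₁) {e₀ e₁ : E.Obj} (hs : Chain E e₀ e₁) :
    Tot (tensor D E) (pair d₀ e₀) (pair d₁ e₁) :=
  match G with
  | .nil => edge (rightFun E d₀) e₀ e₁ hs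
  | .cons g .nil => epsFam g e₀ e₁ hs
  | .cons _ (.cons _ _) => 0

@[simp] theorem pairTau_nil (d : D.Obj) (hs : Chain E e₀ e₁) :
    pairTau (.nil : Chain D d d) hs = edge (rightFun E d) e₀ e₁ hs := rfl

@[simp] theorem pairTau_single {n : ℤ} (g : D.Hom d₀ d₁ n) (hs : Chain E e₀ e₁) :
    pairTau (.cons g .nil) hs = epsFam g e₀ e₁ hs := rfl

@[simp] theorem pairTau_cons_cons {x y : D.Obj} {m n : ℤ} (g : D.Hom y d₁ n) (g' : D.Hom x y m)
    (G : Chain D d₀ x) (hs : Chain E e₀ e₁) : pairTau (.cons g (.cons g' G)) hs = 0 := rfl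

/-- The value of a functional on a pair of empty chains. -/
def nilVal {d₀ d₁ : D.Obj} {e₀ e₁ : E.Obj} (G : Chain D d₀ d₁) (hs : Chain E e₀ e₁)
    (φ : Chain (tensor D E) (pair d₀ e₀) (pair d₁ e₁) → M) : M :=
  match G, hs, φ with
  | .nil, .nil, φ => φ .nil
  | .nil, .cons _ _, _ => 0
  | .cons _ _, _, _ => 0

/-- The value of a multilinear functional on `a t`, where `t` runs through `brace G hs`. -/
def braceL {z : (tensor D E).Obj} {φ : Chain (tensor D E) (pair d₀ e₀) z → M} (h : IsMulti φ)
    (G : Chain D d₀ d₁) (hs : Chain E e₀ e₁) : Tot (tensor D E) (pair d₁ e₁) z →ₗ[k] M where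
  toFun a := braceSum G hs fun t => consL h t a
  map_add' := (isLinearMap_braceSum G hs fun t => (consL h t).isLinear).map_add
  map_smul' := (isLinearMap_braceSum G hs fun t => (consL h t).isLinear).map_smul

theorem braceL_apply {z : (tensor D E).Obj} {φ : Chain (tensor D E) (pair d₀ e₀) z → M}
    (h : IsMulti φ) (G : Chain D d₀ d₁) (hs : Chain E e₀ e₁)
    (a : Tot (tensor D E) (pair d₁ e₁) z) : braceL h G hs a = braceSum G hs fun t => consL h t a :=
  rfl

@[simp] theorem braceL_of {z : (tensor D E).Obj} {φ : Chain (tensor D E) (pair d₀ e₀) z → M}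
    (h : IsMulti φ) (G : Chain D d₀ d₁) (hs : Chain E e₀ e₁) {n : ℤ}
    (a : (tensor D E).Hom (pair d₁ e₁) z n) :
    braceL h G hs (of n a) = braceSum G hs fun t => φ (.cons a t) := by
  simp [braceL_apply]

theorem splitSum_cons_edge (F : DGFunctor E (tensor D E)) {m : ℤ} {y : E.Obj} (h : E.Hom y e₁ m)
    (hs : Chain E e₀ y) (n : ℤ)
    (L : ∀ w, Chain E e₀ w → Tot (tensor D E) (F.obj w) (F.obj e₁) →ₗ[k] M) :
    splitSum (.cons h hs) (fun w l r => sgn k (n * l.sdeg) • L w r (edge F w e₁ l)) =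
      sgn k (n * (m - 1)) • L y hs (of m (F.map h)) := by
  rw [splitSum_cons, edge_nil, splitSum_left_nil]
  · simp [Chain.sdeg]
  · intros
    simp

/-- The part of the recursion that takes nothing from `G`: only `l = (h)` contributes, with last
morphism `id ⊗ h`. -/
theorem splitSum_edge_brace (G : Chain D d₀ d₁)
    {φ : Chain (tensor D E) (pair d₀ e₀) (pair d₁ e₁) → M} (hφ : IsMulti φ) {y : E.Obj} {m : ℤ}
    (h : E.Hom y e₁ m) (hs : Chain E e₀ y) :
    splitSum (.cons h hs) (fun _ l r => sgn k (G.sdeg * l.sdeg) •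
      braceL hφ G r (pairTau .nil l)) =
    sgn k (G.sdeg * (m - 1)) • braceSum G hs (fun t => φ (.cons (rightHom d₁ h) t)) :=
  (splitSum_cons_edge (rightFun E d₁) h hs G.sdeg fun _ r => braceL hφ G r).trans
    (congrArg _ (braceL_of hφ G hs _))

/-- The recursion for braces. -/
theorem braceSum_eq_splitSum₂ (G : Chain D d₀ d₁) (hs : Chain E e₀ e₁)
    {φ : Chain (tensor D E) (pair d₀ e₀) (pair d₁ e₁) → M} (hφ : IsMulti φ) :
    braceSum G hs φ = nilVal G hs φ +
      splitSum₂ G hs fun _ _ Gl l Gr r => braceL hφ Gr r (pairTau Gl l) := by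
  -- The last morphism of a term is `pairTau Gl l`: with `Gl` empty it is `id ⊗ h`, with `Gl = (g)`
  -- it is `ε(g; l)`, and longer `Gl` give zero. These are the two alternatives in the definition of
  -- `brace`.
  cases G with
  | nil =>
    cases hs with
    | nil => simp [splitSum₂, nilVal, rightChain]
    | cons h hs =>
      unfold splitSum₂
      rw [splitSum_nil, splitSum_edge_brace .nil hφ h hs]
      simp [nilVal, rightChain, Chain.sdeg, sgn_zero]
  | cons g G =>
    have last : splitSum G (fun v Gl Gr => splitSum hs fun w l r => sgn k (Gr.sdeg * l.sdeg) •
        braceL hφ Gr r (pairTau (.cons g Gl) l)) = lastSum g G hs φ := by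
      rw [splitSum_left_nil]
      · refine splitSum_congr fun w l r _ => ?_
        rw [pairTau_single, epsFam, braceL_of]
      · intros
        simp
    unfold splitSum₂
    rw [splitSum_cons, last]
    cases hs with
    | nil => simp [braceSum_cons_nil, nilVal]
    | cons h hs =>
      rw [splitSum_edge_brace (.cons g G) hφ h hs, braceSum_cons_cons]
      simp [nilVal]

/-- `pairTau` kills the pair of empty chains, so every contributing step of the recursion removes at
least one morphism. This makes induction along the recursion well founded. -/
theorem pairTau_eq_zero_or {v : D.Obj} {w : E.Obj} {G : Chain D d₀ d₁} {hs : Chain E e₀ e₁}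
    {Gl : Chain D v d₁} {Gr : Chain D d₀ v} {l : Chain E w e₁} {r : Chain E e₀ w}
    (hG : Gl.append Gr = G) (hl : l.append r = hs) :
    pairTau Gl l = 0 ∨ Gr.length + r.length < G.length + hs.length := by
  subst hG hl
  rw [Chain.length_append, Chain.length_append]
  cases Gl with
  | nil =>
    cases l with
    | nil => left; rfl
    | cons h l => right; simp only [Chain.length]; omega
  | cons g Gl => right; simp only [Chain.length]; omega

/-- Induction over pairs of chains along the recursion `braceSum_eq_splitSum₂`. -/
theorem pair_induction {d₀ : D.Obj} {e₀ : E.Obj}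
    {P : ∀ d₁ e₁, Chain D d₀ d₁ → Chain E e₀ e₁ → Prop}
    (step : ∀ d₁ e₁ (G : Chain D d₀ d₁) (hs : Chain E e₀ e₁),
      (∀ v w (Gl : Chain D v d₁) (l : Chain E w e₁) Gr r, Gl.append Gr = G → l.append r = hs →
        pairTau Gl l = 0 ∨ P v w Gr r) → P d₁ e₁ G hs)
    {d₁ : D.Obj} {e₁ : E.Obj} (G : Chain D d₀ d₁) (hs : Chain E e₀ e₁) : P d₁ e₁ G hs := by
  have : ∀ (n : ℕ) d₁ e₁ (G : Chain D d₀ d₁) (hs : Chain E e₀ e₁), G.length + hs.length < n →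
      P d₁ e₁ G hs := by
    intro n
    induction n with
    | zero => intro _ _ _ _ h; omega
    | succ n ih =>
      intro d₁ e₁ G hs h
      refine step _ _ G hs fun v w Gl l Gr r hG hl => ?_
      refine (pairTau_eq_zero_or hG hl).imp_right fun h' => ih _ _ _ _ (by omega)
  exact this _ _ _ G hs (Nat.lt_succ_self _)

/-- A cut of the chain `a t` either has an empty left part or keeps `a` in the left part. -/
theorem consL_splitSum {B : DGCat.{u} k} {x y z : B.Obj}
    {Φ : ∀ w : B.Obj, Chain B w z → Chain B x w → M} (h : ∀ w r, IsMulti (fun l => Φ w l r))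
    (h' : ∀ w l, IsMulti (Φ w l)) (t : Chain B x y) (a : Tot B y z) :
    consL (splitSum_isMulti h h') t a = consL (h' z .nil) t a +
      splitSum t (fun w l r => consL (h w r) l a) := by
  induction a using Tot.induction with
  | h₀ => simp
  | h₁ n a => simp
  | h₂ a b ha hb =>
    simp only [map_add, ha, hb, splitSum_add]
    abel

theorem consL_braceSum {B : DGCat.{u} k} {x y z : B.Obj} {d₀ d₁ : D.Obj} {e₀ e₁ : E.Obj}
    (G : Chain D d₀ d₁) (hs : Chain E e₀ e₁)
    {φ : Chain B x z → Chain (tensor D E) (pair d₀ e₀) (pair d₁ e₁) → M}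
    (h : ∀ t, IsMulti (fun s => φ s t)) (t : Chain B x y) (a : Tot B y z) :
    consL (braceSum_isMulti_param G hs h) t a = braceSum G hs (fun u => consL (h u) t a) := by
  induction a using Tot.induction with
  | h₀ => simp
  | h₁ n a => simp
  | h₂ a b ha hb => simp only [map_add, ha, hb, braceSum_add]

theorem IsMulti.consL_param {A B : DGCat.{u} k} {x y : A.Obj} {u v z : B.Obj}
    {φ : Chain A x y → Chain B u z → M} (h : ∀ s, IsMulti (φ s)) (h' : ∀ t, IsMulti fun s => φ s t)
    (t : Chain B u v) (a : Tot B v z) : IsMulti (fun s => TwistedTensor.consL (h s) t a) := by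
  induction a using Tot.induction with
  | h₀ =>
    simp only [map_zero]
    exact fun _ _ _ _ _ => isLinearMap_zero
  | h₁ n a => simpa using h' _
  | h₂ a b ha hb => simpa using ha.add hb

/-- `nilVal` is the counit for cutting pairs of chains. -/
theorem splitSum₂_nilVal (G : Chain D d₀ d₁) (hs : Chain E e₀ e₁)
    (φ : ∀ v w, Chain (tensor D E) (pair v w) (pair d₁ e₁) → Chain D d₀ v → Chain E e₀ w → M) :
    splitSum₂ G hs (fun v w Gl l Gr r => nilVal Gl l (fun t => φ v w t Gr r)) =
      φ d₁ e₁ .nil G hs := by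
  unfold splitSum₂
  rw [splitSum_left_nil, splitSum_left_nil]
  · simp [nilVal, Chain.sdeg, sgn_zero]
  · intros
    simp [nilVal]
  · intros
    simp [nilVal]

/-- The brace map is compatible with cutting. -/
theorem braceSum_splitSum (G : Chain D d₀ d₁) (hs : Chain E e₀ e₁)
    {Φ : ∀ w : (tensor D E).Obj, Chain (tensor D E) w (pair d₁ e₁) →
      Chain (tensor D E) (pair d₀ e₀) w → M} (h : ∀ w r, IsMulti (fun l => Φ w l r))
    (h' : ∀ w l, IsMulti (Φ w l)) :
    braceSum G hs (fun t => splitSum t Φ) = splitSum₂ G hs fun v w Gl l Gr r =>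
      braceSum Gl l fun u => braceSum Gr r (Φ (pair v w) u) := by
  induction G, hs using pair_induction with
  | step d₁ e₁ G hs ih =>
  have e₁ : splitSum₂ G hs (fun v w Gl l Gr r => braceL (splitSum_isMulti h h') Gr r (pairTau Gl l)) =
      splitSum₂ G hs (fun v w Gl l Gr r => braceL (h' _ .nil) Gr r (pairTau Gl l)) +
      splitSum₂ G hs (fun v' w' Gl l r r' => splitSum₂ r r' fun v w e e' b b' =>
        braceSum e e' (fun u => braceSum b b' fun t =>
          consL (y := pair v' w') (h (pair v w) t) u (pairTau Gl l))) := by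
    rw [← splitSum₂_add]
    refine splitSum₂_congr fun v' w' Gl l Gr r hG hl => ?_
    simp only [braceL_apply, consL_splitSum h h', braceSum_add]
    congr 1
    -- Cuts below the last morphism are cuts of a term of the shorter brace, so the induction
    -- hypothesis applies unless the last morphism is already zero.
    rcases ih v' w' Gl l Gr r hG hl with h0 | ih
    · simp [h0, splitSum₂]
    · exact ih (Φ := fun w a b => consL (h w b) a (pairTau Gl l))
        (fun w t => (h w t).consL _) fun w t => IsMulti.consL_param (h w) (h' w) _ _
  -- After reassociating, the stripped morphism belongs to the left part of the cut. The terms with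
  -- empty left part and the others recombine, through the counit, into the recursion for the left
  -- brace.
  rw [braceSum_eq_splitSum₂ G hs (splitSum_isMulti h h'), e₁, ← splitSum₂_assoc, ← add_assoc]
  have e₂ : nilVal G hs (fun t => splitSum t Φ) = nilVal G hs (Φ _ .nil) := by
    cases G with
    | nil =>
      cases hs with
      | nil => simp [nilVal]
      | cons h hs => rfl
    | cons g G => rfl
  rw [e₂, ← braceSum_eq_splitSum₂, ← splitSum₂_nilVal G hs fun v w t Gr r =>
    braceSum Gr r (Φ (pair v w) t), ← splitSum₂_add]
  refine splitSum₂_congr fun v w Gl l Gr r _ _ => ?_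
  rw [braceSum_eq_splitSum₂ Gl l (braceSum_isMulti_param Gr r (h (pair v w)))]
  refine congrArg _ (splitSum₂_congr fun v' w' a a' e e' _ _ => ?_)
  rw [braceL_apply]
  refine braceSum_congr fun t _ => ?_
  exact (consL_braceSum Gr r (h (pair v w)) t _).symm

end BraceCoalgebra

/-! ### Compatibility of braces with the bar differentials -/

section BraceBar

variable {D E : DGCat.{u} k} {M N : Type*} [AddCommGroup M] [Module k M] [AddCommGroup N]
  [Module k N] {d₀ d₁ : D.Obj} {e₀ e₁ : E.Obj}

theorem pairTau_mem_homog (G : Chain D d₀ d₁) (hs : Chain E e₀ e₁) :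
    pairTau G hs ∈ homog (tensor D E) (pair d₀ e₀) (pair d₁ e₁) (1 + (G.sdeg + hs.sdeg)) := by
  rcases G with _ | ⟨g, _ | ⟨g', G⟩⟩
  · have := edge_isHomog (rightFun E d₀) e₀ e₁ hs
    simpa [Chain.sdeg] using this
  · rw [pairTau_single, epsFam]
    simp only [Chain.sdeg, add_zero]
    rw [← add_assoc, add_sub_cancel]
    exact of_mem_homog _ _
  · exact Submodule.zero_mem _

/-- `pairTau` sees at most one morphism of `D`, so from two or more only the merge of the last two
can survive. -/
theorem barSum_pairTau_cons_cons {x y : D.Obj} {m n : ℤ} (g : D.Hom y d₁ n) (g' : D.Hom x y m)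
    (G : Chain D d₀ x) (hs : Chain E e₀ e₁) :
    barSum (.cons g (.cons g' G)) (fun t => pairTau t hs) =
      sgn k (n - 1) • pairTau (.cons (D.comp rfl g g') G) hs := by
  have h : barSum (.cons g' G) (fun t => pairTau (.cons g t) hs) = 0 := by
    rw [barSum_cons]
    cases G <;> simp
  rw [barSum_cons, h]
  simp

/-- The Maurer-Cartan equation for `pairTau`. -/
theorem diffT_pairTau (G : Chain D d₀ d₁) (hs : Chain E e₀ e₁) :
    diffT (pairTau G hs) = barSum₂ G hs (fun t s => pairTau t s) - splitSum₂ G hs fun _ _ Gl l Gr r =>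
      sgn k (Gl.sdeg + l.sdeg) • mulT (pairTau Gl l) (pairTau Gr r) := by
  -- For empty `G` this is `edge_mc`, for `G = (g)` the formula for `d ε(g; hs)`, and for two
  -- morphisms the formula for `ε(g g'; hs)`. For three or more every term vanishes.
  rcases G with _ | ⟨g, _ | ⟨g', G⟩⟩
  · have h := congrFun (congrFun (congrFun (edge_mc (rightFun E d₀)) e₀) e₁) hs
    simp only [Pi.add_apply, Pi.sub_apply, Pi.zero_apply, famDiff_apply, famBar_apply] at h
    rw [cup_apply, sub_add_eq_add_sub, sub_eq_zero, ← eq_sub_iff_add_eq] at h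
    simpa [barSum₂, splitSum₂, Chain.sdeg, sgn_zero] using h
  · rename_i n
    have h := congrFun (congrFun (congrFun (epsFam_d rfl g) e₀) e₁) hs
    rw [twDiff_eq] at h
    simp only [Pi.add_apply, Pi.sub_apply, Pi.smul_apply, famDiff_apply, famBar_apply] at h
    have hd : splitSum₂ (.cons g .nil) hs (fun _ _ Gl l Gr r =>
        sgn k (Gl.sdeg + l.sdeg) • mulT (pairTau Gl l) (pairTau Gr r)) =
        cup n (edge (rightFun E d₁)) (epsFam g) e₀ e₁ hs -
          sgn k n • cup 1 (epsFam g) (edge (rightFun E d₀)) e₀ e₁ hs := by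
      unfold splitSum₂
      rw [splitSum_cons, splitSum_nil, cup_apply, cup_apply, sub_eq_add_neg, ← neg_smul,
        ← splitSum_smul]
      congr 1
      · refine splitSum_congr fun w l r _ => ?_
        rw [smul_smul, ← sgn_add, pairTau_nil, pairTau_single]
        congr 1
        simp only [Chain.sdeg]
        congr 1
        ring
      · refine splitSum_congr fun w l r _ => ?_
        rw [smul_smul, smul_smul, pairTau_nil, pairTau_single, neg_sgn, ← sgn_add, ← sgn_add]
        congr 1
        simp only [Chain.sdeg]
        exact sgn_eq (-1) (by ring)
    unfold barSum₂
    rw [hd, barSum_cons]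
    simp only [pairTau_single, mergeVal_nil, barSum_nil, add_zero, smul_zero, Chain.sdeg]
    have e₂ : sgn k (n - 1) = - sgn k n := by rw [sgn_sub, sgn_one]; ring
    rw [h, e₂]
    change _ = (_ + -sgn k n • barSum hs (epsFam g e₀ e₁)) - _
    module
  · rename_i n _ _ m
    unfold barSum₂
    rw [barSum_pairTau_cons_cons]
    have h₁ : barSum hs (pairTau (.cons g (.cons g' G))) = 0 := barSum_zero hs
    rw [h₁, smul_zero, add_zero, pairTau_cons_cons, map_zero, eq_comm, sub_eq_zero]
    unfold splitSum₂
    rw [splitSum_cons, splitSum_cons]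
    cases G with
    | cons g'' G =>
      rw [splitSum_cons]
      simp
    | nil =>
      rw [splitSum_nil, pairTau_single, epsFam_comp rfl g g', cup_apply]
      simp only [pairTau_cons_cons, map_zero, LinearMap.zero_apply, smul_zero, splitSum_zero, zero_add, add_zero]
      rw [← splitSum_smul]
      refine splitSum_congr fun w l r _ => ?_
      rw [smul_smul, smul_smul, pairTau_single, pairTau_single, ← sgn_add, ← sgn_add]
      congr 1
      simp only [Chain.sdeg]
      exact sgn_congr (by simp [parity_simps, ← Int.not_even_iff_odd]; tauto)

/-- The functional `t ↦ φ ((a g) t)`, where `g` is the last morphism of the chain `g t`. -/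
def mergeL {B : DGCat.{u} k} {x : B.Obj} {y z : B.Obj} {φ : Chain B x z → M} (h : IsMulti φ)
    (a : Tot B y z) : Chain B x y → M
  | .nil => 0
  | .cons (m := m) g t => consL h t (mulT a (of m g))

theorem mergeL_isMulti {B : DGCat.{u} k} {x : B.Obj} {y z : B.Obj} {φ : Chain B x z → M}
    (h : IsMulti φ) (a : Tot B y z) : IsMulti (mergeL h a) := by
  intro u v n l s
  cases l with
  | nil => exact (consL h s ∘ₗ mulT a ∘ₗ of n).isLinear
  | cons g l => exact h.consL _ l s

theorem consL_mergeL {B : DGCat.{u} k} {x : B.Obj} {w y z : B.Obj} {φ : Chain B x z → M}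
    (h : IsMulti φ) (a : Tot B y z) (t : Chain B x w) (b : Tot B w y) :
    consL (mergeL_isMulti h a) t b = consL h t (mulT a b) := by
  induction b using Tot.induction with
  | h₀ => simp
  | h₁ n b => rw [consL_of]; rfl
  | h₂ b c hb hc => simp only [map_add, hb, hc]

theorem mergeL_of {B : DGCat.{u} k} {x : B.Obj} {y z : B.Obj} {φ : Chain B x z → M}
    (h : IsMulti φ) {m : ℤ} (g : B.Hom y z m) (t : Chain B x y) :
    mergeL h (of m g) t = mergeVal g t φ := by
  cases t with
  | nil => rfl
  | cons g' t => rw [mergeL, ← of_comp rfl, consL_of]; rfl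

theorem consL_barSum {B : DGCat.{u} k} {x : B.Obj} {y z : B.Obj} {φ : Chain B x z → M}
    (h : IsMulti φ) {n m : ℤ} (hn : n + 1 = m) {a : Tot B y z} (ha : a ∈ homog B y z m)
    (t : Chain B x y) :
    consL (barSum_isMulti h) t a = consL h t (diffT a) +
      sgn k n • (mergeL h a t + barSum t fun u => consL h u a) := by
  obtain ⟨a, rfl⟩ := ha
  subst hn
  rw [consL_of, barSum_cons, mergeL_of, ← of_d rfl]
  simp

/-- Composing `a` with the last morphism of each term multiplies `a` by `pairTau` in the recursion;
the empty term drops out because `mergeL` is `0` there. -/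
theorem braceSum_mergeL (G : Chain D d₀ d₁) (hs : Chain E e₀ e₁) {z : (tensor D E).Obj}
    {φ : Chain (tensor D E) (pair d₀ e₀) z → M} (h : IsMulti φ)
    (a : Tot (tensor D E) (pair d₁ e₁) z) :
    braceSum G hs (mergeL h a) = splitSum₂ G hs fun _ _ Gl l Gr r =>
      braceL h Gr r (mulT a (pairTau Gl l)) := by
  have h₀ : nilVal G hs (mergeL h a) = 0 := by
    cases G <;> cases hs <;> rfl
  rw [braceSum_eq_splitSum₂ G hs (mergeL_isMulti h a), h₀, zero_add]
  refine splitSum₂_congr fun v w Gl l Gr r _ _ => ?_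
  simp only [braceL_apply, consL_mergeL]

/-- Every chain occurring in a bar differential is nonempty. -/
theorem barSum_eq_zero {B : DGCat.{u} k} {x z : B.Obj} (s : Chain B x z)
    {φ : Chain B x z → M} (h : ∀ {y : B.Obj} {m : ℤ} (g : B.Hom y z m) t, φ (.cons g t) = 0) :
    barSum s φ = 0 := by
  cases s with
  | nil => rfl
  | cons g s =>
    rw [barSum_cons, h]
    simp only [h, barSum_zero]
    cases s <;> simp [h]

theorem barSum₂_nilVal (G : Chain D d₀ d₁) (hs : Chain E e₀ e₁)
    (φ : Chain (tensor D E) (pair d₀ e₀) (pair d₁ e₁) → M) :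
    barSum₂ G hs (fun t s => nilVal t s φ) = 0 := by
  unfold barSum₂
  rw [barSum_eq_zero G fun _ _ => rfl, barSum_eq_zero hs fun _ _ => by cases G <;> rfl, smul_zero,
    add_zero]

/-- The brace map is compatible with the bar differentials. -/
theorem braceSum_barSum (G : Chain D d₀ d₁) (hs : Chain E e₀ e₁)
    {φ : Chain (tensor D E) (pair d₀ e₀) (pair d₁ e₁) → M} (h : IsMulti φ) :
    braceSum G hs (fun t => barSum t φ) = barSum₂ G hs (fun t s => braceSum t s φ) := by
  induction G, hs using pair_induction with
  | step d₁ e₁ G hs ih =>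
  have h₀ : nilVal G hs (fun t => barSum t φ) = 0 := by
    cases G <;> cases hs <;> rfl
  -- With last morphism `a = pairTau Gl l`, the bar differential differentiates `a`, merges it with
  -- the next morphism, or acts on the rest. The last case is the induction hypothesis; the degree
  -- of `a` is one more than that of the cut, which fixes the sign.
  have e₁ : splitSum₂ G hs (fun _ _ Gl l Gr r => braceL (barSum_isMulti h) Gr r (pairTau Gl l)) =
      splitSum₂ G hs (fun _ _ Gl l Gr r => braceL h Gr r (diffT (pairTau Gl l)) +
        sgn k (Gl.sdeg + l.sdeg) • (splitSum₂ Gr r (fun _ _ a b a' b' =>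
          braceL h a' b' (mulT (pairTau Gl l) (pairTau a b))) +
        barSum₂ Gr r (fun t s => braceL h t s (pairTau Gl l)))) := by
    refine splitSum₂_congr fun v w Gl l Gr r hG hl => ?_
    rcases ih v w Gl l Gr r hG hl with h0 | ih
    · simp [h0, splitSum₂, barSum₂]
    · rw [← braceSum_mergeL, braceL_apply, braceL_apply]
      simp only [consL_barSum h (add_comm _ _) (pairTau_mem_homog Gl l), braceSum_add, braceSum_smul]
      rw [ih (h.consL _)]
      simp only [braceL_apply]
  have e₂ : ∀ t s, braceSum t s φ = nilVal t s φ +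
      splitSum₂ t s fun _ _ Gl l Gr r => braceL h Gr r (pairTau Gl l) :=
    fun t s => braceSum_eq_splitSum₂ t s h
  simp only [e₂, barSum₂_add, barSum₂_nilVal, zero_add]
  rw [braceSum_eq_splitSum₂ G hs (barSum_isMulti h), h₀, zero_add, e₁, barSum₂_splitSum₂]
  -- The merge terms are quadratic in `pairTau`; regrouping collects both factors in the left part
  -- of a cut.
  have e₃ := splitSum₂_assoc G hs fun v w v' w' a a' e e' b b' =>
    sgn k (a.sdeg + a'.sdeg) • braceL h b b' (mulT (pairTau a a') (pairTau e e'))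
  simp only [smul_add, ← splitSum₂_smul]
  rw [splitSum₂_add, splitSum₂_add, ← e₃, ← splitSum₂_add, ← splitSum₂_add]
  refine splitSum₂_congr fun v w Gl l Gr r _ _ => ?_
  -- The quadratic part of the Maurer–Cartan equation cancels the merge terms, and the remaining
  -- terms are the coderivation formula.
  rw [diffT_pairTau, map_sub, map_barSum₂, map_splitSum₂]
  simp only [map_smul, braceL_apply]
  abel

theorem braceSum_of_cons_eq_zero (G : Chain D d₀ d₁) (hs : Chain E e₀ e₁)
    {φ : Chain (tensor D E) (pair d₀ e₀) (pair d₁ e₁) → M} (h : IsMulti φ)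
    (h₀ : ∀ {y : (tensor D E).Obj} {m : ℤ} (g : (tensor D E).Hom y (pair d₁ e₁) m) t,
      φ (.cons g t) = 0) : braceSum G hs φ = nilVal G hs φ := by
  have h₁ : ∀ {y : (tensor D E).Obj} (a : Tot (tensor D E) y (pair d₁ e₁)) t,
      consL h t a = 0 := by
    intro y a t
    induction a using Tot.induction with
    | h₀ => simp
    | h₁ m a => simp [h₀]
    | h₂ a b ha hb => simp [ha, hb]
  rw [braceSum_eq_splitSum₂ G hs h, add_eq_left]
  refine splitSum_eq_zero fun _ _ _ _ => splitSum_eq_zero fun _ _ _ _ => ?_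
  simp [braceL_apply, h₁]

theorem splitSum₂_nilVal_right (G : Chain D d₀ d₁) (hs : Chain E e₀ e₁)
    (φ : ∀ v w, Chain D v d₁ → Chain E w e₁ → Chain (tensor D E) (pair d₀ e₀) (pair v w) → M) :
    splitSum₂ G hs (fun v w Gl l Gr r => nilVal Gr r (φ v w Gl l)) = φ d₀ e₀ G hs .nil := by
  unfold splitSum₂
  rw [splitSum_right_nil, splitSum_right_nil]
  · simp [nilVal, Chain.sdeg, sgn_zero]
  · intros
    simp [nilVal]
  · intros
    simp [nilVal]

/-- The functional on chains of length `1` given by a linear map. -/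
def singleVal {B : DGCat.{u} k} {x y : B.Obj} (L : Tot B x y →ₗ[k] M) (s : Chain B x y) : M :=
  match s with
  | .nil => 0
  | .cons (m := m) g .nil => L (of m g)
  | .cons _ (.cons _ _) => 0

theorem singleVal_isMulti {B : DGCat.{u} k} {x y : B.Obj} (L : Tot B x y →ₗ[k] M) :
    IsMulti (singleVal L) := by
  rintro u v n (_ | ⟨g', _ | ⟨g'', l⟩⟩) s
  · cases s with
    | nil => exact (L ∘ₗ of n).isLinear
    | cons g' s => exact isLinearMap_zero
  · exact isLinearMap_zero
  · exact isLinearMap_zero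

theorem consL_singleVal_nil {B : DGCat.{u} k} {x y : B.Obj} (L : Tot B x y →ₗ[k] M)
    (a : Tot B x y) : consL (singleVal_isMulti L) .nil a = L a := by
  induction a using Tot.induction with
  | h₀ => simp
  | h₁ m a => rw [consL_of]; rfl
  | h₂ a b ha hb => simp [ha, hb]

theorem consL_singleVal_cons {B : DGCat.{u} k} {x y v w : B.Obj} {m : ℤ} (L : Tot B x y →ₗ[k] M)
    (g : B.Hom v w m) (t : Chain B x v) (a : Tot B w y) :
    consL (singleVal_isMulti L) (.cons g t) a = 0 := by
  induction a using Tot.induction with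
  | h₀ => simp
  | h₁ m a => rw [consL_of]; rfl
  | h₂ a b ha hb => simp [ha, hb]

/-- A length-one term arises from a single step of the recursion that uses up both chains. Thus
`pairTau` is the length-one component of the brace map. -/
theorem braceSum_singleVal (G : Chain D d₀ d₁) (hs : Chain E e₀ e₁)
    (L : Tot (tensor D E) (pair d₀ e₀) (pair d₁ e₁) →ₗ[k] M) :
    braceSum G hs (singleVal L) = L (pairTau G hs) := by
  have h₀ : nilVal G hs (singleVal L) = 0 := by
    cases G <;> cases hs <;> rfl
  rw [braceSum_eq_splitSum₂ G hs (singleVal_isMulti L), h₀, zero_add,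
    ← consL_singleVal_nil L, ← splitSum₂_nilVal_right G hs fun v w Gl l t =>
      consL (singleVal_isMulti L) t (pairTau Gl l)]
  refine splitSum₂_congr fun v w Gl l Gr r _ _ => ?_
  rw [braceL_apply]
  exact braceSum_of_cons_eq_zero Gr r ((singleVal_isMulti L).consL _) fun g t =>
    consL_singleVal_cons L g t _

theorem edge_eq_singleVal {X : DGCat.{u} k} (F : DGFunctor D X) (x y : D.Obj) :
    edge F x y = singleVal F.tot := by
  funext s
  rcases s with _ | ⟨g, _ | ⟨g', s⟩⟩
  · rfl
  · rw [edge_single, singleVal, DGFunctor.tot_of]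
  · rfl

end BraceBar

/-! ### Currying -/

section Curry

variable {D E X : DGCat.{u} k}

theorem ev_mulT_of_mem {F G H : (Coh D X).Obj} {n : ℤ} (b : Tot (Coh D X) G H)
    {a : Tot (Coh D X) F G} (ha : a ∈ homog (Coh D X) F G n) :
    ev (mulT b a) = cup n (ev b) (ev a) := by
  obtain ⟨a, rfl⟩ := ha
  rw [ev_of]
  induction b using Tot.induction with
  | h₀ => simp
  | h₁ m b => rw [ev_mulT, ev_of]
  | h₂ b c hb hc => simp only [map_add, LinearMap.add_apply, hb, hc]

/-- The value of a cochain on a chain. -/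
def evAt {F G : (Coh D X).Obj} {x y : D.Obj} (s : Chain D x y) :
    Tot (Coh D X) F G →ₗ[k] Tot X ((cohFun F).obj x) ((cohFun G).obj y) where
  toFun a := ev a x y s
  map_add' a b := by
    rw [map_add]
    rfl
  map_smul' r a := by
    rw [map_smul]
    rfl

theorem evAt_apply {F G : (Coh D X).Obj} {x y : D.Obj} (s : Chain D x y) (a : Tot (Coh D X) F G) :
    evAt s a = ev a x y s := rfl

theorem Coh.tot_ext {F G : (Coh D X).Obj} {a b : Tot (Coh D X) F G}
    (h : ∀ {x y : D.Obj} (s : Chain D x y), evAt s a = evAt s b) : a = b := by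
  refine ev_injective ?_
  funext x y s
  exact h s

/-- An outer cup product of cochains with values in cochains becomes one convolution over cuts of
pairs. The value of `φ` on `Sr` has degree `n + Sr.sdeg`, and the inner sign `Sr.sdeg * l.sdeg` is
the one built into `splitSum₂`. -/
theorem evAt_cup {B : DGCat.{u} k} {F G H : B.Obj → (Coh D X).Obj} {n : ℤ}
    (ψ : Fam B (Coh D X) G H) {φ : Fam B (Coh D X) F G} (hφ : IsHomog n φ) {b₀ b₁ : B.Obj}
    (S : Chain B b₀ b₁) {x y : D.Obj} (s : Chain D x y) :
    evAt s (cup n ψ φ b₀ b₁ S) = splitSum₂ S s fun v w Sl l Sr r =>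
      sgn k (n * (Sl.sdeg + l.sdeg)) • mulT (evAt l (ψ v b₁ Sl)) (evAt r (φ b₀ v Sr)) := by
  rw [cup_apply, map_splitSum]
  refine splitSum_congr fun v Sl Sr _ => ?_
  rw [map_smul, evAt_apply, ev_mulT_of_mem _ (hφ _ _ _), cup_apply, ← splitSum_smul]
  refine splitSum_congr fun w l r _ => ?_
  rw [smul_smul, smul_smul, ← sgn_add, ← sgn_add]
  congr 2
  ring

theorem isMulti_of_injective {M N : Type*} [AddCommGroup M] [Module k M] [AddCommGroup N]
    [Module k N] (L : M →ₗ[k] N) (hL : Function.Injective L) {x y : D.Obj} {φ : Chain D x y → M}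
    (h : IsMulti (fun s => L (φ s))) : IsMulti φ := fun u v n l s =>
  ⟨fun a b => hL (by rw [map_add]; exact (h l s).map_add a b),
    fun c a => hL (by rw [map_smul]; exact (h l s).map_smul c a)⟩

/-- The composite of two dg functors. -/
abbrev compFun {Y : DGCat.{u} k} (G : DGFunctor E Y) (F : DGFunctor Y X) : DGFunctor E X where
  obj e := F.obj (G.obj e)
  map := F.map ∘ₗ G.map
  map_id e := by rw [LinearMap.comp_apply, G.map_id, F.map_id]
  map_comp h g f := by simp only [LinearMap.comp_apply, G.map_comp, F.map_comp]
  map_d h f := by simp only [LinearMap.comp_apply, G.map_d, F.map_d]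

/-! ### Postcomposition of cochains with a dg functor -/

section Post

variable {Y : DGCat.{u} k} (F : DGFunctor Y X)

/-- The image of a family under a dg functor. -/
def postFam {G H : E.Obj → Y.Obj} (φ : Fam E Y G H) :
    Fam E X (fun e => F.obj (G e)) (fun e => F.obj (H e)) :=
  fun x y s => F.tot (φ x y s)

theorem postFam_apply {G H : E.Obj → Y.Obj} (φ : Fam E Y G H) {x y : E.Obj} (s : Chain E x y) :
    postFam F φ x y s = F.tot (φ x y s) := rfl

theorem postFam_cup {G H K : E.Obj → Y.Obj} (n : ℤ) (ψ : Fam E Y H K) (φ : Fam E Y G H) :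
    postFam F (cup n ψ φ) = cup n (postFam F ψ) (postFam F φ) := by
  funext x y s
  simp only [postFam_apply, cup_apply, map_splitSum, map_smul, F.tot_mulT]

theorem postFam_oneFam (G : E.Obj → Y.Obj) :
    postFam F (oneFam G) = oneFam fun e => F.obj (G e) := by
  funext x y s
  cases s with
  | nil => exact F.tot_oneT _
  | cons g s => exact map_zero F.tot

theorem postFam_edge (G : DGFunctor E Y) : postFam F (edge G) = edge (compFun G F) := by
  funext x y s
  rcases s with _ | ⟨g, _ | ⟨g', s⟩⟩
  · exact map_zero F.tot
  · rw [postFam_apply, edge_single, edge_single, DGFunctor.tot_of]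
    rfl
  · exact map_zero F.tot

theorem postFam_twDiff (n : ℤ) (G H : DGFunctor E Y) (φ : Fam E Y G.obj H.obj) :
    postFam F (twDiff n G H φ) = twDiff n (compFun G F) (compFun H F) (postFam F φ) := by
  have h₁ : postFam F (cup n (edge H) φ) = cup n (edge (compFun H F)) (postFam F φ) := by
    rw [postFam_cup, postFam_edge]
  have h₂ : postFam F (cup 1 φ (edge G)) = cup 1 (postFam F φ) (edge (compFun G F)) := by
    rw [postFam_cup, postFam_edge]
  rw [twDiff_eq, twDiff_eq, ← h₁, ← h₂]
  funext x y s
  simp only [postFam_apply, Pi.add_apply, Pi.sub_apply, Pi.smul_apply, famDiff_apply,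
    famBar_apply, map_add, map_sub, map_smul, F.tot_diffT, map_barSum]
  rfl

theorem postFam_mem {G H : DGFunctor E Y} {n : ℤ} {φ : Fam E Y G.obj H.obj}
    (h : φ ∈ cohHom G H n) : postFam F φ ∈ cohHom (compFun G F) (compFun H F) n :=
  ⟨fun x y s => F.tot_mem_homog (h.1 x y s), fun x y => (h.2.1 x y).comp F.tot.isLinear,
    fun x y => (h.2.2 x y).comp F.tot.isLinear⟩

theorem postFam_add {G H : E.Obj → Y.Obj} (φ ψ : Fam E Y G H) :
    postFam F (φ + ψ) = postFam F φ + postFam F ψ := by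
  funext x y s
  exact map_add F.tot _ _

theorem postFam_smul {G H : E.Obj → Y.Obj} (r : k) (φ : Fam E Y G H) :
    postFam F (r • φ) = r • postFam F φ := by
  funext x y s
  exact map_smul F.tot _ _

end Post

/-- The dg functor `e ↦ F (d, e)`. -/
abbrev sliceFun (F : DGFunctor (tensor D E) X) (d : D.Obj) : DGFunctor E X :=
  compFun (rightFun E d) F

/-- The dg functor `D → Coh E X` adjoint to `F`. -/
def curryObj (F : DGFunctor (tensor D E) X) : DGFunctor D (Coh E X) :=
  toCoh (fun d => sliceFun F d) (fun g => postFam F (epsFam g))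
    (fun g => postFam_mem F (epsFam_mem g))
    (fun f f' => (congrArg (postFam F) (epsFam_add f f')).trans (postFam_add F _ _))
    (fun r f => (congrArg (postFam F) (epsFam_smul r f)).trans (postFam_smul F _ _))
    (fun c => (congrArg (postFam F) (epsFam_id c)).trans (postFam_oneFam F _))
    (fun h g f => (congrArg (postFam F) (epsFam_comp h g f)).trans (postFam_cup F _ _ _))
    (fun h f => (congrArg (postFam F) (epsFam_d h f)).trans (postFam_twDiff F _ _ _ _))

/-- The part of the image of `pairTau` which comes from an empty first chain. -/
def nilEdge (F : DGFunctor (tensor D E) X) {d₀ d₁ : D.Obj} {e₀ e₁ : E.Obj} (G : Chain D d₀ d₁)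
    (hs : Chain E e₀ e₁) : Tot X (F.obj (pair d₀ e₀)) (F.obj (pair d₁ e₁)) :=
  match G with
  | .nil => edge (sliceFun F d₀) e₀ e₁ hs
  | .cons _ _ => 0

/-- The value of the family `edge (curryObj F)`. -/
def curryEdge (F : DGFunctor (tensor D E) X) {d₀ d₁ : D.Obj} {e₀ e₁ : E.Obj} (G : Chain D d₀ d₁)
    (hs : Chain E e₀ e₁) : Tot X (F.obj (pair d₀ e₀)) (F.obj (pair d₁ e₁)) :=
  evAt hs (edge (curryObj F) d₀ d₁ G)

/-- The twisting element on pairs of chains splits in two: `nilEdge` twists the inner differential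
of `Coh E X`, and `curryEdge` the outer one of `Coh D (Coh E X)`. -/
theorem tot_pairTau (F : DGFunctor (tensor D E) X) {d₀ d₁ : D.Obj} {e₀ e₁ : E.Obj}
    (G : Chain D d₀ d₁) (hs : Chain E e₀ e₁) :
    F.tot (pairTau G hs) = nilEdge F G hs + curryEdge F G hs := by
  rcases G with _ | ⟨g, _ | ⟨g', G⟩⟩
  · refine (congrFun (congrFun (congrFun (postFam_edge F (rightFun E d₀)) e₀) e₁) hs).trans ?_
    exact (add_zero _).symm
  · rw [nilEdge, zero_add, curryEdge, edge_single, evAt_apply, ev_of]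
    rfl
  · rw [pairTau_cons_cons, map_zero, nilEdge, zero_add]
    exact (map_zero (evAt (F := (curryObj F).obj _) (G := (curryObj F).obj _) hs)).symm

variable {F F' F'' : DGFunctor (tensor D E) X}

/-- The cochain `hs ↦ φ (brace G hs)`. -/
def braceFam (φ : Fam (tensor D E) X F.obj F'.obj) {d₀ d₁ : D.Obj} (G : Chain D d₀ d₁) :
    Fam E X (sliceFun F d₀).obj (sliceFun F' d₁).obj :=
  fun e₀ e₁ hs => braceSum G hs (φ (pair d₀ e₀) (pair d₁ e₁))

theorem braceFam_mem {n p : ℤ} {φ : Fam (tensor D E) X F.obj F'.obj} (h : φ ∈ cohHom F F' n)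
    {d₀ d₁ : D.Obj} (G : Chain D d₀ d₁) (hp : n + G.sdeg = p) :
    braceFam φ G ∈ cohHom (sliceFun F d₀) (sliceFun F' d₁) p := by
  refine ⟨fun x y s => braceSum_mem _ fun t ht => ?_,
    fun x y => braceSum_isMulti_right G (h.2.1 _ _),
    fun x y => braceSum_isNormal_right G (h.2.1 _ _) (h.2.2 _ _)⟩
  have := h.1 _ _ t
  rwa [ht, ← add_assoc, hp] at this

/-- The cochain of `D` with values in `Coh E X` adjoint to `φ`. -/
def curryFam {n : ℤ} {φ : Fam (tensor D E) X F.obj F'.obj} (h : φ ∈ cohHom F F' n) :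
    Fam D (Coh E X) (curryObj F).obj (curryObj F').obj :=
  fun d₀ d₁ G => of (X := Coh E X) (n + G.sdeg)
    (⟨braceFam φ G, braceFam_mem h G rfl⟩ :
      {φ // φ ∈ cohHom (sliceFun F d₀) (sliceFun F' d₁) (n + G.sdeg)})

theorem ev_curryFam {n : ℤ} {φ : Fam (tensor D E) X F.obj F'.obj} (h : φ ∈ cohHom F F' n)
    {d₀ d₁ : D.Obj} (G : Chain D d₀ d₁) : ev (curryFam h d₀ d₁ G) = braceFam φ G :=
  ev_of _ _

theorem curryFam_mem {n : ℤ} {φ : Fam (tensor D E) X F.obj F'.obj} (h : φ ∈ cohHom F F' n) :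
    curryFam h ∈ cohHom (curryObj F) (curryObj F') n := by
  refine ⟨fun d₀ d₁ G => of_mem_homog _ _, fun d₀ d₁ => isMulti_of_injective ev ev_injective ?_,
    fun d₀ d₁ v l s => ev_injective ?_⟩
  · simp only [ev_curryFam]
    intro u v n l s
    refine ⟨fun a b => ?_, fun c a => ?_⟩
    · funext e₀ e₁ hs
      exact (braceSum_isMulti_left hs (h.2.1 _ _) l s).map_add a b
    · funext e₀ e₁ hs
      exact (braceSum_isMulti_left hs (h.2.1 _ _) l s).map_smul c a
  · rw [ev_curryFam, map_zero]
    funext e₀ e₁ hs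
    exact braceSum_isNormal_left hs (h.2.1 _ _) (h.2.2 _ _) l s

theorem curryFam_id (F : DGFunctor (tensor D E) X) :
    curryFam (oneFam_mem F) = oneFam (curryObj F).obj := by
  funext d₀ d₁ G
  refine ev_injective ?_
  rw [ev_curryFam]
  funext e₀ e₁ hs
  refine (braceSum_of_cons_eq_zero G hs ((oneFam_mem F).2.1 _ _) fun _ _ => rfl).trans ?_
  cases G with
  | nil =>
    refine Eq.trans ?_ (congrFun (congrFun (congrFun (ev_oneT (F := (curryObj F).obj d₀)).symm e₀) e₁) hs)
    cases hs <;> rfl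
  | cons g G => exact (map_zero (evAt (F := (curryObj F).obj _) (G := (curryObj F).obj _) hs)).symm

/-- Compatibility of braces with cutting, read on cochains. The exponent is constant over a brace
because all its terms have degree `Gl.sdeg + l.sdeg`. -/
theorem braceFam_cup {n : ℤ} {ψ : Fam (tensor D E) X F'.obj F''.obj}
    {φ : Fam (tensor D E) X F.obj F'.obj} (hψ : ∀ x y, IsMulti (ψ x y)) (hφ : ∀ x y, IsMulti (φ x y))
    {d₀ d₁ : D.Obj} (G : Chain D d₀ d₁) {e₀ e₁ : E.Obj} (hs : Chain E e₀ e₁) :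
    braceFam (cup n ψ φ) G e₀ e₁ hs = splitSum₂ G hs fun v w Gl l Gr r =>
      sgn k (n * (Gl.sdeg + l.sdeg)) • mulT (braceFam ψ Gl w e₁ l) (braceFam φ Gr e₀ w r) := by
  have h := braceSum_splitSum G hs (M := Tot X (F.obj (pair d₀ e₀)) (F''.obj (pair d₁ e₁)))
    (Φ := fun w l r => sgn k (n * l.sdeg) • mulT (ψ w (pair d₁ e₁) l) (φ (pair d₀ e₀) w r))
    (fun w r => isMulti_smul_sdeg n ((hψ w _).comp (mulT.flip (φ _ w r)).isLinear))
    (fun w l => (hφ _ w).comp ((sgn k (n * l.sdeg) • mulT (ψ w _ l)).isLinear))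
  refine h.trans (splitSum₂_congr fun v w Gl l Gr r _ _ => ?_)
  have h₁ : ∀ u : Chain (tensor D E) (pair v w) (pair d₁ e₁), u.sdeg = Gl.sdeg + l.sdeg →
      braceSum Gr r (fun t => sgn k (n * u.sdeg) • mulT (ψ (pair v w) (pair d₁ e₁) u)
        (φ (pair d₀ e₀) (pair v w) t)) = sgn k (n * (Gl.sdeg + l.sdeg)) •
          mulT.flip (braceSum Gr r (φ (pair d₀ e₀) (pair v w))) (ψ (pair v w) (pair d₁ e₁) u) := by
    intro u hu
    rw [braceSum_smul, ← map_braceSum, hu]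
    rfl
  rw [braceSum_congr h₁, braceSum_smul, ← map_braceSum]
  rfl

theorem evAt_curryFam {n : ℤ} {φ : Fam (tensor D E) X F.obj F'.obj} (h : φ ∈ cohHom F F' n)
    {d₀ d₁ : D.Obj} (G : Chain D d₀ d₁) {e₀ e₁ : E.Obj} (hs : Chain E e₀ e₁) :
    evAt hs (curryFam h d₀ d₁ G) = braceFam φ G e₀ e₁ hs :=
  congrFun (congrFun (congrFun (ev_curryFam h G) e₀) e₁) hs

theorem curryFam_cup {m n p : ℤ} (hp : m + n = p) {ψ : Fam (tensor D E) X F'.obj F''.obj}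
    {φ : Fam (tensor D E) X F.obj F'.obj} (hψ : ψ ∈ cohHom F' F'' m) (hφ : φ ∈ cohHom F F' n) :
    curryFam (cup_mem hp hψ hφ) = cup n (curryFam hψ) (curryFam hφ) := by
  funext d₀ d₁ G
  refine Coh.tot_ext fun {e₀ e₁} hs => ?_
  rw [evAt_curryFam, evAt_cup (curryFam hψ) (curryFam_mem hφ).1]
  refine (braceFam_cup hψ.2.1 hφ.2.1 G hs).trans (splitSum₂_congr fun v w Gl l Gr r _ _ => ?_)
  rw [evAt_curryFam, evAt_curryFam]
  rfl

theorem braceFam_edge (F : DGFunctor (tensor D E) X) {d₀ d₁ : D.Obj} (G : Chain D d₀ d₁)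
    {e₀ e₁ : E.Obj} (hs : Chain E e₀ e₁) :
    braceFam (edge F) G e₀ e₁ hs = nilEdge F G hs + curryEdge F G hs := by
  rw [← tot_pairTau, ← braceSum_singleVal, braceFam, edge_eq_singleVal]

/-- Only cuts taking nothing from `G` contribute. The sign from moving `l` past `G` turns the degree
`n` of `φ` into the degree `n + G.sdeg` of the inner cochain. -/
theorem splitSum₂_nilEdge_left (n : ℤ) (φ : Fam (tensor D E) X F.obj F'.obj) {d₀ d₁ : D.Obj}
    (G : Chain D d₀ d₁) {e₀ e₁ : E.Obj} (hs : Chain E e₀ e₁) :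
    splitSum₂ G hs (fun v w Gl l Gr r => sgn k (n * (Gl.sdeg + l.sdeg)) •
      mulT (nilEdge F' Gl l) (braceFam φ Gr e₀ w r)) =
    cup (n + G.sdeg) (edge (sliceFun F' d₁)) (braceFam φ G) e₀ e₁ hs := by
  unfold splitSum₂
  rw [splitSum_left_nil, cup_apply]
  · refine splitSum_congr fun w l r _ => ?_
    rw [smul_smul, ← sgn_add]
    simp only [Chain.sdeg]
    rw [show G.sdeg * l.sdeg + n * (0 + l.sdeg) = (n + G.sdeg) * l.sdeg by ring]
    rfl
  · intros
    simp [nilEdge]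

theorem splitSum₂_nilEdge_right (φ : Fam (tensor D E) X F.obj F'.obj) {d₀ d₁ : D.Obj}
    (G : Chain D d₀ d₁) {e₀ e₁ : E.Obj} (hs : Chain E e₀ e₁) :
    splitSum₂ G hs (fun v w Gl l Gr r => sgn k (1 * (Gl.sdeg + l.sdeg)) •
      mulT (braceFam φ Gl w e₁ l) (nilEdge F Gr r)) =
    sgn k G.sdeg • cup 1 (braceFam φ G) (edge (sliceFun F d₀)) e₀ e₁ hs := by
  unfold splitSum₂
  rw [splitSum_right_nil, cup_apply, ← splitSum_smul]
  · refine splitSum_congr fun w l r _ => ?_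
    rw [smul_smul, smul_smul, ← sgn_add, ← sgn_add]
    simp only [Chain.sdeg]
    rw [show 0 * l.sdeg + 1 * (G.sdeg + l.sdeg) = G.sdeg + 1 * l.sdeg by ring]
    rfl
  · intros
    simp [nilEdge]

theorem braceFam_twDiff {n : ℤ} {φ : Fam (tensor D E) X F.obj F'.obj} (h : ∀ x y, IsMulti (φ x y))
    {d₀ d₁ : D.Obj} (G : Chain D d₀ d₁) {e₀ e₁ : E.Obj} (hs : Chain E e₀ e₁) :
    braceFam (twDiff n F F' φ) G e₀ e₁ hs = diffT (braceFam φ G e₀ e₁ hs) +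
      sgn k n • barSum₂ G hs (fun t s => braceFam φ t e₀ e₁ s) +
      braceFam (cup n (edge F') φ) G e₀ e₁ hs -
      sgn k n • braceFam (cup 1 φ (edge F)) G e₀ e₁ hs := by
  have h₁ : barSum₂ G hs (fun t s => braceFam φ t e₀ e₁ s) = _ :=
    (braceSum_barSum G hs (h (pair d₀ e₀) (pair d₁ e₁))).symm
  rw [h₁]
  simp only [braceFam, map_braceSum, ← braceSum_smul, ← braceSum_add, sub_eq_add_neg]
  rw [← neg_one_smul k, ← braceSum_smul, ← braceSum_add]
  refine braceSum_congr fun t _ => ?_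
  rw [twDiff_eq, neg_one_smul, ← sub_eq_add_neg]
  rfl

/-- The inner differential of the value on `G` accounts for the differential of `X`, the bar
differential of `E` and the `nilEdge` products. The outer one adds the bar differential of `D` and
the `curryEdge` products. Together these are the pieces of `braceFam_twDiff`. -/
theorem curryFam_d {n p : ℤ} (hp : n + 1 = p) {φ : Fam (tensor D E) X F.obj F'.obj}
    (h : φ ∈ cohHom F F' n) :
    curryFam (twDiff_mem hp h) = twDiff n (curryObj F) (curryObj F') (curryFam h) := by
  funext d₀ d₁ G
  refine Coh.tot_ext fun {e₀ e₁} hs => ?_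
  -- The value on `G` is an inner cochain of degree `n + G.sdeg`, so this degree governs the signs
  -- of the inner differential.
  have hd : evAt hs (diffT (curryFam h d₀ d₁ G)) =
      twDiff (n + G.sdeg) (sliceFun F d₀) (sliceFun F' d₁) (braceFam φ G) e₀ e₁ hs :=
    congrFun (congrFun (congrFun (ev_diffT (X := X) (D := E) (n := n + G.sdeg)
      (F := (curryObj F).obj d₀) (G := (curryObj F').obj d₁)
      ⟨braceFam φ G, braceFam_mem h G rfl⟩) e₀) e₁) hs
  have hb : evAt hs (barSum G (curryFam h d₀ d₁)) = barSum G fun t => braceFam φ t e₀ e₁ hs := by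
    rw [map_barSum]
    simp only [evAt_curryFam]
    rfl
  have h₁ := evAt_cup (edge (curryObj F')) (curryFam_mem h).1 G hs
  have h₂ := evAt_cup (curryFam h) (edge_isHomog (curryObj F)) G hs
  simp only [evAt_curryFam] at h₁ h₂
  have h₃ := braceFam_cup (F'' := F') (n := n) (edge_isMulti F') h.2.1 G hs
  have h₄ := braceFam_cup (F := F) (F' := F) (F'' := F') (n := 1) h.2.1 (edge_isMulti F) G hs
  simp only [braceFam_edge, map_add, LinearMap.add_apply, smul_add, splitSum₂_add] at h₃ h₄
  have h₅ := h₃.trans (congrArg (· + _) (splitSum₂_nilEdge_left n φ G hs))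
  have h₆ := h₄.trans (congrArg (· + _) (splitSum₂_nilEdge_right φ G hs))
  have hL := braceFam_twDiff (n := n) h.2.1 G hs
  rw [h₅, h₆] at hL
  unfold barSum₂ at hL
  have hR : evAt hs (twDiff n (curryObj F) (curryObj F') (curryFam h) d₀ d₁ G) =
      evAt hs (diffT (curryFam h d₀ d₁ G)) + sgn k n • evAt hs (barSum G (curryFam h d₀ d₁)) +
        evAt hs (cup n (edge (curryObj F')) (curryFam h) d₀ d₁ G) -
        sgn k n • evAt hs (cup 1 (curryFam h) (edge (curryObj F)) d₀ d₁ G) := by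
    rw [twDiff_eq]
    simp only [Pi.add_apply, Pi.sub_apply, Pi.smul_apply, famDiff_apply, famBar_apply, map_add,
      map_sub, map_smul]
  rw [hd, hb, h₁, h₂, twDiff_eq] at hR
  simp only [Pi.add_apply, Pi.sub_apply, Pi.smul_apply, famDiff_apply, famBar_apply] at hR
  refine (evAt_curryFam _ G hs).trans (hL.trans (Eq.trans ?_ hR.symm))
  -- `A` comes from the differential of `X`, `B₁` and `B₂` from the bar differentials of `D` and
  -- `E`, the `N` from `nilEdge` and the `C` from `curryEdge`; the right side groups the inner
  -- differential in parentheses.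
  have aux : ∀ {M : Type u} [AddCommGroup M] [Module k M] (A B₁ B₂ N₁ N₂ C₁ C₂ : M) (g : ℤ),
      A + sgn k n • (B₁ + sgn k g • B₂) + (N₁ + C₁) - sgn k n • (sgn k g • N₂ + C₂) =
        (A + sgn k (n + g) • B₂ + N₁ - sgn k (n + g) • N₂) + sgn k n • B₁ + C₁ -
          sgn k n • C₂ := by
    intro M _ _ A B₁ B₂ N₁ N₂ C₁ C₂ g
    rw [sgn_add]
    module
  exact aux (diffT (braceFam φ G e₀ e₁ hs)) (barSum G fun t => braceFam φ t e₀ e₁ hs)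
    (barSum hs (braceFam φ G e₀ e₁))
    (cup (n + G.sdeg) (edge (sliceFun F' d₁)) (braceFam φ G) e₀ e₁ hs)
    (cup 1 (braceFam φ G) (edge (sliceFun F d₀)) e₀ e₁ hs)
    (splitSum₂ G hs fun v w Gl l Gr r => sgn k (n * (Gl.sdeg + l.sdeg)) •
      mulT (curryEdge F' Gl l) (braceFam φ Gr e₀ w r))
    (splitSum₂ G hs fun v w Gl l Gr r => sgn k (1 * (Gl.sdeg + l.sdeg)) •
      mulT (braceFam φ Gl w e₁ l) (curryEdge F Gr r)) G.sdeg

theorem braceFam_add (φ ψ : Fam (tensor D E) X F.obj F'.obj) {d₀ d₁ : D.Obj} (G : Chain D d₀ d₁) :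
    braceFam (φ + ψ) G = braceFam φ G + braceFam ψ G := by
  funext e₀ e₁ hs
  exact braceSum_add _ _ _ _

theorem braceFam_smul (r : k) (φ : Fam (tensor D E) X F.obj F'.obj) {d₀ d₁ : D.Obj}
    (G : Chain D d₀ d₁) : braceFam (r • φ) G = r • braceFam φ G := by
  funext e₀ e₁ hs
  exact braceSum_smul _ _ _ _

theorem curryFam_add {n : ℤ} {φ ψ : Fam (tensor D E) X F.obj F'.obj} (h : φ ∈ cohHom F F' n)
    (h' : ψ ∈ cohHom F F' n) (h'' : φ + ψ ∈ cohHom F F' n) :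
    curryFam h'' = curryFam h + curryFam h' := by
  funext d₀ d₁ G
  refine ev_injective ?_
  rw [Pi.add_apply, Pi.add_apply, Pi.add_apply, map_add, ev_curryFam, ev_curryFam, ev_curryFam,
    braceFam_add]
  rfl

theorem curryFam_smul {n : ℤ} (r : k) {φ : Fam (tensor D E) X F.obj F'.obj}
    (h : φ ∈ cohHom F F' n) (h' : r • φ ∈ cohHom F F' n) :
    curryFam h' = r • curryFam h := by
  funext d₀ d₁ G
  refine ev_injective ?_
  rw [Pi.smul_apply, Pi.smul_apply, Pi.smul_apply, map_smul, ev_curryFam, ev_curryFam,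
    braceFam_smul]
  rfl

/-- The dg functor `Coh (tensor D E) X → Coh D (Coh E X)`. -/
def curry (D E X : DGCat.{u} k) : DGFunctor (Coh (tensor D E) X) (Coh D (Coh E X)) :=
  toCoh (fun F => curryObj (cohFun F)) (fun φ => curryFam (cohVal_mem φ))
    (fun φ => curryFam_mem (cohVal_mem φ))
    (fun φ ψ => curryFam_add (cohVal_mem φ) (cohVal_mem ψ) (cohVal_mem (φ + ψ)))
    (fun r φ => curryFam_smul r (cohVal_mem φ) (cohVal_mem (r • φ)))
    (fun F => curryFam_id (cohFun F))
    (fun h ψ φ => curryFam_cup h (cohVal_mem ψ) (cohVal_mem φ))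
    (fun h φ => curryFam_d h (cohVal_mem φ))

end Curry

/-! ### The associator -/

section Assoc

/-- The dg functor adjoint to the associator. -/
def assocCurry (C D E : DGCat.{u} k) :
    DGFunctor C (Coh D (Coh E (tensor C (tensor D E)))) :=
  compFun (cohUnit C (tensor D E)) (curry D E (tensor C (tensor D E)))

/-- The associator. -/
def assoc (C D E : DGCat.{u} k) : tensor (tensor C D) E ⟶ tensor C (tensor D E) :=
  tensorLift (tensorLift (assocCurry C D E))

variable {C D E : DGCat.{u} k}

theorem of_assoc_eps_right (c : C.Obj) {d₀ d₁ : D.Obj} {e₀ e₁ : E.Obj} {n p : ℤ}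
    (g : D.Hom d₀ d₁ n) (hs : Chain E e₀ e₁) (hp : n + hs.sdeg = p) :
    of p ((assoc C D E).map (epsHom (C := tensor C D) (rightHom (C := C) c g) hs hp)) =
      of (X := tensor C (tensor D E)) p (rightHom (D := tensor D E) c (epsHom g hs hp)) := by
  refine (tensorLift_eps (tensorLift (assocCurry C D E)) (rightHom (C := C) c g) hs hp).trans ?_
  -- By definition, the inner lift applies to `g` the dg functor attached to `c`, which is the
  -- currying of `x ↦ id_c ⊗ x`.
  refine Eq.trans (b := postFam (rightFun (tensor D E) c) (epsFam g) e₀ e₁ hs) rfl ?_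
  rw [postFam_apply, ← of_epsHom g hs hp, DGFunctor.tot_of]
  rfl

/-- Two applications of the adjunction evaluate the curried cochain of `ε(f; -)` on `gs` and then on
`hs`, and currying is pullback along the braces. -/
theorem of_assoc_eps_eps {c₀ c₁ : C.Obj} {d₀ d₁ : D.Obj} {e₀ e₁ : E.Obj} {m q p : ℤ}
    (f : C.Hom c₀ c₁ m) (gs : Chain D d₀ d₁) (hs : Chain E e₀ e₁)
    (hq : m + gs.sdeg = q) (hp : q + hs.sdeg = p) :
    of p ((assoc C D E).map (epsHom (C := tensor C D) (epsHom f gs hq) hs hp)) =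
      braceSum gs hs (epsFam f (pair d₀ e₀) (pair d₁ e₁)) := by
  refine (tensorLift_eps (tensorLift (assocCurry C D E)) (epsHom f gs hq) hs hp).trans ?_
  have h := tensorLift_eps (assocCurry C D E) f gs hq
  have h' := congrArg (evAt hs) h
  rw [evAt_apply, ev_of] at h'
  refine h'.trans ?_
  exact evAt_curryFam (epsFam_mem f) gs hs

theorem of_sum_brace {c₀ c₁ : C.Obj} {d₀ d₁ : D.Obj} {e₀ e₁ : E.Obj} {m q p : ℤ}
    (f : C.Hom c₀ c₁ m) (gs : Chain D d₀ d₁) (hs : Chain E e₀ e₁)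
    (hq : m + gs.sdeg = q) (hp : q + hs.sdeg = p) :
    of p (((brace gs hs).map fun w =>
        w.coeff • epsHom f w.chain (p := p) (by have := w.deg; omega)).sum) =
      braceSum gs hs (epsFam f (pair d₀ e₀) (pair d₁ e₁)) := by
  rw [map_list_sum, List.map_map]
  refine congrArg List.sum (List.map_congr_left fun w _ => ?_)
  rw [Function.comp_apply, map_smul, of_epsHom]

theorem assoc_isAssociator (C D E : DGCat.{u} k) : IsAssociator (assoc C D E) where
  obj_eq _ _ _ := rfl
  map_right _ _ _ _ _ _ := HEq.rfl
  map_eps_right c d₀ d₁ e₀ e₁ n p g hs hp :=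
    heq_of_eq (of_injective (X := tensor C (tensor D E)) p (of_assoc_eps_right c g hs hp))
  map_eps_eps {c₀ c₁ d₀ d₁ e₀ e₁ m q p} f gs hs hq hp := by
    exact heq_of_eq (of_injective (X := tensor C (tensor D E)) p
      ((of_assoc_eps_eps f gs hs hq hp).trans (of_sum_brace f gs hs hq hp).symm))

end Assoc

/-! ### Generators -/

section Generators

/-- A dg subcategory with all objects. -/
structure SubDG (X : DGCat.{u} k) where
  carrier : ∀ (x y : X.Obj) (n : ℤ), Submodule k (X.Hom x y n)
  id_mem : ∀ x, X.id x ∈ carrier x x 0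
  comp_mem : ∀ {x y z : X.Obj} {m n p : ℤ} (h : m + n = p) {b : X.Hom y z m} {a : X.Hom x y n},
    b ∈ carrier y z m → a ∈ carrier x y n → X.comp h b a ∈ carrier x z p
  d_mem : ∀ {x y : X.Obj} {n p : ℤ} (h : n + 1 = p) {a : X.Hom x y n},
    a ∈ carrier x y n → X.d h a ∈ carrier x y p

namespace SubDG

variable {C D X Y : DGCat.{u} k}

/-- The dg subcategory on which two dg functors agree. -/
def equalizer (F G : DGFunctor X Y) (h : ∀ x, F.obj x = G.obj x) : SubDG X where
  carrier x y n :=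
    { carrier := {a | HEq (F.map a) (G.map a)}
      add_mem' := by
        -- With the functors taken apart, their object maps can be identified, and heterogeneous
        -- equality becomes equality.
        obtain ⟨o, m, _, _, _⟩ := F
        obtain ⟨o', m', _, _, _⟩ := G
        obtain rfl : o = o' := funext h
        intro a b ha hb
        have ha := eq_of_heq ha
        have hb := eq_of_heq hb
        exact heq_of_eq (by dsimp only at ha hb ⊢; rw [map_add, map_add, ha, hb])
      zero_mem' := by
        obtain ⟨o, m, _, _, _⟩ := F
        obtain ⟨o', m', _, _, _⟩ := G
        obtain rfl : o = o' := funext h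
        exact heq_of_eq (by dsimp only; rw [map_zero, map_zero])
      smul_mem' := by
        obtain ⟨o, m, _, _, _⟩ := F
        obtain ⟨o', m', _, _, _⟩ := G
        obtain rfl : o = o' := funext h
        intro r a ha
        have ha := eq_of_heq ha
        exact heq_of_eq (by dsimp only at ha ⊢; rw [map_smul, map_smul, ha]) }
  id_mem x := by
    obtain ⟨o, m, h₁, _, _⟩ := F
    obtain ⟨o', m', h₂, _, _⟩ := G
    obtain rfl : o = o' := funext h
    exact heq_of_eq ((h₁ x).trans (h₂ x).symm)
  comp_mem e b a hb ha := by
    obtain ⟨o, m, _, h₁, _⟩ := F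
    obtain ⟨o', m', _, h₂, _⟩ := G
    obtain rfl : o = o' := funext h
    have ha := eq_of_heq ha
    have hb := eq_of_heq hb
    exact heq_of_eq ((h₁ e b a).trans ((congrArg₂ (fun b a => Y.comp e b a) hb ha).trans
      (h₂ e b a).symm))
  d_mem e a ha := by
    obtain ⟨o, m, _, _, h₁⟩ := F
    obtain ⟨o', m', _, _, h₂⟩ := G
    obtain rfl : o = o' := funext h
    have ha := eq_of_heq ha
    exact heq_of_eq ((h₁ e a).trans ((congrArg (fun a => Y.d e a) ha).trans (h₂ e a).symm))

theorem eq_of_equalizer {F G : DGFunctor X Y} (h : ∀ x, F.obj x = G.obj x)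
    (h' : ∀ (x y : X.Obj) (n : ℤ) (a : X.Hom x y n), HEq (F.map a) (G.map a)) : F = G := by
  obtain ⟨o, m, _, _, _⟩ := F
  obtain ⟨o', m', _, _, _⟩ := G
  obtain rfl : o = o' := funext h
  have : @m = @m' := by
    funext x y n
    exact LinearMap.ext fun a => eq_of_heq (h' x y n a)
  subst this
  rfl

/-- The morphisms all of whose homogeneous components lie in a dg subcategory. -/
def tot (S : SubDG X) (x y : X.Obj) : Submodule k (Tot X x y) where
  carrier := {a | ∀ n, a n ∈ S.carrier x y n}
  add_mem' ha hb n := Submodule.add_mem _ (ha n) (hb n)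
  zero_mem' _ := Submodule.zero_mem _
  smul_mem' r _ ha n := Submodule.smul_mem _ r (ha n)

theorem of_mem_tot (S : SubDG X) {x y : X.Obj} {n : ℤ} {a : X.Hom x y n} :
    of n a ∈ S.tot x y ↔ a ∈ S.carrier x y n := by
  refine ⟨fun h => by simpa [of_apply_self] using h n, fun h m => ?_⟩
  by_cases hmn : n = m
  · subst hmn
    rwa [of_apply_self]
  · rw [homog_component_ne (of_mem_homog n a) hmn]
    exact Submodule.zero_mem _

theorem tot_induction (S : SubDG X) {x y : X.Obj} {p : Tot X x y → Prop} {a : Tot X x y}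
    (ha : a ∈ S.tot x y) (h₀ : p 0) (h₁ : ∀ n, ∀ a ∈ S.carrier x y n, p (of n a))
    (h₂ : ∀ a b, p a → p b → p (a + b)) : p a := by
  classical
  rw [← DirectSum.sum_support_of a]
  exact Finset.sum_induction _ p h₂ h₀ fun n _ => h₁ n _ (ha n)

theorem mulT_mem (S : SubDG X) {x y z : X.Obj} {b : Tot X y z} {a : Tot X x y}
    (hb : b ∈ S.tot y z) (ha : a ∈ S.tot x y) : mulT b a ∈ S.tot x z := by
  refine S.tot_induction (p := fun b => mulT b a ∈ S.tot x z) hb ?_ (fun n b hb => ?_)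
    fun b c hb hc => ?_
  · simp
  · refine S.tot_induction (p := fun a => mulT _ a ∈ S.tot x z) ha ?_ (fun n a ha => ?_)
      fun a c ha hc => ?_
    · simp
    · rw [← of_comp rfl, of_mem_tot]
      exact S.comp_mem rfl hb ha
    · rw [map_add]
      exact Submodule.add_mem _ ha hc
  · rw [map_add]
    exact Submodule.add_mem _ hb hc

theorem diffT_mem (S : SubDG X) {x y : X.Obj} {a : Tot X x y} (ha : a ∈ S.tot x y) :
    diffT a ∈ S.tot x y := by
  refine S.tot_induction (p := fun a => diffT a ∈ S.tot x y) ha ?_ (fun n a ha => ?_)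
    fun a c ha hc => ?_
  · simp
  · rw [← of_d rfl, of_mem_tot]
    exact S.d_mem rfl ha
  · rw [map_add]
    exact Submodule.add_mem _ ha hc

theorem oneT_mem (S : SubDG X) (x : X.Obj) : oneT x ∈ S.tot x x := S.of_mem_tot.2 (S.id_mem x)

/-- The morphisms `f` for which all `ε(f; s)` lie in a dg subcategory `S` that contains all
`id ⊗ g`. -/
def left (S : SubDG (tensor C D)) (h : ∀ (c : C.Obj) (d₀ d₁ : D.Obj) (n : ℤ) (g : D.Hom d₀ d₁ n),
    rightHom c g ∈ S.carrier (pair c d₀) (pair c d₁) n) : SubDG C where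
  carrier c₀ c₁ m :=
    { carrier := {f | ∀ (d₀ d₁ : D.Obj) (s : Chain D d₀ d₁),
        epsFam f d₀ d₁ s ∈ S.tot (pair c₀ d₀) (pair c₁ d₁)}
      add_mem' := fun ha hb d₀ d₁ s => by
        rw [epsFam_add]
        exact Submodule.add_mem _ (ha _ _ s) (hb _ _ s)
      zero_mem' := fun d₀ d₁ s => by
        rw [← zero_smul k (0 : C.Hom c₀ c₁ m), epsFam_smul, zero_smul]
        exact Submodule.zero_mem _
      smul_mem' := fun r a ha d₀ d₁ s => by
        rw [epsFam_smul]
        exact Submodule.smul_mem _ r (ha _ _ s) }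
  id_mem c d₀ d₁ s := by
    rw [epsFam_id]
    cases s with
    | nil => exact S.oneT_mem _
    | cons g s => exact Submodule.zero_mem _
  comp_mem e b a hb ha d₀ d₁ s := by
    rw [epsFam_comp e, cup_apply]
    exact splitSum_mem _ _ fun w l r _ => Submodule.smul_mem _ _ (S.mulT_mem (hb _ _ l) (ha _ _ r))
  d_mem e f hf d₀ d₁ s := by
    have he : ∀ c (d₀ d₁ : D.Obj) (s : Chain D d₀ d₁),
        edge (rightFun D c) d₀ d₁ s ∈ S.tot (pair c d₀) (pair c d₁) := by
      intro c d₀ d₁ s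
      rcases s with _ | ⟨g, _ | ⟨g', s⟩⟩
      · exact Submodule.zero_mem _
      · exact S.of_mem_tot.2 (h c _ _ _ g)
      · exact Submodule.zero_mem _
    -- The relation for `d ε(f; s)` expresses `ε(d f; s)` through the differential of `ε(f; s)`,
    -- values `ε(f; t)` and products with `id ⊗ g`, all of which belong to `S`.
    rw [epsFam_d e, twDiff_eq]
    refine Submodule.sub_mem _ (Submodule.add_mem _ (Submodule.add_mem _ ?_ ?_) ?_) ?_
    · exact S.diffT_mem (hf _ _ s)
    · exact Submodule.smul_mem _ _ (barSum_mem _ s fun t _ => hf _ _ t)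
    · exact splitSum_mem _ _ fun w l r _ =>
        Submodule.smul_mem _ _ (S.mulT_mem (he _ _ _ l) (hf _ _ r))
    · exact Submodule.smul_mem _ _ (splitSum_mem _ _ fun w l r _ =>
        Submodule.smul_mem _ _ (S.mulT_mem (hf _ _ l) (he _ _ _ r)))

theorem tensor_top (S : SubDG (tensor C D))
    (h : ∀ (c : C.Obj) (d₀ d₁ : D.Obj) (n : ℤ) (g : D.Hom d₀ d₁ n),
      rightHom c g ∈ S.carrier (pair c d₀) (pair c d₁) n)
    (h' : ∀ (c₀ c₁ : C.Obj) (m : ℤ) (f : C.Hom c₀ c₁ m), f ∈ (S.left h).carrier c₀ c₁ m)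
    (x y : (tensor C D).Obj) (n : ℤ) (a : (tensor C D).Hom x y n) : a ∈ S.carrier x y n := by
  revert a
  refine Quotient.ind fun a => ?_
  induction a with
  | zero => exact (S.carrier _ _ _).zero_mem
  | add a b ha hb => exact (S.carrier _ _ _).add_mem ha hb
  | smul r a ha => exact (S.carrier _ _ _).smul_mem r ha
  | id x => exact S.id_mem x
  | comp e b a hb ha => exact S.comp_mem e hb ha
  | d e a ha => exact S.d_mem e ha
  | right c g => exact h c _ _ _ g
  | eps f s e =>
    refine S.of_mem_tot.1 ?_
    have := h' _ _ _ f _ _ s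
    rwa [← of_epsHom f s e] at this

end SubDG

theorem tensor_hom_ext {C D Y : DGCat.{u} k} {F G : tensor C D ⟶ Y} (h : ∀ x, F.obj x = G.obj x)
    (hr : ∀ (c : C.Obj) (d₀ d₁ : D.Obj) (n : ℤ) (g : D.Hom d₀ d₁ n),
      HEq (F.map (rightHom c g)) (G.map (rightHom c g)))
    (he : ∀ (c₀ c₁ : C.Obj) (m : ℤ) (f : C.Hom c₀ c₁ m) (d₀ d₁ : D.Obj) (s : Chain D d₀ d₁),
      HEq (F.map (epsHom f s rfl)) (G.map (epsHom f s rfl))) : F = G :=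
  SubDG.eq_of_equalizer h <| (SubDG.equalizer F G h).tensor_top hr fun c₀ c₁ m f d₀ d₁ s =>
    SubDG.of_mem_tot _ |>.2 (he c₀ c₁ m f d₀ d₁ s)

/-- `tensor_top` is used twice. The morphisms `f` of `tensor C D` for which the functors agree on
all `ε(f; hs)` again form a dg subcategory, so generators of `tensor C D` suffice. -/
theorem tensor₃_hom_ext {C D E Y : DGCat.{u} k} {F G : tensor (tensor C D) E ⟶ Y}
    (h : ∀ x, F.obj x = G.obj x)
    (h₁ : ∀ (x : (tensor C D).Obj) (e₀ e₁ : E.Obj) (n : ℤ) (g : E.Hom e₀ e₁ n),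
      HEq (F.map (rightHom x g)) (G.map (rightHom x g)))
    (h₂ : ∀ (c : C.Obj) (d₀ d₁ : D.Obj) (m : ℤ) (g : D.Hom d₀ d₁ m) (e₀ e₁ : E.Obj)
      (hs : Chain E e₀ e₁),
      HEq (F.map (epsHom (rightHom c g) hs rfl)) (G.map (epsHom (rightHom c g) hs rfl)))
    (h₃ : ∀ (c₀ c₁ : C.Obj) (m : ℤ) (f : C.Hom c₀ c₁ m) (d₀ d₁ : D.Obj) (gs : Chain D d₀ d₁)
      (e₀ e₁ : E.Obj) (hs : Chain E e₀ e₁),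
      HEq (F.map (epsHom (epsHom f gs rfl) hs rfl)) (G.map (epsHom (epsHom f gs rfl) hs rfl))) :
    F = G :=
  SubDG.eq_of_equalizer h <| (SubDG.equalizer F G h).tensor_top h₁ <|
    SubDG.tensor_top _ (fun c d₀ d₁ m g e₀ e₁ hs => SubDG.of_mem_tot _ |>.2 (h₂ c d₀ d₁ m g e₀ e₁ hs))
      fun c₀ c₁ m f d₀ d₁ gs => SubDG.of_mem_tot _ |>.2 fun e₀ e₁ hs =>
        SubDG.of_mem_tot _ |>.2 (h₃ c₀ c₁ m f d₀ d₁ gs e₀ e₁ hs)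

theorem tensor₄_hom_ext {B C D E Y : DGCat.{u} k} {F G : tensor (tensor (tensor B C) D) E ⟶ Y}
    (h : ∀ x, F.obj x = G.obj x)
    (h₁ : ∀ (x : (tensor (tensor B C) D).Obj) (e₀ e₁ : E.Obj) (n : ℤ) (g : E.Hom e₀ e₁ n),
      HEq (F.map (rightHom x g)) (G.map (rightHom x g)))
    (h₂ : ∀ (x : (tensor B C).Obj) (d₀ d₁ : D.Obj) (m : ℤ) (g : D.Hom d₀ d₁ m) (e₀ e₁ : E.Obj)
      (hs : Chain E e₀ e₁),
      HEq (F.map (epsHom (rightHom x g) hs rfl)) (G.map (epsHom (rightHom x g) hs rfl)))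
    (h₃ : ∀ (b : B.Obj) (c₀ c₁ : C.Obj) (m : ℤ) (f : C.Hom c₀ c₁ m) (d₀ d₁ : D.Obj)
      (gs : Chain D d₀ d₁) (e₀ e₁ : E.Obj) (hs : Chain E e₀ e₁),
      HEq (F.map (epsHom (epsHom (rightHom b f) gs rfl) hs rfl))
        (G.map (epsHom (epsHom (rightHom b f) gs rfl) hs rfl)))
    (h₄ : ∀ (b₀ b₁ : B.Obj) (m : ℤ) (a : B.Hom b₀ b₁ m) (c₀ c₁ : C.Obj) (fs : Chain C c₀ c₁)
      (d₀ d₁ : D.Obj) (gs : Chain D d₀ d₁) (e₀ e₁ : E.Obj) (hs : Chain E e₀ e₁),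
      HEq (F.map (epsHom (epsHom (epsHom a fs rfl) gs rfl) hs rfl))
        (G.map (epsHom (epsHom (epsHom a fs rfl) gs rfl) hs rfl))) :
    F = G :=
  SubDG.eq_of_equalizer h <| (SubDG.equalizer F G h).tensor_top h₁ <|
    SubDG.tensor_top _ (fun c d₀ d₁ m g e₀ e₁ hs => SubDG.of_mem_tot _ |>.2 (h₂ c d₀ d₁ m g e₀ e₁ hs)) <|
      SubDG.tensor_top _ (fun b c₀ c₁ m f d₀ d₁ gs => SubDG.of_mem_tot _ |>.2 fun e₀ e₁ hs =>
        SubDG.of_mem_tot _ |>.2 (h₃ b c₀ c₁ m f d₀ d₁ gs e₀ e₁ hs))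
      fun b₀ b₁ m a c₀ c₁ fs => SubDG.of_mem_tot _ |>.2 fun d₀ d₁ gs =>
        SubDG.of_mem_tot _ |>.2 fun e₀ e₁ hs =>
          SubDG.of_mem_tot _ |>.2 (h₄ b₀ b₁ m a c₀ c₁ fs d₀ d₁ gs e₀ e₁ hs)

/-- The prescribed values are exactly those on the generators in `tensor₃_hom_ext`; hence
uniqueness. -/
theorem isAssociator_iff {C D E : DGCat.{u} k}
    (F : tensor (tensor C D) E ⟶ tensor C (tensor D E)) : IsAssociator F ↔ F = assoc C D E := by
  refine ⟨fun h => ?_, fun h => h ▸ assoc_isAssociator C D E⟩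
  have h' := assoc_isAssociator C D E
  refine tensor₃_hom_ext (fun x => (h.obj_eq x.1.1 x.1.2 x.2).trans (h'.obj_eq x.1.1 x.1.2 x.2).symm) ?_ ?_ ?_
  · exact fun x e₀ e₁ n g => (h.map_right x.1 x.2 g).trans (h'.map_right x.1 x.2 g).symm
  · exact fun c d₀ d₁ m g e₀ e₁ hs =>
      (h.map_eps_right c g hs rfl).trans (h'.map_eps_right c g hs rfl).symm
  · exact fun c₀ c₁ m f d₀ d₁ gs e₀ e₁ hs =>
      (h.map_eps_eps f gs hs rfl rfl).trans (h'.map_eps_eps f gs hs rfl rfl).symm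

end Generators

/-! ### Functoriality and naturality -/

section Naturality

variable {C D E C' D' E' C'' D'' : DGCat.{u} k}

theorem Chain.map_id {x : D.Obj} : ∀ {y : D.Obj} (s : Chain D x y), s.map (𝟙 D) = s
  | _, .nil => rfl
  | _, .cons g s => congrArg (Chain.cons g) (map_id s)

theorem Chain.map_comp (F : D ⟶ D') (G : D' ⟶ D'') {x : D.Obj} :
    ∀ {y : D.Obj} (s : Chain D x y), s.map (F ≫ G) = (s.map F).map G
  | _, .nil => rfl
  | _, .cons g s => congrArg (Chain.cons (DGFunctor.map G (DGFunctor.map F g))) (map_comp F G s)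

theorem epsHom_heq {c₀ c₁ : C.Obj} {d₀ d₁ : D.Obj} {m p p' : ℤ} (f : C.Hom c₀ c₁ m)
    {s s' : Chain D d₀ d₁} (hs : s = s') (h : m + s.sdeg = p) (h' : m + s'.sdeg = p') :
    HEq (epsHom f s h) (epsHom f s' h') := by
  subst hs h h'
  rfl

theorem tensorMap_id (C D : DGCat.{u} k) : tensorMap (𝟙 C) (𝟙 D) = 𝟙 (tensor C D) :=
  tensor_hom_ext (fun _ => rfl) (fun _ _ _ _ _ => HEq.rfl) fun _ _ _ f _ _ s =>
    epsHom_heq f s.map_id _ _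

theorem tensorMap_comp (F : C ⟶ C') (F' : C' ⟶ C'') (G : D ⟶ D') (G' : D' ⟶ D'') :
    tensorMap (F ≫ F') (G ≫ G') = tensorMap F G ≫ tensorMap F' G' :=
  tensor_hom_ext (fun _ => rfl) (fun _ _ _ _ _ => HEq.rfl) fun _ _ _ f _ _ s =>
    epsHom_heq (DGFunctor.map F' (DGFunctor.map F f)) (s.map_comp G G') _ _

theorem splitSum_map {M : Type*} [AddCommGroup M] [Module k M] (G : DGFunctor D D') {x y : D.Obj}
    (s : Chain D x y) (Φ : ∀ w : D'.Obj, Chain D' w (G.obj y) → Chain D' (G.obj x) w → M) :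
    splitSum (s.map G) Φ = splitSum s fun w l r => Φ (G.obj w) (l.map G) (r.map G) := by
  rw [splitSum, splitSum, splits_map, List.map_map]
  rfl

theorem cons_epsHom_eq {c₀ c₁ : C.Obj} {d₀ d₁ : D.Obj} {m p : ℤ} (f : C.Hom c₀ c₁ m)
    (s : Chain D d₀ d₁) (h : m + s.sdeg = p) {x : (tensor C D).Obj}
    (t : Chain (tensor C D) x (pair c₀ d₀)) :
    Chain.cons (epsHom f s h) t = Chain.cons (epsHom f s rfl) t := by
  subst h
  rfl

theorem rightChain_map (G : DGFunctor D D') (H : DGFunctor E E') (d : D.Obj) {e₀ : E.Obj} :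
    ∀ {e₁ : E.Obj} (hs : Chain E e₀ e₁),
      rightChain (G.obj d) (hs.map H) = (rightChain d hs).map (tensorMap G H)
  | _, .nil => rfl
  | _, .cons h hs => congrArg (Chain.cons (rightHom (G.obj d) (H.map h)))
      (rightChain_map G H d hs)

/-- Braces are built from `id ⊗ h` and `ε(g; l)`, which `tensorMap` respects, and chains keep their
lengths and degrees under dg functors. -/
theorem braceSum_map {M : Type*} [AddCommGroup M] [Module k M] (G : DGFunctor D D')
    (H : DGFunctor E E') {d₀ : D.Obj} : ∀ {d₁ : D.Obj} (gs : Chain D d₀ d₁) {e₀ e₁ : E.Obj}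
    (hs : Chain E e₀ e₁) (φ : Chain (tensor D' E') (pair (G.obj d₀) (H.obj e₀))
      (pair (G.obj d₁) (H.obj e₁)) → M),
    braceSum (gs.map G) (hs.map H) φ = braceSum gs hs fun t => φ (t.map (tensorMap G H))
  | _, .nil, e₀, e₁, hs, φ => by
    rw [Chain.map, braceSum_nil, braceSum_nil, rightChain_map]
  | _, .cons g gs, e₀, e₁, hs, φ => by
    have last : ∀ {e₁ : E.Obj} (hs : Chain E e₀ e₁) (φ : Chain (tensor D' E')
        (pair (G.obj d₀) (H.obj e₀)) (pair (G.obj _) (H.obj e₁)) → M),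
        lastSum (G.map g) (gs.map G) (hs.map H) φ =
          lastSum g gs hs fun t => φ (t.map (tensorMap G H)) := by
      intro e₁ hs φ
      refine (splitSum_map H hs _).trans (splitSum_congr fun w l r _ => ?_)
      rw [braceSum_map G H gs]
      refine congrArg₂ (· • ·) (by rw [Chain.sdeg_map, Chain.sdeg_map])
        (braceSum_congr fun t _ => ?_)
      exact (congrArg φ (cons_epsHom_eq (G.map g) (l.map H) (by rw [Chain.sdeg_map]) _)).symm
    induction hs with
    | nil => exact (braceSum_cons_nil _ _ _).trans ((last .nil φ).trans (braceSum_cons_nil _ _ _).symm)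
    | cons h hs ih =>
      rw [braceSum_cons_cons, ← last]
      refine (braceSum_cons_cons (G.map g) (gs.map G) (H.map h) (hs.map H) φ).trans ?_
      refine congrArg₂ (· + ·) (congrArg₂ (· • ·) ?_ (ih _)) rfl
      rw [← Chain.sdeg_map G]
      rfl

theorem tot_epsFam (F : DGFunctor C C') (G : DGFunctor D D') {c₀ c₁ : C.Obj} {m : ℤ}
    (f : C.Hom c₀ c₁ m) {d₀ d₁ : D.Obj} (s : Chain D d₀ d₁) :
    (tensorMap F G).tot (epsFam f d₀ d₁ s) =
      epsFam (F.map f) (G.obj d₀) (G.obj d₁) (s.map G) := by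
  rw [epsFam, DGFunctor.tot_of, ← of_epsHom (F.map f) (s.map G) (by rw [Chain.sdeg_map])]
  rfl

theorem assoc_eps_right (c : C.Obj) {d₀ d₁ : D.Obj} {e₀ e₁ : E.Obj} {n p : ℤ}
    (g : D.Hom d₀ d₁ n) (hs : Chain E e₀ e₁) (hp : n + hs.sdeg = p) :
    (assoc C D E).map (epsHom (C := tensor C D) (rightHom (C := C) c g) hs hp) =
      rightHom (D := tensor D E) c (epsHom g hs hp) :=
  of_injective (X := tensor C (tensor D E)) p (of_assoc_eps_right c g hs hp)

/-- The action of the associator on total spaces of morphisms. -/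
def assocT {c₀ c₁ : C.Obj} {d₀ d₁ : D.Obj} {e₀ e₁ : E.Obj} :
    Tot (tensor (tensor C D) E) (pair (pair c₀ d₀) e₀) (pair (pair c₁ d₁) e₁) →ₗ[k]
      Tot (tensor C (tensor D E)) (pair c₀ (pair d₀ e₀)) (pair c₁ (pair d₁ e₁)) :=
  (assoc C D E).tot

/-- The linear extension of `f ↦ ε(f; s)`. -/
def epsL {c₀ c₁ : C.Obj} {d₀ d₁ : D.Obj} (s : Chain D d₀ d₁) :
    Tot C c₀ c₁ →ₗ[k] Tot (tensor C D) (pair c₀ d₀) (pair c₁ d₁) :=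
  Tot.lift fun _ =>
    { toFun := fun f => epsFam f d₀ d₁ s
      map_add' := fun f f' => by
        rw [epsFam_add]
        rfl
      map_smul' := fun r f => by
        rw [epsFam_smul]
        rfl }

theorem epsL_of {c₀ c₁ : C.Obj} {d₀ d₁ : D.Obj} (s : Chain D d₀ d₁) {m : ℤ} (f : C.Hom c₀ c₁ m) :
    epsL s (of m f) = epsFam f d₀ d₁ s := Tot.lift_of _ _ _

theorem assocT_epsL_epsFam {c₀ c₁ : C.Obj} {d₀ d₁ : D.Obj} {e₀ e₁ : E.Obj} {m : ℤ}
    (f : C.Hom c₀ c₁ m) (gs : Chain D d₀ d₁) (hs : Chain E e₀ e₁) :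
    assocT (epsL hs (epsFam f d₀ d₁ gs)) = braceSum gs hs (epsFam f (pair d₀ e₀) (pair d₁ e₁)) := by
  rw [epsFam, epsL_of]
  exact (DGFunctor.tot_of (assoc C D E) _ _).trans (of_assoc_eps_eps f gs hs rfl rfl)

theorem assocT_epsL_right (c : C.Obj) {d₀ d₁ : D.Obj} {e₀ e₁ : E.Obj} (a : Tot D d₀ d₁)
    (hs : Chain E e₀ e₁) :
    assocT (epsL hs ((rightFun D c).tot a)) = (rightFun (tensor D E) c).tot (epsL hs a) := by
  induction a using Tot.induction with
  | h₀ => simp only [map_zero]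
  | h₂ a b ha hb => simp only [map_add, ha, hb]
  | h₁ n g =>
    rw [DGFunctor.tot_of, epsL_of, epsL_of, epsFam, epsFam, DGFunctor.tot_of]
    exact (DGFunctor.tot_of (assoc C D E) _ _).trans (of_assoc_eps_right c g hs rfl)

/-- The action of `tensorMap F G` on total spaces of morphisms. -/
def mapT (F : DGFunctor C C') (G : DGFunctor D D') {c₀ c₁ : C.Obj} {d₀ d₁ : D.Obj} :
    Tot (tensor C D) (pair c₀ d₀) (pair c₁ d₁) →ₗ[k]
      Tot (tensor C' D') (pair (F.obj c₀) (G.obj d₀)) (pair (F.obj c₁) (G.obj d₁)) :=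
  (tensorMap F G).tot

/-- On generators; the only substantial case is nested `ε`, where naturality of the braces is used.
-/
theorem assoc_natural (F : C ⟶ C') (G : D ⟶ D') (H : E ⟶ E') :
    tensorMap (tensorMap F G) H ≫ assoc C' D' E' =
      assoc C D E ≫ tensorMap F (tensorMap G H) := by
  refine tensor₃_hom_ext (fun _ => rfl) (fun x e₀ e₁ n g => HEq.rfl)
    (fun c d₀ d₁ m g e₀ e₁ hs => ?_) (fun c₀ c₁ m f d₀ d₁ gs e₀ e₁ hs => ?_)
  · refine heq_of_eq ((assoc_eps_right (DGFunctor.obj F c) (DGFunctor.map G g) (hs.map H)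
      (by rw [Chain.sdeg_map])).trans ?_)
    exact (congrArg (tensorMap F (tensorMap G H)).map (assoc_eps_right c g hs rfl)).symm
  · refine heq_of_eq (of_injective (X := tensor C' (tensor D' E')) _ ?_)
    refine (of_assoc_eps_eps (DGFunctor.map F f) (gs.map G) (hs.map H) (by rw [Chain.sdeg_map])
      (by rw [Chain.sdeg_map])).trans ?_
    have h := congrArg (DGFunctor.tot (tensorMap F (tensorMap G H))) (of_assoc_eps_eps f gs hs rfl rfl)
    refine Eq.trans ?_ (h.symm.trans (DGFunctor.tot_of _ _ _))
    refine (braceSum_map (M := Tot (tensor C' (tensor D' E'))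
      (pair (F.obj c₀) (pair (G.obj d₀) (H.obj e₀))) (pair (F.obj c₁) (pair (G.obj d₁) (H.obj e₁))))
      G H gs hs _).trans ?_
    refine Eq.trans ?_ (map_braceSum (M := Tot (tensor C (tensor D E)) (pair c₀ (pair d₀ e₀))
      (pair c₁ (pair d₁ e₁))) (mapT F (tensorMap G H)) gs hs _).symm
    exact braceSum_congr fun t _ => (tot_epsFam F (tensorMap G H) f t).symm

end Naturality

/-! ### Iterated braces -/

section IteratedBrace

variable {C D E : DGCat.{u} k} {M N : Type*} [AddCommGroup M] [Module k M] [AddCommGroup N]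
  [Module k N]

theorem IsMulti.map {X Y : DGCat.{u} k} (F : DGFunctor X Y) {x y : X.Obj}
    {φ : Chain Y (F.obj x) (F.obj y) → M} (h : IsMulti φ) : IsMulti fun t => φ (Chain.map F t) :=
  fun u v n l s => by
    simp only [Chain.map_append, Chain.map]
    exact IsLinearMap.comp' (f := fun a => φ ((l.map F).append (.cons a (s.map F)))) (h _ _)
      F.map.isLinear

theorem consL_map {X Y : DGCat.{u} k} (F : DGFunctor X Y) {x y z : X.Obj}
    {φ : Chain Y (F.obj x) (F.obj z) → M} (h : IsMulti φ) (t : Chain X x y) (a : Tot X y z) :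
    consL (h.map F) t a = consL h (t.map F) (F.tot a) := by
  induction a using Tot.induction with
  | h₀ => simp only [map_zero]
  | h₁ n a =>
    rw [consL_of, DGFunctor.tot_of, consL_of]
    rfl
  | h₂ a b ha hb => simp only [map_add, ha, hb]

theorem braceSum_splitSum_swap {B : DGCat.{u} k} {x z : B.Obj} {d₀ d₁ : D.Obj} {e₀ e₁ : E.Obj}
    (G : Chain D d₀ d₁) (hs : Chain E e₀ e₁) (s : Chain B x z)
    (Φ : Chain (tensor D E) (pair d₀ e₀) (pair d₁ e₁) →
      ∀ w : B.Obj, Chain B w z → Chain B x w → M) :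
    braceSum G hs (fun t => splitSum s (Φ t)) =
      splitSum s fun w l r => braceSum G hs fun t => Φ t w l r := by
  have : ∀ L : List (Split s),
      braceSum G hs (fun t => (L.map fun p => Φ t p.mid p.left p.right).sum) =
        (L.map fun p => braceSum G hs fun t => Φ t p.mid p.left p.right).sum := by
    intro L
    induction L with
    | nil => simp
    | cons p L ih =>
      simp only [List.map_cons, List.sum_cons, braceSum_add, ih]
  exact this s.splits

theorem splitSum_isMulti_param {B : DGCat.{u} k} {x y : B.Obj} {d₀ d₁ : D.Obj} (s : Chain D d₀ d₁)
    {Φ : Chain B x y → ∀ w : D.Obj, Chain D w d₁ → Chain D d₀ w → M}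
    (h : ∀ w l r, IsMulti fun t => Φ t w l r) : IsMulti fun t => splitSum s (Φ t) :=
  fun _ _ _ l t => isLinearMap_splitSum s fun w a b => h w a b l t

theorem list_sum_sum_comm {A B : Type*} (l : List A) (l' : List B) (f : A → B → M) :
    (l.map fun a => (l'.map (f a)).sum).sum = (l'.map fun b => (l.map fun a => f a b).sum).sum := by
  induction l with
  | nil => simp
  | cons a l ih => simp only [List.map_cons, List.sum_cons, ih, List.sum_map_add]

theorem braceSum_comm {A B : DGCat.{u} k} {a₀ a₁ : A.Obj} {b₀ b₁ : B.Obj} {d₀ d₁ : D.Obj}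
    {e₀ e₁ : E.Obj} (fs : Chain A a₀ a₁) (gs : Chain B b₀ b₁) (G : Chain D d₀ d₁)
    (hs : Chain E e₀ e₁) (φ : Chain (tensor A B) (pair a₀ b₀) (pair a₁ b₁) →
      Chain (tensor D E) (pair d₀ e₀) (pair d₁ e₁) → M) :
    braceSum fs gs (fun t => braceSum G hs (φ t)) =
      braceSum G hs fun u => braceSum fs gs fun t => φ t u := by
  simp only [braceSum, List.smul_sum, List.map_map, Function.comp_def]
  refine (list_sum_sum_comm _ _ _).trans ?_
  refine congrArg List.sum (List.map_congr_left fun w _ => congrArg List.sum ?_)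
  exact List.map_congr_left fun w' _ => smul_comm _ _ _

theorem isMulti_of_cons_eq_zero {x y : D.Obj} {φ : Chain D x y → M}
    (h : ∀ {u : D.Obj} {n : ℤ} (g : D.Hom u y n) (t : Chain D x u), φ (.cons g t) = 0) :
    IsMulti φ := by
  rintro u v n (_ | ⟨g', l⟩) s
  · simp only [Chain.append, h]
    exact isLinearMap_zero
  · simp only [Chain.append, h]
    exact isLinearMap_zero

theorem pairTau_isMulti_right {d₀ d₁ : D.Obj} (G : Chain D d₀ d₁) (e₀ e₁ : E.Obj) :
    IsMulti fun hs : Chain E e₀ e₁ => pairTau G hs := by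
  rcases G with _ | ⟨g, _ | ⟨g', G⟩⟩
  · simp only [pairTau_nil, edge_eq_singleVal]
    exact singleVal_isMulti _
  · exact epsFam_isMulti g e₀ e₁
  · exact fun _ _ _ _ _ => isLinearMap_zero

/-- On nonempty first chains `pairTau` is a functional of length-one type. It is not so on the empty
chain, where it equals `edge`. -/
theorem pairTau_cons_eq {x₀ x₁ y : D.Obj} {z₀ z₁ : E.Obj} {n : ℤ} (g : D.Hom y x₁ n)
    (t : Chain D x₀ y) (hs : Chain E z₀ z₁) :
    pairTau (.cons g t) hs = singleVal (epsL hs) (.cons g t) := by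
  cases t with
  | nil => exact (epsL_of hs g).symm
  | cons g' t => rfl

theorem pairTau_isMulti_left (d₀ d₁ : D.Obj) {e₀ e₁ : E.Obj} (hs : Chain E e₀ e₁) :
    IsMulti fun G : Chain D d₀ d₁ => pairTau G hs := by
  have h : IsMulti fun G : Chain D d₀ d₁ => pairTau G hs + (-1 : k) • singleVal (epsL hs) G :=
    isMulti_of_cons_eq_zero fun g t => by rw [pairTau_cons_eq]; simp
  have := h.add (singleVal_isMulti (M := Tot (tensor D E) (pair d₀ e₀) (pair d₁ e₁)) (epsL hs))
  simpa using this

/-- A brace with nonempty first chain has only nonempty terms, so the values on the empty chain do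
not matter. -/
theorem braceSum_congr_cons {d₀ d₁ d₂ : D.Obj} {e₀ e₁ : E.Obj} {n : ℤ} (g : D.Hom d₁ d₂ n)
    (G : Chain D d₀ d₁) (hs : Chain E e₀ e₁)
    {φ ψ : Chain (tensor D E) (pair d₀ e₀) (pair d₂ e₁) → M}
    (h : ∀ {y : (tensor D E).Obj} {m : ℤ} (a : (tensor D E).Hom y (pair d₂ e₁) m) t,
      φ (.cons a t) = ψ (.cons a t)) :
    braceSum (.cons g G) hs φ = braceSum (.cons g G) hs ψ := by
  have h₀ : braceSum (.cons g G) hs (fun t => φ t + (-1 : k) • ψ t) = 0 :=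
    braceSum_of_cons_eq_zero _ _ (isMulti_of_cons_eq_zero fun a t => by rw [h]; simp)
      fun a t => by rw [h]; simp
  rw [braceSum_add, braceSum_smul] at h₀
  simpa [← sub_eq_add_neg, sub_eq_zero] using h₀

theorem assocT_edge (c : C.Obj) (d : D.Obj) {e₀ e₁ : E.Obj} (hs : Chain E e₀ e₁) :
    assocT (edge (rightFun (C := tensor C D) E (pair c d)) e₀ e₁ hs) =
      (rightFun (tensor D E) c).tot (edge (rightFun E d) e₀ e₁ hs) := by
  rcases hs with _ | ⟨h, _ | ⟨h', hs⟩⟩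
  · simp only [edge_nil, map_zero]
  · rw [edge_single, edge_single, DGFunctor.tot_of]
    exact DGFunctor.tot_of (assoc C D E) _ _
  · simp only [edge_cons_cons, map_zero]

theorem assocT_pairTau_rightChain (c : C.Obj) {d₀ d₁ : D.Obj} {e₀ e₁ : E.Obj} (gs : Chain D d₀ d₁)
    (hs : Chain E e₀ e₁) :
    assocT (pairTau (rightChain c gs) hs) = (rightFun (tensor D E) c).tot (pairTau gs hs) := by
  rcases gs with _ | ⟨g, _ | ⟨g', gs⟩⟩
  · exact assocT_edge c d₀ hs
  · have := assocT_epsL_right c (of _ g) hs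
    rw [DGFunctor.tot_of, epsL_of, epsL_of] at this
    exact this
  · simp only [rightChain, pairTau_cons_cons, map_zero]

/-- The length-one components of the two iterated braces correspond under the associator. For `fs =
(f)` this is its formula on `ε(ε(f; gs); hs)`; for empty `fs` it is the formula on `ε(id ⊗ g; hs)`
and `id ⊗ h`. For longer `fs` both sides vanish. -/
theorem assocT_braceSum_pairTau {c₀ c₁ : C.Obj} {d₀ d₁ : D.Obj} {e₀ e₁ : E.Obj}
    (fs : Chain C c₀ c₁) (gs : Chain D d₀ d₁) (hs : Chain E e₀ e₁) :
    assocT (braceSum fs gs fun u => pairTau u hs) = braceSum gs hs fun t => pairTau fs t := by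
  cases fs with
  | nil =>
    rw [braceSum_nil, assocT_pairTau_rightChain]
    simp only [pairTau_nil, edge_eq_singleVal]
    exact (braceSum_singleVal gs hs _).symm
  | cons f fs =>
    rw [braceSum_congr_cons f fs gs fun a t => pairTau_cons_eq a t hs, braceSum_singleVal]
    cases fs with
    | nil => exact assocT_epsL_epsFam f gs hs
    | cons f' fs => simp only [pairTau_cons_cons, map_zero, braceSum_zero]

/-- The sum of the values of a multilinear functional on `a t`, where `t` runs through the terms of
`brace fs u` for the terms `u` of `brace gs hs`. -/
def braceL₂ {c₀ c₁ : C.Obj} {d₀ d₁ : D.Obj} {e₀ e₁ : E.Obj} {z : (tensor C (tensor D E)).Obj}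
    {φ : Chain (tensor C (tensor D E)) (pair c₀ (pair d₀ e₀)) z → M} (h : IsMulti φ)
    (fs : Chain C c₀ c₁) (gs : Chain D d₀ d₁) (hs : Chain E e₀ e₁) :
    Tot (tensor C (tensor D E)) (pair c₁ (pair d₁ e₁)) z →ₗ[k] M where
  toFun a := braceSum gs hs fun t => braceL h fs t a
  map_add' := (isLinearMap_braceSum gs hs fun t => (braceL h fs t).isLinear).map_add
  map_smul' := (isLinearMap_braceSum gs hs fun t => (braceL h fs t).isLinear).map_smul

/-- The recursion for one of the iterated braces: strip the last morphism of the outer brace, then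
use compatibility of the inner brace with cutting. `braceSum_braceSum_map_eq` does the same for the
other bracketing. -/
theorem braceSum_braceSum_eq {c₀ c₁ : C.Obj} {d₀ d₁ : D.Obj} {e₀ e₁ : E.Obj}
    (fs : Chain C c₀ c₁) (gs : Chain D d₀ d₁) (hs : Chain E e₀ e₁)
    {φ : Chain (tensor C (tensor D E)) (pair c₀ (pair d₀ e₀)) (pair c₁ (pair d₁ e₁)) → M}
    (h : IsMulti φ) :
    braceSum gs hs (fun t => braceSum fs t φ) = nilVal gs hs (fun t => nilVal fs t φ) +
      splitSum fs fun _ l r => splitSum gs fun _ l' r' => splitSum hs fun _ l'' r'' =>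
        sgn k (r'.sdeg * l''.sdeg + r.sdeg * (l'.sdeg + l''.sdeg)) •
          braceL₂ h r r' r'' (braceSum l' l'' fun u => pairTau l u) := by
  have e₁ : braceSum gs hs (fun t => nilVal fs t φ) = nilVal gs hs (fun t => nilVal fs t φ) := by
    have h₀ : ∀ {y : (tensor D E).Obj} {m : ℤ} (g : (tensor D E).Hom y (pair d₁ e₁) m) t,
        nilVal fs (.cons g t) φ = 0 := fun g t => by cases fs <;> rfl
    exact braceSum_of_cons_eq_zero gs hs (isMulti_of_cons_eq_zero h₀) h₀
  simp only [braceSum_eq_splitSum₂ fs _ h]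
  rw [braceSum_add, e₁]
  congr 1
  refine (braceSum_splitSum_swap gs hs fs _).trans (splitSum_congr fun v l r _ => ?_)
  refine (braceSum_splitSum gs hs (fun w r' => isMulti_smul_sdeg _
    ((pairTau_isMulti_right l _ _).comp (braceL h r r').isLinear))
    fun w l' => (braceSum_isMulti_right r (h.consL (pairTau l l'))).smul _).trans ?_
  refine splitSum_congr fun v' l' r' _ => splitSum_congr fun v'' l'' r'' _ => ?_
  rw [sgn_add, mul_smul, map_braceSum, ← braceSum_smul (sgn k (r.sdeg * _))]
  refine congrArg _ (braceSum_congr fun t ht => ?_)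
  rw [braceSum_smul, ht]
  rfl

theorem braceSum_braceSum_map_eq {c₀ c₁ : C.Obj} {d₀ d₁ : D.Obj} {e₀ e₁ : E.Obj}
    (fs : Chain C c₀ c₁) (gs : Chain D d₀ d₁) (hs : Chain E e₀ e₁)
    {φ : Chain (tensor (tensor C D) E) (pair (pair c₀ d₀) e₀) (pair (pair c₁ d₁) e₁) → M}
    (h : IsMulti φ) :
    braceSum fs gs (fun u => braceSum u hs φ) = nilVal fs gs (fun u => nilVal u hs φ) +
      splitSum fs fun _ l r => splitSum gs fun _ l' r' => splitSum hs fun _ l'' r'' =>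
        sgn k (r.sdeg * l'.sdeg + (r.sdeg + r'.sdeg) * l''.sdeg) •
          braceSum r r' fun u => braceL h u r'' (braceSum l l' fun t => pairTau t l'') := by
  have e₁ : braceSum fs gs (fun u => nilVal u hs φ) = nilVal fs gs (fun u => nilVal u hs φ) := by
    have h₀ : ∀ {y : (tensor C D).Obj} {m : ℤ} (g : (tensor C D).Hom y (pair c₁ d₁) m) t,
        nilVal (.cons g t) hs φ = 0 := fun g t => rfl
    exact braceSum_of_cons_eq_zero fs gs (isMulti_of_cons_eq_zero h₀) h₀
  simp only [braceSum_eq_splitSum₂ _ hs h]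
  rw [braceSum_add, e₁]
  congr 1
  refine (braceSum_splitSum fs gs (fun w r => splitSum_isMulti_param hs fun _ l'' r'' =>
    (((pairTau_isMulti_left _ _ l'').comp (braceL h r r'').isLinear)).smul _)
    fun w l => splitSum_isMulti_param hs fun _ l'' r'' => by
      simp only [mul_comm _ l''.sdeg]
      exact isMulti_smul_sdeg _ (braceSum_isMulti_left r'' (h.consL (pairTau l l'')))).trans ?_
  refine splitSum_congr fun v l r _ => splitSum_congr fun v' l' r' _ => ?_
  simp only [braceSum_splitSum_swap]
  rw [← splitSum_smul]
  refine splitSum_congr fun v'' l'' r'' _ => ?_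
  rw [sgn_add, mul_smul, ← braceSum_smul (sgn k ((r.sdeg + r'.sdeg) * _))]
  refine congrArg _ ((braceSum_comm _ _ _ _ _).trans (braceSum_congr fun u hu => ?_))
  rw [braceSum_smul, ← map_braceSum, hu]

/-- The image of a chain under the associator. -/
def assocChain {c₀ c₁ : C.Obj} {d₀ d₁ : D.Obj} {e₀ e₁ : E.Obj}
    (t : Chain (tensor (tensor C D) E) (pair (pair c₀ d₀) e₀) (pair (pair c₁ d₁) e₁)) :
    Chain (tensor C (tensor D E)) (pair c₀ (pair d₀ e₀)) (pair c₁ (pair d₁ e₁)) :=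
  t.map (assoc C D E)

theorem isMulti_assocChain {c₀ c₁ : C.Obj} {d₀ d₁ : D.Obj} {e₀ e₁ : E.Obj}
    {φ : Chain (tensor C (tensor D E)) (pair c₀ (pair d₀ e₀)) (pair c₁ (pair d₁ e₁)) → M}
    (h : IsMulti φ) : IsMulti fun t => φ (assocChain t) :=
  IsMulti.map (assoc C D E) h

theorem consL_assocChain {c₀ c₁ c₂ : C.Obj} {d₀ d₁ d₂ : D.Obj} {e₀ e₁ e₂ : E.Obj}
    {φ : Chain (tensor C (tensor D E)) (pair c₀ (pair d₀ e₀)) (pair c₂ (pair d₂ e₂)) → M}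
    (h : IsMulti φ)
    (t : Chain (tensor (tensor C D) E) (pair (pair c₀ d₀) e₀) (pair (pair c₁ d₁) e₁))
    (a : Tot (tensor (tensor C D) E) (pair (pair c₁ d₁) e₁) (pair (pair c₂ d₂) e₂)) :
    consL (isMulti_assocChain h) t a = consL h (assocChain t) (assocT a) :=
  consL_map (assoc C D E) h t a

/-- The brace maps are associative up to the associator. -/
theorem braceSum_braceSum_assoc {c₀ c₁ : C.Obj} {d₀ d₁ : D.Obj} {e₀ e₁ : E.Obj}
    (fs : Chain C c₀ c₁) (gs : Chain D d₀ d₁) (hs : Chain E e₀ e₁)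
    {φ : Chain (tensor C (tensor D E)) (pair c₀ (pair d₀ e₀)) (pair c₁ (pair d₁ e₁)) → M}
    (h : IsMulti φ) :
    braceSum fs gs (fun u => braceSum u hs fun t => φ (assocChain t)) =
      braceSum gs hs (fun t => braceSum fs t φ) := by
  have main : ∀ (n : ℕ) (c₁ : C.Obj) (d₁ : D.Obj) (e₁ : E.Obj) (fs : Chain C c₀ c₁)
      (gs : Chain D d₀ d₁) (hs : Chain E e₀ e₁)
      (φ : Chain (tensor C (tensor D E)) (pair c₀ (pair d₀ e₀)) (pair c₁ (pair d₁ e₁)) → M),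
      IsMulti φ → fs.length + gs.length + hs.length < n →
      braceSum fs gs (fun u => braceSum u hs fun t => φ (assocChain t)) =
        braceSum gs hs (fun t => braceSum fs t φ) := by
    intro n
    induction n with
    | zero => exact fun _ _ _ _ _ _ _ _ hn => absurd hn (Nat.not_lt_zero _)
    | succ n ih =>
      intro c₁ d₁ e₁ fs gs hs φ h hn
      rw [braceSum_braceSum_eq fs gs hs h]
      refine (braceSum_braceSum_map_eq fs gs hs (isMulti_assocChain h)).trans ?_
      congr 1
      · cases fs <;> cases gs <;> cases hs <;> rfl
      refine splitSum_congr fun v l r hl => splitSum_congr fun v' l' r' hl' =>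
        splitSum_congr fun v'' l'' r'' hl'' => ?_
      -- In both bracketings the sign is that of moving `l'` past `r`, and `l''` past both `r` and
      -- `r'`.
      refine congrArg₂ (· • ·) (congrArg _ (by ring)) ?_
      have e : braceSum r r' (fun u => braceL (isMulti_assocChain h) u r''
          (braceSum l l' fun t => pairTau t l'')) = braceSum r r' fun u => braceSum u r'' fun t =>
            consL h (assocChain t) (braceSum l' l'' fun u => pairTau l u) := by
        rw [← assocT_braceSum_pairTau]
        refine braceSum_congr fun u _ => (braceL_apply _ _ _ _).trans (braceSum_congr fun t _ => ?_)
        exact consL_assocChain h t _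
      rw [e]
      -- If all three left parts are empty, the stripped morphism is zero; otherwise the remaining
      -- chains are strictly shorter.
      have e₁ : braceSum l' l'' (fun u => pairTau l u) = 0 ∨
          r.length + r'.length + r''.length < n := by
        subst hl hl' hl''
        simp only [Chain.length_append] at hn
        rcases l with _ | ⟨a, l⟩
        · rcases l' with _ | ⟨a, l'⟩
          · rcases l'' with _ | ⟨a, l''⟩
            · left
              rw [braceSum_nil]
              rfl
            all_goals
              right
              simp only [Chain.length] at hn
              omega
          all_goals
            right
            simp only [Chain.length] at hn
            omega
        all_goals
          right
          simp only [Chain.length] at hn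
          omega
      rcases e₁ with e₁ | e₁
      · simp only [e₁, map_zero, braceSum_zero]
      · exact ih _ _ _ r r' r'' _ (h.consL _) e₁
  exact main _ _ _ _ fs gs hs φ h (Nat.lt_succ_self _)

end IteratedBrace

/-! ### The pentagon -/

section Pentagon

variable {B C D E : DGCat.{u} k}

theorem assocT_epsFam_epsFam {c₀ c₁ : C.Obj} {d₀ d₁ : D.Obj} {e₀ e₁ : E.Obj} {m q : ℤ}
    (f : C.Hom c₀ c₁ m) (gs : Chain D d₀ d₁) (hq : m + gs.sdeg = q) (hs : Chain E e₀ e₁) :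
    assocT (epsFam (epsHom f gs hq) e₀ e₁ hs) =
      braceSum gs hs (epsFam f (pair d₀ e₀) (pair d₁ e₁)) := by
  rw [← assocT_epsL_epsFam, ← of_epsHom f gs hq, epsL_of]

theorem assocT_epsFam_right (c : C.Obj) {d₀ d₁ : D.Obj} {e₀ e₁ : E.Obj} {m : ℤ}
    (g : D.Hom d₀ d₁ m) (hs : Chain E e₀ e₁) :
    assocT (epsFam (rightHom (C := C) c g) (pair c e₀).2 e₁ hs) =
      (rightFun (tensor D E) c).tot (epsFam g e₀ e₁ hs) := by
  have := assocT_epsL_right c (of m g) hs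
  rw [DGFunctor.tot_of, epsL_of, epsL_of] at this
  exact this

theorem tensorMap_eps_id {C' : DGCat.{u} k} (F : DGFunctor C C') {c₀ c₁ : C.Obj} {d₀ d₁ : D.Obj}
    {m p : ℤ} (f : C.Hom c₀ c₁ m) (gs : Chain D d₀ d₁) (h : m + gs.sdeg = p) :
    (tensorMap F (𝟙 D)).map (epsHom f gs h) = epsHom (F.map f) gs h :=
  eq_of_heq (epsHom_heq (F.map f) gs.map_id (by rw [Chain.sdeg_map, h]) h)

theorem assocT_assoc_eps_eps {b₀ b₁ : B.Obj} {c₀ c₁ : C.Obj} {d₀ d₁ : D.Obj} {e₀ e₁ : E.Obj}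
    {m q p r : ℤ} (a : B.Hom b₀ b₁ m) (fs : Chain C c₀ c₁) (gs : Chain D d₀ d₁) (hs : Chain E e₀ e₁)
    (hq : m + fs.sdeg = q) (hr : q + gs.sdeg = r) (hp : r + hs.sdeg = p) :
    assocT (of (X := tensor (tensor B C) (tensor D E)) (x := pair (pair b₀ c₀) (pair d₀ e₀))
      (y := pair (pair b₁ c₁) (pair d₁ e₁)) p
      ((assoc (tensor B C) D E).map (epsHom (epsHom (epsHom a fs hq) gs hr) hs hp))) =
    braceSum gs hs fun t => braceSum fs t (epsFam a (pair c₀ (pair d₀ e₀)) (pair c₁ (pair d₁ e₁))) := by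
  refine (congrArg assocT (of_assoc_eps_eps (epsHom a fs hq) gs hs hr hp)).trans ?_
  refine (map_braceSum assocT gs hs _).trans (braceSum_congr fun t _ => ?_)
  exact assocT_epsFam_epsFam a fs hq t

theorem mapT_epsFam_assoc {b₀ b₁ : B.Obj} {c₀ c₁ : C.Obj} {d₀ d₁ : D.Obj} {e₀ e₁ : E.Obj}
    {m : ℤ} (a : B.Hom b₀ b₁ m)
    (t : Chain (tensor (tensor C D) E) (pair (pair c₀ d₀) e₀) (pair (pair c₁ d₁) e₁)) :
    mapT (𝟙 B : DGFunctor B B) (assoc C D E) (epsFam a _ _ t) =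
      epsFam a (pair c₀ (pair d₀ e₀)) (pair c₁ (pair d₁ e₁)) (assocChain t) :=
  tot_epsFam (𝟙 B : DGFunctor B B) (assoc C D E) a t

/-- The path through `B ⊗ ((C ⊗ D) ⊗ E)` first produces the brace of a brace and then applies the
associator to its chains. Associativity of braces rewrites this as the other iterated brace. -/
theorem mapT_assocT_epsHom {b₀ b₁ : B.Obj} {c₀ c₁ : C.Obj} {d₀ d₁ : D.Obj} {e₀ e₁ : E.Obj}
    {m p r : ℤ} (a : B.Hom b₀ b₁ m) (fs : Chain C c₀ c₁) (gs : Chain D d₀ d₁) (hs : Chain E e₀ e₁)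
    {x : (tensor B (tensor C D)).Hom (pair b₀ (pair c₀ d₀)) (pair b₁ (pair c₁ d₁)) r}
    (hx : of r x = braceSum fs gs (epsFam a (pair c₀ d₀) (pair c₁ d₁))) (hp : r + hs.sdeg = p) :
    mapT (𝟙 B : DGFunctor B B) (assoc C D E) (assocT (of p (epsHom x hs hp))) =
      braceSum gs hs fun t => braceSum fs t (epsFam a (pair c₀ (pair d₀ e₀)) (pair c₁ (pair d₁ e₁))) := by
  rw [of_epsHom, ← epsL_of, hx, map_braceSum, map_braceSum, map_braceSum]
  refine Eq.trans (braceSum_congr fun u _ => ?_)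
    (braceSum_braceSum_assoc fs gs hs (epsFam_isMulti a (pair c₀ (pair d₀ e₀)) (pair c₁ (pair d₁ e₁))))
  rw [assocT_epsL_epsFam, map_braceSum]
  exact braceSum_congr fun t _ => mapT_epsFam_assoc a t

theorem assocT_assoc_eps_right (b : B.Obj) {c₀ c₁ : C.Obj} {d₀ d₁ : D.Obj} {e₀ e₁ : E.Obj}
    {m p r : ℤ} (f : C.Hom c₀ c₁ m) (gs : Chain D d₀ d₁) (hs : Chain E e₀ e₁)
    (hr : m + gs.sdeg = r) (hp : r + hs.sdeg = p) :
    assocT (of (X := tensor (tensor B C) (tensor D E)) (x := pair (pair b c₀) (pair d₀ e₀))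
      (y := pair (pair b c₁) (pair d₁ e₁)) p
      ((assoc (tensor B C) D E).map (epsHom (epsHom (rightHom b f) gs hr) hs hp))) =
    (rightFun (tensor C (tensor D E)) b).tot
      (braceSum gs hs (epsFam f (pair d₀ e₀) (pair d₁ e₁))) := by
  refine (congrArg assocT (of_assoc_eps_eps (rightHom b f) gs hs hr hp)).trans ?_
  refine (map_braceSum assocT gs hs _).trans ((braceSum_congr fun t _ => ?_).trans
    (map_braceSum (DGFunctor.tot (rightFun (tensor C (tensor D E)) b)) gs hs _).symm)
  exact assocT_epsFam_right b f t

/-- Compared on four kinds of generators. If some outermost slot is an identity, the defining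
formulas of the associator suffice; the generator nested in three `ε` needs associativity of braces.
-/
theorem pentagon (B C D E : DGCat.{u} k) :
    assoc (tensor B C) D E ≫ assoc B C (tensor D E) =
      tensorMap (assoc B C D) (𝟙 E) ≫ assoc B (tensor C D) E ≫ tensorMap (𝟙 B) (assoc C D E) := by
  refine tensor₄_hom_ext (fun _ => rfl) (fun x e₀ e₁ n g => HEq.rfl) ?_ ?_ ?_
  · rintro ⟨b, c⟩ d₀ d₁ m g e₀ e₁ hs
    refine heq_of_eq ?_
    refine (congrArg (assoc B C (tensor D E)).map
      (assoc_eps_right (C := tensor B C) (pair b c) g hs rfl)).trans (Eq.symm ?_)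
    refine (congrArg (assoc B (tensor C D) E ≫ tensorMap (𝟙 B) (assoc C D E)).map
      (tensorMap_eps_id (assoc B C D) (rightHom (pair b c) g) hs rfl)).trans ?_
    refine (congrArg (tensorMap (𝟙 B) (assoc C D E)).map
      (assoc_eps_right b (rightHom (C := C) c g) hs rfl)).trans ?_
    exact congrArg (rightHom b) (assoc_eps_right c g hs rfl)
  · intro b c₀ c₁ m f d₀ d₁ gs e₀ e₁ hs
    refine heq_of_eq (of_injective (X := tensor B (tensor C (tensor D E))) _ ?_)
    refine (DGFunctor.tot_of (assoc B C (tensor D E)) _ _).symm.trans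
      ((assocT_assoc_eps_right b f gs hs rfl rfl).trans (Eq.symm ?_))
    refine (congrArg (fun a => of _ ((assoc B (tensor C D) E ≫ tensorMap (𝟙 B) (assoc C D E)).map a))
      (tensorMap_eps_id (assoc B C D) (epsHom (rightHom b f) gs rfl) hs rfl)).trans ?_
    refine Eq.trans ?_ (congrArg (rightFun (tensor C (tensor D E)) b).tot
      (of_assoc_eps_eps f gs hs rfl rfl))
    refine Eq.trans ?_ (DGFunctor.tot_of (rightFun (tensor C (tensor D E)) b) _ _).symm
    refine congrArg (of _) ?_
    have h := assoc_eps_right b f gs (rfl : m + gs.sdeg = _)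
    have h' := assoc_eps_right b (epsHom f gs rfl) hs (rfl : m + gs.sdeg + hs.sdeg = _)
    refine (congrArg (fun x => (tensorMap (𝟙 B) (assoc C D E)).map
      ((assoc B (tensor C D) E).map (epsHom x hs rfl))) h).trans ?_
    exact congrArg (tensorMap (𝟙 B) (assoc C D E)).map h'
  · intro b₀ b₁ m a c₀ c₁ fs d₀ d₁ gs e₀ e₁ hs
    refine heq_of_eq (of_injective (X := tensor B (tensor C (tensor D E))) _ ?_)
    refine (DGFunctor.tot_of (assoc B C (tensor D E)) _ _).symm.trans
      ((assocT_assoc_eps_eps a fs gs hs rfl rfl rfl).trans (Eq.symm ?_))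
    refine (congrArg (fun a => of _ ((assoc B (tensor C D) E ≫ tensorMap (𝟙 B) (assoc C D E)).map a))
      (tensorMap_eps_id (assoc B C D) (epsHom (epsHom a fs rfl) gs rfl) hs rfl)).trans ?_
    have h := mapT_assocT_epsHom a fs gs hs (of_assoc_eps_eps a fs gs rfl rfl) rfl
    refine Eq.trans ?_ h
    refine (DGFunctor.tot_of (tensorMap (𝟙 B) (assoc C D E)) _ _).symm.trans ?_
    exact congrArg (tensorMap (𝟙 B) (assoc C D E)).tot
      (DGFunctor.tot_of (assoc B (tensor C D) E) _ _).symm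

end Pentagon

/-! ### Coherence of the functors `Υ` -/

section Coherence

theorem tensorMap_comp_id {C C' C'' D : DGCat.{u} k} (F : C ⟶ C') (F' : C' ⟶ C'') :
    tensorMap (F ≫ F') (𝟙 D) = tensorMap F (𝟙 D) ≫ tensorMap F' (𝟙 D) := by
  rw [← tensorMap_comp, Category.comp_id]

theorem tensorMap_id_comp {C D D' D'' : DGCat.{u} k} (G : D ⟶ D') (G' : D' ⟶ D'') :
    tensorMap (𝟙 C) (G ≫ G') = tensorMap (𝟙 C) G ≫ tensorMap (𝟙 C) G' := by
  rw [← tensorMap_comp, Category.comp_id]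

theorem tensorMap_id_eqToHom (A : DGCat.{u} k) {Q Q' : DGCat.{u} k} (e : Q = Q')
    (e' : tensor A Q = tensor A Q') : tensorMap (𝟙 A) (eqToHom e) = eqToHom e' := by
  subst e
  exact tensorMap_id A Q

/-- The inductive step of `upsilonTwo_append`, with the iterated tensor products replaced by
arbitrary dg categories. Naturality moves `x` and `z` past associators, the hypothesis is used under
`A ⊗ -`, and the remaining three associators are replaced by two through the pentagon. -/
theorem assoc_step {A U T S TU ST Q Q' : DGCat.{u} k} (x : tensor U T ⟶ TU) (y : tensor TU S ⟶ Q')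
    (z : tensor T S ⟶ ST) (w : tensor U ST ⟶ Q) (e : Q = Q') (e' : tensor A Q = tensor A Q')
    (ih : tensorMap x (𝟙 S) ≫ y = assoc U T S ≫ tensorMap (𝟙 U) z ≫ w ≫ eqToHom e) :
    tensorMap (assoc A U T ≫ tensorMap (𝟙 A) x) (𝟙 S) ≫ assoc A TU S ≫ tensorMap (𝟙 A) y =
      assoc (tensor A U) T S ≫ tensorMap (𝟙 (tensor A U)) z ≫
        (assoc A U ST ≫ tensorMap (𝟙 A) w) ≫ eqToHom e' := by
  have h₁ := assoc_natural (𝟙 A) x (𝟙 S)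
  have h₂ := assoc_natural (𝟙 A) (𝟙 U) z
  rw [tensorMap_id] at h₂
  rw [tensorMap_comp_id, Category.assoc, ← Category.assoc (tensorMap (tensorMap (𝟙 A) x) (𝟙 S)), h₁,
    Category.assoc, ← tensorMap_id_comp, ih]
  simp only [tensorMap_id_comp, Category.assoc]
  rw [← Category.assoc (tensorMap (𝟙 (tensor A U)) z), h₂, tensorMap_id_eqToHom A e e',
    Category.assoc, ← Category.assoc (assoc (tensor A U) T S), pentagon]
  simp only [Category.assoc]

/-- The associators as a family. -/
abbrev assocFamily (k : Type u) [Field k] : AssocFamily k := fun C D E => assoc C D E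

theorem comp_eqToHom_eq {P Q Q' Q'' : DGCat.{u} k} (f : P ⟶ Q) (e : Q = Q'') (e₁ : Q = Q')
    (e₂ : Q' = Q'') : f ≫ eqToHom e = (f ≫ eqToHom e₁) ≫ eqToHom e₂ := by
  rw [Category.assoc, eqToHom_trans]

variable {ι : Type*} (X : ι → DGCat.{u} k)

/-- Coherence for three blocks: joining `t, u` first or `s, t` first gives the same functor. The
`eqToHom` is needed because associativity of concatenation is an equality of sequences that is not
definitional for variable `u`. -/
theorem upsilonTwo_append (s t : NSeq ι) : ∀ u : NSeq ι,
    tensorMap (upsilonTwo (assocFamily k) X t u) (𝟙 (iterTensor X s)) ≫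
        upsilonTwo (assocFamily k) X s (t.append u) =
      assoc (iterTensor X u) (iterTensor X t) (iterTensor X s) ≫
        tensorMap (𝟙 (iterTensor X u)) (upsilonTwo (assocFamily k) X s t) ≫
          upsilonTwo (assocFamily k) X (s.append t) u ≫
            eqToHom (congrArg (iterTensor X) (NSeq.append_assoc s t u))
  | .single b => by
    have h : tensorMap (𝟙 (tensor (X b) (iterTensor X t))) (𝟙 (iterTensor X s)) = 𝟙 _ :=
      tensorMap_id _ _
    exact congrArg (· ≫ (assoc (X b) (iterTensor X t) (iterTensor X s) ≫
      tensorMap (𝟙 (X b)) (upsilonTwo (assocFamily k) X s t))) h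
  | .snoc u b => assoc_step (A := X b) (upsilonTwo (assocFamily k) X t u)
      (upsilonTwo (assocFamily k) X s (t.append u)) (upsilonTwo (assocFamily k) X s t)
      (upsilonTwo (assocFamily k) X (s.append t) u) _ _ (upsilonTwo_append s t u)

theorem upsilonTwo_eqToHom (α : AssocFamily k) {s s' : NSeq ι} (t : NSeq ι) (h : s = s') :
    tensorMap (𝟙 (iterTensor X t)) (eqToHom (congrArg (iterTensor X) h)) ≫ upsilonTwo α X s' t =
      upsilonTwo α X s t ≫ eqToHom (congrArg (fun s => iterTensor X (s.append t)) h) := by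
  subst h
  rw [eqToHom_refl, eqToHom_refl, tensorMap_id, Category.id_comp, Category.comp_id]

/-- The inductive step of `upsilonTwo_upsilon` in abstract form: naturality of the associator moves
`f` and `g`, `hb` is three-block coherence, and `hd` carries the transport through the last join. -/
theorem upsilon_step {A T S T' S' Y Z Q Q₁ Q₂ AT : DGCat.{u} k} (p : tensor T S ⟶ Y)
    (q : Y ⟶ Z) (f : T ⟶ T') (g : S ⟶ S') (c : tensor T' S' ⟶ Q) (e : Q = Z)
    (d : tensor A Z ⟶ Q₁) (a : tensor A T' ⟶ AT) (b : tensor AT S' ⟶ Q₂)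
    (d' : tensor A Q ⟶ Q₂) (e₁ : Q₂ = Q₁)
    (ih : p ≫ q = tensorMap f g ≫ c ≫ eqToHom e)
    (hb : tensorMap a (𝟙 S') ≫ b = assoc A T' S' ≫ tensorMap (𝟙 A) c ≫ d')
    (hd : tensorMap (𝟙 A) (eqToHom e) ≫ d = d' ≫ eqToHom e₁) :
    (assoc A T S ≫ tensorMap (𝟙 A) p) ≫ tensorMap (𝟙 A) q ≫ d =
      tensorMap (tensorMap (𝟙 A) f ≫ a) g ≫ b ≫ eqToHom e₁ := by
  have h₁ : tensorMap (tensorMap (𝟙 A) f ≫ a) g =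
      tensorMap (tensorMap (𝟙 A) f) g ≫ tensorMap a (𝟙 S') := by
    rw [← tensorMap_comp, Category.comp_id]
  have h₂ := assoc_natural (𝟙 A) f g
  rw [h₁, Category.assoc, Category.assoc, ← Category.assoc (tensorMap a (𝟙 S')), hb,
    Category.assoc, Category.assoc, ← hd, ← Category.assoc (tensorMap _ g), h₂, Category.assoc,
    ← Category.assoc (tensorMap (𝟙 A) p), ← tensorMap_id_comp, ih]
  simp only [tensorMap_id_comp, Category.assoc]

/-- Concatenating two sequences of blocks and then joining everything agrees with joining each
sequence first and then the two results. -/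
theorem upsilonTwo_upsilon (S : NSeq (NSeq ι)) : ∀ T : NSeq (NSeq ι),
    upsilonTwo (assocFamily k) (iterTensor X) S T ≫ upsilon (assocFamily k) X (S.append T) =
      tensorMap (upsilon (assocFamily k) X T) (upsilon (assocFamily k) X S) ≫
        upsilonTwo (assocFamily k) X S.join T.join ≫
          eqToHom (congrArg (iterTensor X) (NSeq.join_append S T).symm)
  | .single t => rfl
  | .snoc T t => by
    have hd := upsilonTwo_eqToHom X (assocFamily k) t (NSeq.join_append S T).symm
    have hb := upsilonTwo_append X S.join T.join t
    refine (upsilon_step (A := iterTensor X t) _ _ _ _ _ _ _ _ _ (upsilonTwo (assocFamily k) X (S.join.append T.join) t ≫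
            eqToHom (congrArg (iterTensor X) (NSeq.append_assoc S.join T.join t))) _ (upsilonTwo_upsilon S T) hb ?_)
    exact hd.trans (comp_eqToHom_eq _ _ _ _)

theorem whisker_step {A A' P P' P'' Q Q' R R' : DGCat.{u} k} (f : A ⟶ A') (x : P ⟶ P') (y : P' ⟶ Q)
    (e : Q = Q') (z : P ⟶ P'') (w : P'' ⟶ Q') (c : tensor A' Q ⟶ R) (c' : tensor A' Q' ⟶ R')
    (e' : R = R') (ih : x ≫ y ≫ eqToHom e = z ≫ w)
    (hc : tensorMap (𝟙 A') (eqToHom e) ≫ c' = c ≫ eqToHom e') :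
    tensorMap f x ≫ (tensorMap (𝟙 A') y ≫ c) ≫ eqToHom e' =
      tensorMap (𝟙 A) z ≫ tensorMap f w ≫ c' := by
  rw [Category.assoc, ← hc, ← Category.assoc (tensorMap (𝟙 A) z), ← tensorMap_comp, ← ih]
  simp only [← Category.assoc, ← tensorMap_comp, Category.id_comp, Category.comp_id]

/-- The coherence statement for arbitrary factors `X`. In the inductive step the earlier sequences
are handled by the hypothesis, tensored with the functor for the last sequence `S`, and
`upsilonTwo_upsilon` joins the two parts. -/
theorem iterTensorMap_upsilon : ∀ 𝔻 : NSeq (NSeq (NSeq ι)),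
    iterTensorMap (X := iterTensor (iterTensor X)) (Y := iterTensor X)
        (upsilon (assocFamily k) X) 𝔻 ≫
      upsilon (assocFamily k) X (𝔻.map NSeq.join) ≫
        eqToHom (congrArg (iterTensor X) (NSeq.join_map_join 𝔻)) =
    upsilon (assocFamily k) (iterTensor X) 𝔻 ≫ upsilon (assocFamily k) X 𝔻.join
  | .single S => rfl
  | .snoc 𝔻 S => by
    have hc := upsilonTwo_eqToHom X (assocFamily k) S.join (NSeq.join_map_join 𝔻)
    have h := whisker_step (upsilon (assocFamily k) X S) _ _ _ _ _
      (upsilonTwo (assocFamily k) X (𝔻.map NSeq.join).join S.join)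
      (upsilonTwo (assocFamily k) X 𝔻.join.join S.join ≫
        eqToHom (congrArg (iterTensor X) (NSeq.join_append 𝔻.join S).symm))
      (congrArg (iterTensor X) (NSeq.join_map_join (.snoc 𝔻 S))) (iterTensorMap_upsilon 𝔻)
      ((Category.assoc _ _ _).symm.trans ((congrArg (· ≫ eqToHom _) hc).trans
        (comp_eqToHom_eq _ _ _ _).symm))
    refine h.trans ?_
    refine Eq.trans ?_ (Category.assoc _ _ _).symm
    exact congrArg (tensorMap (𝟙 _) _ ≫ ·) (upsilonTwo_upsilon X 𝔻.join S).symm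

end Coherence

end TwistedTensor

theorem proposition4p1 (k : Type u) [Field k] :
    ∃ α : TwistedTensor.AssocFamily k,
      (∀ (C D E : TwistedTensor.DGCat.{u} k)
        (F : TwistedTensor.tensor (TwistedTensor.tensor C D) E ⟶
          TwistedTensor.tensor C (TwistedTensor.tensor D E)),
        TwistedTensor.IsAssociator F ↔ F = α C D E) ∧
      ∀ 𝔻 : TwistedTensor.NSeq (TwistedTensor.NSeq TwistedTensor.Disk),
        TwistedTensor.upsilonOne α 𝔻 ≫
            eqToHom (congrArg (TwistedTensor.diskCat k) (TwistedTensor.NSeq.join_map_join 𝔻)) =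
          TwistedTensor.upsilonTwoStep α 𝔻 := by
  refine ⟨TwistedTensor.assocFamily k, fun C D E F => TwistedTensor.isAssociator_iff F, fun 𝔻 => ?_⟩
  -- The disk categories are iterated tensor products of intervals by definition, so only the
  -- bracketing of the composite has to be adjusted.
  exact (Category.assoc _ _ _).trans
    (TwistedTensor.iterTensorMap_upsilon (fun n : ℕ+ => TwistedTensor.interval k n) 𝔻)
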